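/- Throughout, "2-category" means bicategory (weak 2-category), and a monoidal 2-category is a bicategory $\mathfrak{C}$ with a pseudofunctor $\Box:\mathfrak{C}\times\mathfrak{C}\to\mathfrak{C}$, a unit object $I$, pseudonatural adjoint equivalences $\alpha:(A\Box B)\Box C\simeq A\Box(B\Box C)$, $l:I\Box A\simeq A$, $r:A\Box I\simeq A$, a pentagonator and three 2-unitors (invertible modifications), satisfying the usual axioms (that is, a tricategory with one object). No linearity is assumed. A right dual of an object $C$ of $\mathfrak{C}$ is an object $C^\sharp$ with 1-morphisms $e_C:C\Box C^\sharp\to I$ and $i_C:I\to C^\sharp\Box C$ such that the two snake composites $C\to C\Box I\to C\Box(C^\sharp\Box C)\to(C\Box C^\sharp)\Box C\to I\Box C\to C$ and $C^\sharp\to I\Box C^\sharp\to(C^\sharp\Box C)\Box C^\sharp\to C^\sharp\Box(C\Box C^\sharp)\to C^\sharp\Box I\to C^\sharp$ are isomorphic to the identity 1-morphisms. A 2-condensation $(A,B,f,g,\phi,\gamma)$ consists of 1-morphisms $f:A\to B$, $g:B\to A$ and 2-morphisms $\phi:f\circ g\Rightarrow Id_B$, $\gamma:Id_B\Rightarrow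 f\circ g$ with $\phi\cdot\gamma=Id_{Id_B}$. A 2-condensation monad $(A,e,\mu,\delta)$ consists of a 1-morphism $e:A\to A$, an associative 2-morphism $\mu:e\circ e\Rightarrow e$ and a coassociative 2-morphism $\delta:e\Rightarrow e\circ e$ (no unit or counit is required) such that the Frobenius relations $(e\circ\mu)\cdot(\delta\circ e)=\delta\cdot\mu=(\mu\circ e)\cdot(e\circ\delta)$ hold (associativity constraints suppressed) and $\mu\cdot\delta=Id_e$. A splitting of $(A,e,\mu,\delta)$ is a 2-condensation $(A,B,f,g,\phi,\gamma)$ together with an invertible 2-morphism $\theta:g\circ f\cong e$ which identifies $g\circ\phi\circ f$ with $\mu$ and $g\circ\gamma\circ f$ with $\delta$; the object $B$ is also called the splitting. Lemma. Let $\mathfrak{C}$ be a monoidal 2-category that is locally idempotent complete (in every category $Hom_{\mathfrak{C}}(A,B)$ all idempotents split) and in which every 2-condensation monad splits. Let $C$ be an object of $\mathfrak{C}$ that has a right dual, and let $(C,e,\mu,\delta)$ be a 2-condensation monad on $C$. Then, for every splitting of $(C,e,\mu,\delta)$, the object $B$ onto which $C$ is condensed has a right dual. -/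

import Mathlib

open CategoryTheory Bicategory
open scoped CategoryTheory.Pseudofunctor.StrongTrans CategoryTheory.Prod

universe w v u w₁ v₁ u₁ w₂ v₂ u₂ w₃ v₃ u₃ w₄ v₄ u₄

noncomputable section

namespace TwoCat

/-! ### Products of pseudofunctors -/

section Products

variable {B : Type u₁} [Bicategory.{w₁, v₁} B] {C : Type u₂} [Bicategory.{w₂, v₂} C]
  {D : Type u₃} [Bicategory.{w₃, v₃} D] {E : Type u₄} [Bicategory.{w₄, v₄} E]

/-- The product `F × G : B × D ⥤ᵖ C × E` of two pseudofunctors. -/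
@[simps]
def prodMap (F : B ⥤ᵖ C) (G : D ⥤ᵖ E) : (B × D) ⥤ᵖ (C × E) where
  obj X := (F.obj X.1, G.obj X.2)
  map f := F.map f.1 ×ₘ G.map f.2
  map₂ η := F.map₂ η.1 ×ₘ G.map₂ η.2
  mapId X := Iso.prod (F.mapId X.1) (G.mapId X.2)
  mapComp f g := Iso.prod (F.mapComp f.1 g.1) (G.mapComp f.2 g.2)

variable (B C D)

/-- The (strict) reparenthesizing pseudofunctor `(B × C) × D ⥤ᵖ B × (C × D)`. -/
@[simps]
def prodAssoc : ((B × C) × D) ⥤ᵖ (B × (C × D)) where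
  obj X := (X.1.1, (X.1.2, X.2))
  map f := f.1.1 ×ₘ (f.1.2 ×ₘ f.2)
  map₂ η := η.1.1 ×ₘ (η.1.2 ×ₘ η.2)
  mapId X := Iso.refl _
  mapComp f g := Iso.refl _

end Products


/-! ### Monoidal 2-categories

A monoidal 2-category (monoidal bicategory, i.e. tricategory with one object) consists of a
bicategory `B`, a tensor pseudofunctor `B × B ⥤ᵖ B`, a unit object, adjoint equivalences
`(a ⊠ b) ⊠ c ≌ a ⊠ (b ⊠ c)`, `I ⊠ a ≌ a`, `a ⊠ I ≌ a` in the bicategories of pseudofunctors, and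
invertible modifications `π`, `μ`, `λ`, `ρ` subject to three axioms.  We first collect the data
down to the adjoint equivalences. -/

/-- The tensor product, unit, associator and unitors of a monoidal 2-category.  The last three are
adjoint equivalences in bicategories of pseudofunctors, pseudonatural transformations and
modifications. -/
structure MonoidalData (B : Type u) [Bicategory.{w, v} B] where
  /-- the tensor product -/
  tensor : (B × B) ⥤ᵖ B
  /-- the unit object -/
  unit : B
  /-- the associator `(a ⊠ b) ⊠ c ≌ a ⊠ (b ⊠ c)` -/
  associator : (prodMap tensor (Pseudofunctor.id B)).comp tensor ≌
    ((prodAssoc B B B).comp (prodMap (Pseudofunctor.id B) tensor)).comp tensor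
  /-- the left unitor `I ⊠ a ≌ a` -/
  leftUnitor : (Prod.sectR unit B).toPseudofunctor.comp tensor ≌ Pseudofunctor.id B
  /-- the right unitor `a ⊠ I ≌ a` -/
  rightUnitor : (Prod.sectL B unit).toPseudofunctor.comp tensor ≌ Pseudofunctor.id B

section Squares

variable {B : Type u} [Bicategory.{w, v} B]

/-- Vertical pasting of two invertible squares
`f ≫ p' ≅ p ≫ g` and `g ≫ q' ≅ q ≫ h`. -/
def paste {a a' b b' c c' : B} {f : a ⟶ a'} {g : b ⟶ b'} {h : c ⟶ c'}
    {p : a ⟶ b} {p' : a' ⟶ b'} {q : b ⟶ c} {q' : b' ⟶ c'}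
    (σ : f ≫ p' ≅ p ≫ g) (τ : g ≫ q' ≅ q ≫ h) : f ≫ (p' ≫ q') ≅ (p ≫ q) ≫ h :=
  (α_ f p' q').symm ≪≫ whiskerRightIso σ q' ≪≫ α_ p g q' ≪≫
    whiskerLeftIso p τ ≪≫ (α_ p q h).symm

end Squares

namespace MonoidalData

variable {B : Type u} [Bicategory.{w, v} B] (T : MonoidalData B)

/-- The tensor product `a ⊠ b` of objects. -/
abbrev obj (a b : B) : B := T.tensor.obj (a, b)

/-- The tensor product `f ⊠ g` of 1-morphisms. -/
abbrev map {a a' b b' : B} (f : a ⟶ a') (g : b ⟶ b') : T.obj a b ⟶ T.obj a' b' :=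
  T.tensor.map (f ×ₘ g)

/-- The tensor product of invertible 2-morphisms. -/
abbrev map₂Iso {a a' b b' : B} {f f' : a ⟶ a'} {g g' : b ⟶ b'} (η : f ≅ f') (θ : g ≅ g') :
    T.map f g ≅ T.map f' g' :=
  T.tensor.map₂Iso (Iso.prod η θ)

/-- The interchange constraint `(f ≫ f') ⊠ (g ≫ g') ≅ (f ⊠ g) ≫ (f' ⊠ g')`. -/
abbrev mapComp {a a' a'' b b' b'' : B} (f : a ⟶ a') (f' : a' ⟶ a'') (g : b ⟶ b')
    (g' : b' ⟶ b'') : T.map (f ≫ f') (g ≫ g') ≅ T.map f g ≫ T.map f' g' :=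
  T.tensor.mapComp (f ×ₘ g) (f' ×ₘ g')

/-- The unit constraint `𝟙 a ⊠ 𝟙 b ≅ 𝟙 (a ⊠ b)`. -/
abbrev mapId (a b : B) : T.map (𝟙 a) (𝟙 b) ≅ 𝟙 (T.obj a b) :=
  T.tensor.mapId (a, b)

/-- `a ⊠ f`, that is `𝟙 a ⊠ f`. -/
abbrev wl (a : B) {b b' : B} (f : b ⟶ b') : T.obj a b ⟶ T.obj a b' := T.map (𝟙 a) f

/-- `f ⊠ b`, that is `f ⊠ 𝟙 b`. -/
abbrev wr {a a' : B} (f : a ⟶ a') (b : B) : T.obj a b ⟶ T.obj a' b := T.map f (𝟙 b)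

/-- `a ⊠ -` on invertible 2-morphisms. -/
abbrev wl₂ (a : B) {b b' : B} {f f' : b ⟶ b'} (η : f ≅ f') : T.wl a f ≅ T.wl a f' :=
  T.map₂Iso (Iso.refl (𝟙 a)) η

/-- `- ⊠ b` on invertible 2-morphisms. -/
abbrev wr₂ {a a' : B} {f f' : a ⟶ a'} (η : f ≅ f') (b : B) : T.wr f b ≅ T.wr f' b :=
  T.map₂Iso η (Iso.refl (𝟙 b))

/-- `a ⊠ (f ≫ g) ≅ (a ⊠ f) ≫ (a ⊠ g)`. -/
abbrev wlComp (a : B) {b b' b'' : B} (f : b ⟶ b') (g : b' ⟶ b'') :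
    T.wl a (f ≫ g) ≅ T.wl a f ≫ T.wl a g :=
  T.map₂Iso (λ_ (𝟙 a)).symm (Iso.refl _) ≪≫ T.mapComp (𝟙 a) (𝟙 a) f g

/-- `(f ≫ g) ⊠ b ≅ (f ⊠ b) ≫ (g ⊠ b)`. -/
abbrev wrComp {a a' a'' : B} (f : a ⟶ a') (g : a' ⟶ a'') (b : B) :
    T.wr (f ≫ g) b ≅ T.wr f b ≫ T.wr g b :=
  T.map₂Iso (Iso.refl _) (λ_ (𝟙 b)).symm ≪≫ T.mapComp f g (𝟙 b) (𝟙 b)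

/-- The tensor product `σ ⊠ k` of an invertible square `f ≫ p' ≅ p ≫ f'` with a 1-morphism. -/
def squareTensor {a a' c c' d d' : B} {f : a ⟶ a'} {f' : c ⟶ c'} {p : a ⟶ c} {p' : a' ⟶ c'}
    (σ : f ≫ p' ≅ p ≫ f') (k : d ⟶ d') :
    T.map f k ≫ T.wr p' d' ≅ T.wr p d ≫ T.map f' k :=
  (T.mapComp f p' k (𝟙 d')).symm ≪≫ T.map₂Iso σ (ρ_ k ≪≫ (λ_ k).symm) ≪≫
    T.mapComp p f' (𝟙 d) k

/-- The tensor product `k ⊠ σ` of a 1-morphism with an invertible square `f ≫ p' ≅ p ≫ f'`. -/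
def tensorSquare {a a' c c' d d' : B} {f : a ⟶ a'} {f' : c ⟶ c'} {p : a ⟶ c} {p' : a' ⟶ c'}
    (k : d ⟶ d') (σ : f ≫ p' ≅ p ≫ f') :
    T.map k f ≫ T.wl d' p' ≅ T.wl d p ≫ T.map k f' :=
  (T.mapComp k (𝟙 d') f p').symm ≪≫ T.map₂Iso (ρ_ k ≪≫ (λ_ k).symm) σ ≪≫
    T.mapComp (𝟙 d) k p f'

/-- The component `(a ⊠ b) ⊠ c ⟶ a ⊠ (b ⊠ c)` of the associator. -/
abbrev as (a b c : B) : T.obj (T.obj a b) c ⟶ T.obj a (T.obj b c) :=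
  T.associator.hom.app ((a, b), c)

/-- The component `a ⊠ (b ⊠ c) ⟶ (a ⊠ b) ⊠ c` of the inverse associator. -/
abbrev asInv (a b c : B) : T.obj a (T.obj b c) ⟶ T.obj (T.obj a b) c :=
  T.associator.inv.app ((a, b), c)

/-- The component `I ⊠ a ⟶ a` of the left unitor. -/
abbrev lu (a : B) : T.obj T.unit a ⟶ a := T.leftUnitor.hom.app a

/-- The component `a ⟶ I ⊠ a` of the inverse left unitor. -/
abbrev luInv (a : B) : a ⟶ T.obj T.unit a := T.leftUnitor.inv.app a

/-- The component `a ⊠ I ⟶ a` of the right unitor. -/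
abbrev ru (a : B) : T.obj a T.unit ⟶ a := T.rightUnitor.hom.app a

/-- The component `a ⟶ a ⊠ I` of the inverse right unitor. -/
abbrev ruInv (a : B) : a ⟶ T.obj a T.unit := T.rightUnitor.inv.app a

/-- Pseudonaturality of the associator. -/
abbrev asNat {a a' b b' c c' : B} (f : a ⟶ a') (g : b ⟶ b') (h : c ⟶ c') :
    T.map (T.map f g) h ≫ T.as a' b' c' ≅ T.as a b c ≫ T.map f (T.map g h) :=
  T.associator.hom.naturality ((f ×ₘ g) ×ₘ h)

/-- Pseudonaturality of the left unitor. -/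
abbrev luNat {a a' : B} (f : a ⟶ a') : T.wl T.unit f ≫ T.lu a' ≅ T.lu a ≫ f :=
  T.leftUnitor.hom.naturality f

/-- Pseudonaturality of the right unitor. -/
abbrev ruNat {a a' : B} (f : a ⟶ a') : T.wr f T.unit ≫ T.ru a' ≅ T.ru a ≫ f :=
  T.rightUnitor.hom.naturality f

/-- The long side of the pentagon. -/
abbrev pentL (a b c d : B) :
    T.obj (T.obj (T.obj a b) c) d ⟶ T.obj a (T.obj b (T.obj c d)) :=
  T.wr (T.as a b c) d ≫ T.as a (T.obj b c) d ≫ T.wl a (T.as b c d)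

/-- The short side of the pentagon. -/
abbrev pentR (a b c d : B) :
    T.obj (T.obj (T.obj a b) c) d ⟶ T.obj a (T.obj b (T.obj c d)) :=
  T.as (T.obj a b) c d ≫ T.as a b (T.obj c d)

variable {a a' b b' c c' d d' : B}

/-- Pseudonaturality of the long side of the pentagon. -/
def pentLNat (f : a ⟶ a') (g : b ⟶ b') (h : c ⟶ c') (k : d ⟶ d') :
    T.map (T.map (T.map f g) h) k ≫ T.pentL a' b' c' d' ≅
      T.pentL a b c d ≫ T.map f (T.map g (T.map h k)) :=
  paste (T.squareTensor (T.asNat f g h) k)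
    (paste (T.asNat f (T.map g h) k) (T.tensorSquare f (T.asNat g h k)))

/-- Pseudonaturality of the short side of the pentagon. -/
def pentRNat (f : a ⟶ a') (g : b ⟶ b') (h : c ⟶ c') (k : d ⟶ d') :
    T.map (T.map (T.map f g) h) k ≫ T.pentR a' b' c' d' ≅
      T.pentR a b c d ≫ T.map f (T.map g (T.map h k)) :=
  paste (T.asNat (T.map f g) h k) (T.asNat f g (T.map h k))

/-- Pseudonaturality of `(a ⊠ I) ⊠ b ⟶ a ⊠ (I ⊠ b) ⟶ a ⊠ b`. -/
def middleNat (f : a ⟶ a') (g : b ⟶ b') :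
    T.map (T.wr f T.unit) g ≫ (T.as a' T.unit b' ≫ T.wl a' (T.lu b')) ≅
      (T.as a T.unit b ≫ T.wl a (T.lu b)) ≫ T.map f g :=
  paste (T.asNat f (𝟙 T.unit) g) (T.tensorSquare f (T.luNat g))

/-- Pseudonaturality of `(I ⊠ a) ⊠ b ⟶ I ⊠ (a ⊠ b) ⟶ a ⊠ b`. -/
def leftNat (f : a ⟶ a') (g : b ⟶ b') :
    T.map (T.wl T.unit f) g ≫ (T.as T.unit a' b' ≫ T.lu (T.obj a' b')) ≅
      (T.as T.unit a b ≫ T.lu (T.obj a b)) ≫ T.map f g :=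
  paste (T.asNat (𝟙 T.unit) f g) (T.luNat (T.map f g))

/-- Pseudonaturality of `(a ⊠ b) ⊠ I ⟶ a ⊠ (b ⊠ I) ⟶ a ⊠ b`. -/
def rightNat (f : a ⟶ a') (g : b ⟶ b') :
    T.map (T.map f g) (𝟙 T.unit) ≫ (T.as a' b' T.unit ≫ T.wl a' (T.ru b')) ≅
      (T.as a b T.unit ≫ T.wl a (T.ru b)) ≫ T.map f g :=
  paste (T.asNat f g (𝟙 T.unit)) (T.tensorSquare f (T.ruNat g))

/-- `((𝟙 ⊠ 𝟙) ⊠ h) ≫ α ≅ α ≫ (𝟙 ⊠ (𝟙 ⊠ h))` with `𝟙 ⊠ 𝟙` replaced by the identity. -/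
def asNat₃ (a b : B) (h : c ⟶ c') :
    T.wl (T.obj a b) h ≫ T.as a b c' ≅ T.as a b c ≫ T.wl a (T.wl b h) :=
  whiskerRightIso (T.map₂Iso (T.mapId a b).symm (Iso.refl h)) _ ≪≫ T.asNat (𝟙 a) (𝟙 b) h

/-- `((f ⊠ 𝟙) ⊠ 𝟙) ≫ α ≅ α ≫ (f ⊠ (𝟙 ⊠ 𝟙))` with `𝟙 ⊠ 𝟙` replaced by the identity. -/
def asNat₁ (f : a ⟶ a') (b c : B) :
    T.wr (T.wr f b) c ≫ T.as a' b c ≅ T.as a b c ≫ T.wr f (T.obj b c) :=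
  T.asNat f (𝟙 b) (𝟙 c) ≪≫ whiskerLeftIso _ (T.map₂Iso (Iso.refl f) (T.mapId b c))

/-- `((𝟙 ⊠ g) ⊠ 𝟙) ≫ α ≅ α ≫ (𝟙 ⊠ (g ⊠ 𝟙))`. -/
abbrev asNat₂ (a : B) (g : b ⟶ b') (c : B) :
    T.wr (T.wl a g) c ≫ T.as a b' c ≅ T.as a b c ≫ T.wl a (T.wr g c) :=
  T.asNat (𝟙 a) g (𝟙 c)

/-- `(f ≫ g ≫ h) ⊠ b ≅ (f ⊠ b) ≫ (g ⊠ b) ≫ (h ⊠ b)`. -/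
abbrev wrComp₃ {a₀ a₁ a₂ a₃ : B} (f : a₀ ⟶ a₁) (g : a₁ ⟶ a₂) (h : a₂ ⟶ a₃) (b : B) :
    T.wr (f ≫ g ≫ h) b ≅ T.wr f b ≫ T.wr g b ≫ T.wr h b :=
  T.wrComp f (g ≫ h) b ≪≫ whiskerLeftIso _ (T.wrComp g h b)

/-- `a ⊠ (f ≫ g ≫ h) ≅ (a ⊠ f) ≫ (a ⊠ g) ≫ (a ⊠ h)`. -/
abbrev wlComp₃ (a : B) {b₀ b₁ b₂ b₃ : B} (f : b₀ ⟶ b₁) (g : b₁ ⟶ b₂) (h : b₂ ⟶ b₃) :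
    T.wl a (f ≫ g ≫ h) ≅ T.wl a f ≫ T.wl a g ≫ T.wl a h :=
  T.wlComp a f (g ≫ h) ≪≫ whiskerLeftIso _ (T.wlComp a g h)

/-- The remaining data and the axioms of a monoidal 2-category: the invertible modifications
`π`, `μ`, `λ`, `ρ`, the associahedron axiom (the two ways around the associahedron on five objects
agree) and the two normalization axioms. The operation `⊗≫` is vertical composition of 2-morphisms
up to the associativity and unit constraints of the bicategory `B`. -/
structure Coherence where
  /-- The pentagonator `π`. -/
  pentagonator (a b c d : B) : T.pentL a b c d ≅ T.pentR a b c d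
  /-- The pentagonator is a modification. -/
  pentagonator_naturality {a a' b b' c c' d d' : B}
    (f : a ⟶ a') (g : b ⟶ b') (h : c ⟶ c') (k : d ⟶ d') :
    T.map (T.map (T.map f g) h) k ◁ (pentagonator a' b' c' d').hom ≫ (T.pentRNat f g h k).hom =
      (T.pentLNat f g h k).hom ≫ (pentagonator a b c d).hom ▷ T.map f (T.map g (T.map h k))
  /-- The middle 2-unitor `μ`. -/
  middle (a b : B) : T.as a T.unit b ≫ T.wl a (T.lu b) ≅ T.wr (T.ru a) b
  /-- The middle 2-unitor is a modification. -/
  middle_naturality {a a' b b' : B} (f : a ⟶ a') (g : b ⟶ b') :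
    T.map (T.wr f T.unit) g ◁ (middle a' b').hom ≫ (T.squareTensor (T.ruNat f) g).hom =
      (T.middleNat f g).hom ≫ (middle a b).hom ▷ T.map f g
  /-- The left 2-unitor `λ`. -/
  left (a b : B) : T.wr (T.lu a) b ≅ T.as T.unit a b ≫ T.lu (T.obj a b)
  /-- The left 2-unitor is a modification. -/
  left_naturality {a a' b b' : B} (f : a ⟶ a') (g : b ⟶ b') :
    T.map (T.wl T.unit f) g ◁ (left a' b').hom ≫ (T.leftNat f g).hom =
      (T.squareTensor (T.luNat f) g).hom ≫ (left a b).hom ▷ T.map f g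
  /-- The right 2-unitor `ρ`. -/
  right (a b : B) : T.ru (T.obj a b) ≅ T.as a b T.unit ≫ T.wl a (T.ru b)
  /-- The right 2-unitor is a modification. -/
  right_naturality {a a' b b' : B} (f : a ⟶ a') (g : b ⟶ b') :
    T.wr (T.map f g) T.unit ◁ (right a' b').hom ≫ (T.rightNat f g).hom =
      (T.ruNat (T.map f g)).hom ≫ (right a b).hom ▷ T.map f g
  /-- The associahedron axiom. -/
  associahedron (a b c d e : B) :
    ((T.wrComp₃ (T.wr (T.as a b c) d) (T.as a (T.obj b c) d) (T.wl a (T.as b c d)) e).inv ≫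
          (T.wr₂ (pentagonator a b c d) e).hom ≫
          (T.wrComp (T.as (T.obj a b) c d) (T.as a b (T.obj c d)) e).hom) ▷
        (T.as a (T.obj b (T.obj c d)) e ≫ T.wl a (T.as b (T.obj c d) e) ≫
          T.wl a (T.wl b (T.as c d e))) ⊗≫
      T.wr (T.as (T.obj a b) c d) e ◁ (pentagonator a b (T.obj c d) e).hom ▷
        T.wl a (T.wl b (T.as c d e)) ⊗≫
      (T.wr (T.as (T.obj a b) c d) e ≫ T.as (T.obj a b) (T.obj c d) e) ◁
        (T.asNat₃ a b (T.as c d e)).inv ⊗≫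
      (pentagonator (T.obj a b) c d e).hom ▷ T.as a b (T.obj c (T.obj d e)) =
    𝟙 ((T.wr (T.wr (T.as a b c) d) e ≫ T.wr (T.as a (T.obj b c) d) e ≫
          T.wr (T.wl a (T.as b c d)) e) ≫
        T.as a (T.obj b (T.obj c d)) e ≫ T.wl a (T.as b (T.obj c d) e) ≫
          T.wl a (T.wl b (T.as c d e))) ⊗≫
      (T.wr (T.wr (T.as a b c) d) e ≫ T.wr (T.as a (T.obj b c) d) e) ◁
        (T.asNat₂ a (T.as b c d) e).hom ▷
        (T.wl a (T.as b (T.obj c d) e) ≫ T.wl a (T.wl b (T.as c d e))) ⊗≫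
      (T.wr (T.wr (T.as a b c) d) e ≫ T.wr (T.as a (T.obj b c) d) e ≫
          T.as a (T.obj (T.obj b c) d) e) ◁
        ((T.wlComp₃ a (T.wr (T.as b c d) e) (T.as b (T.obj c d) e) (T.wl b (T.as c d e))).inv ≫
          (T.wl₂ a (pentagonator b c d e)).hom ≫
          (T.wlComp a (T.as (T.obj b c) d e) (T.as b c (T.obj d e))).hom) ⊗≫
      T.wr (T.wr (T.as a b c) d) e ◁ (pentagonator a (T.obj b c) d e).hom ▷
        T.wl a (T.as b c (T.obj d e)) ⊗≫
      (T.asNat₁ (T.as a b c) d e).hom ▷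
        (T.as a (T.obj b c) (T.obj d e) ≫ T.wl a (T.as b c (T.obj d e))) ⊗≫
      T.as (T.obj (T.obj a b) c) d e ◁ (pentagonator a b c (T.obj d e)).hom ⊗≫
      𝟙 ((T.as (T.obj (T.obj a b) c) d e ≫ T.as (T.obj a b) c (T.obj d e)) ≫
        T.as a b (T.obj c (T.obj d e)))
  /-- The normalization axiom with the unit object in the second position. -/
  left_normalization (a b c : B) :
    (pentagonator a T.unit b c).hom ▷ T.wl a (T.lu (T.obj b c)) ⊗≫
      T.as (T.obj a T.unit) b c ◁ (middle a (T.obj b c)).hom ⊗≫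
      (T.asNat₁ (T.ru a) b c).inv =
    𝟙 (T.pentL a T.unit b c ≫ T.wl a (T.lu (T.obj b c))) ⊗≫
      (T.wr (T.as a T.unit b) c ≫ T.as a (T.obj T.unit b) c) ◁
        ((T.wlComp a (T.as T.unit b c) (T.lu (T.obj b c))).inv ≫ (T.wl₂ a (left b c)).inv) ⊗≫
      T.wr (T.as a T.unit b) c ◁ (T.asNat₂ a (T.lu b) c).inv ⊗≫
      ((T.wrComp (T.as a T.unit b) (T.wl a (T.lu b)) c).inv ≫ (T.wr₂ (middle a b) c).hom) ▷
        T.as a b c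
  /-- The normalization axiom with the unit object in the third position. -/
  right_normalization (a b c : B) :
    (pentagonator a b T.unit c).hom ▷ T.wl a (T.wl b (T.lu c)) ⊗≫
      T.as (T.obj a b) T.unit c ◁ (T.asNat₃ a b (T.lu c)).inv ⊗≫
      (middle (T.obj a b) c).hom ▷ T.as a b c =
    𝟙 (T.pentL a b T.unit c ≫ T.wl a (T.wl b (T.lu c))) ⊗≫
      (T.wr (T.as a b T.unit) c ≫ T.as a (T.obj b T.unit) c) ◁
        ((T.wlComp a (T.as b T.unit c) (T.wl b (T.lu c))).inv ≫ (T.wl₂ a (middle b c)).hom) ⊗≫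
      T.wr (T.as a b T.unit) c ◁ (T.asNat₂ a (T.ru b) c).inv ⊗≫
      ((T.wrComp (T.as a b T.unit) (T.wl a (T.ru b)) c).inv ≫ (T.wr₂ (right a b) c).inv) ▷
        T.as a b c

end MonoidalData

/-- A monoidal structure on a 2-category `B`, where "2-category" means bicategory. -/
class MonoidalTwoCategory (B : Type u) [Bicategory.{w, v} B] where
  /-- the tensor product, unit, associator and unitors -/
  data : MonoidalData B
  /-- the pentagonator and the 2-unitors, with their axioms -/
  coherence : data.Coherence

/-! ### Right duals -/

section Duals

variable {B : Type u} [Bicategory.{w, v} B]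

/-- A right dual of the object `C`: an object `D` with 1-morphisms `ev : C ⊠ D ⟶ I` and
`coev : I ⟶ D ⊠ C` satisfying both snake equations up to invertible 2-morphisms. -/
structure MonoidalData.RightDual (T : MonoidalData B) (C : B) where
  /-- the dual object -/
  dual : B
  /-- the evaluation -/
  ev : T.obj C dual ⟶ T.unit
  /-- the coevaluation -/
  coev : T.unit ⟶ T.obj dual C
  /-- `C ⟶ C ⊠ I ⟶ C ⊠ (D ⊠ C) ⟶ (C ⊠ D) ⊠ C ⟶ I ⊠ C ⟶ C` is isomorphic to the identity. -/
  snake_left : Nonempty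
    (T.ruInv C ≫ T.wl C coev ≫ T.asInv C dual C ≫ T.wr ev C ≫ T.lu C ≅ 𝟙 C)
  /-- `D ⟶ I ⊠ D ⟶ (D ⊠ C) ⊠ D ⟶ D ⊠ (C ⊠ D) ⟶ D ⊠ I ⟶ D` is isomorphic to the identity. -/
  snake_right : Nonempty
    (T.luInv dual ≫ T.wr coev dual ≫ T.as dual C dual ≫ T.wl dual ev ≫ T.ru dual ≅ 𝟙 dual)

/-- The object `C` of a monoidal 2-category has a right dual. -/
def HasRightDual [MonoidalTwoCategory B] (C : B) : Prop :=
  Nonempty ((MonoidalTwoCategory.data (B := B)).RightDual C)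

end Duals

/-! ### 2-condensations and 2-condensation monads

Composition is written in diagrammatic order: `f ≫ g` is "first `f`, then `g`". -/

section Condensations

variable {B : Type u} [Bicategory.{w, v} B]

/-- A 2-condensation of `A` onto `A'`: 1-morphisms `f : A ⟶ A'` and `g : A' ⟶ A` together with
2-morphisms `φ : f ∘ g ⟹ 𝟙` and `γ : 𝟙 ⟹ f ∘ g` such that `φ · γ` is the identity. -/
structure TwoCondensation (A A' : B) where
  /-- the 1-morphism `A ⟶ A'` -/
  f : A ⟶ A'
  /-- the 1-morphism `A' ⟶ A` -/
  g : A' ⟶ A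
  /-- the 2-morphism `f ∘ g ⟹ 𝟙` -/
  φ : g ≫ f ⟶ 𝟙 A'
  /-- the 2-morphism `𝟙 ⟹ f ∘ g` -/
  γ : 𝟙 A' ⟶ g ≫ f
  γ_φ : γ ≫ φ = 𝟙 (𝟙 A')

/-- A 2-condensation monad on `A`: a (nonunital, noncounital) associative and coassociative
structure on a 1-morphism `e : A ⟶ A` which satisfies the Frobenius relations and for which the
comultiplication is a section of the multiplication. -/
structure TwoCondensationMonad (A : B) where
  /-- the underlying 1-morphism -/
  e : A ⟶ A
  /-- the multiplication -/
  μ : e ≫ e ⟶ e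
  /-- the comultiplication -/
  δ : e ⟶ e ≫ e
  assoc : μ ▷ e ≫ μ = (α_ e e e).hom ≫ e ◁ μ ≫ μ
  coassoc : δ ≫ δ ▷ e ≫ (α_ e e e).hom = δ ≫ e ◁ δ
  frobenius_left : δ ▷ e ≫ (α_ e e e).hom ≫ e ◁ μ = μ ≫ δ
  frobenius_right : e ◁ δ ≫ (α_ e e e).inv ≫ μ ▷ e = μ ≫ δ
  δ_μ : δ ≫ μ = 𝟙 e

namespace TwoCondensation

variable {A A' : B} (K : TwoCondensation A A')

/-- The multiplication `g ∘ φ ∘ f` on the 1-morphism `g ∘ f` induced by a 2-condensation. -/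
def inducedMul : (K.f ≫ K.g) ≫ (K.f ≫ K.g) ⟶ K.f ≫ K.g :=
  (α_ K.f K.g (K.f ≫ K.g)).hom ≫ K.f ◁ (α_ K.g K.f K.g).inv ≫ K.f ◁ (K.φ ▷ K.g) ≫
    K.f ◁ (λ_ K.g).hom

/-- The comultiplication `g ∘ γ ∘ f` on the 1-morphism `g ∘ f` induced by a 2-condensation. -/
def inducedComul : K.f ≫ K.g ⟶ (K.f ≫ K.g) ≫ (K.f ≫ K.g) :=
  K.f ◁ (λ_ K.g).inv ≫ K.f ◁ (K.γ ▷ K.g) ≫ K.f ◁ (α_ K.g K.f K.g).hom ≫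
    (α_ K.f K.g (K.f ≫ K.g)).inv

end TwoCondensation

/-- A splitting of a 2-condensation monad `(A, e, μ, δ)`: a 2-condensation `(A, A', f, g, φ, γ)`
together with an invertible 2-morphism `θ : g ∘ f ≅ e` which identifies the induced
multiplication and comultiplication on `g ∘ f` with `μ` and `δ`. -/
structure TwoCondensationMonad.Splitting {A : B} (M : TwoCondensationMonad A) where
  /-- the object onto which `A` is condensed -/
  obj : B
  /-- the 2-condensation -/
  condensation : TwoCondensation A obj
  /-- the identification of the underlying 1-morphisms -/
  θ : condensation.f ≫ condensation.g ≅ M.e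
  θ_mul : condensation.inducedMul ≫ θ.hom =
    θ.hom ▷ (condensation.f ≫ condensation.g) ≫ M.e ◁ θ.hom ≫ M.μ
  θ_comul : condensation.inducedComul ≫
    θ.hom ▷ (condensation.f ≫ condensation.g) ≫ M.e ◁ θ.hom = θ.hom ≫ M.δ

variable (B)

/-- All categories of 1-morphisms are idempotent complete. -/
def LocallyIdempotentComplete : Prop :=
  ∀ a b : B, IsIdempotentComplete (a ⟶ b)

/-- Every 2-condensation monad splits. -/
def AllTwoCondensationMonadsSplit : Prop :=
  ∀ (A : B) (M : TwoCondensationMonad A), Nonempty M.Splitting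

end Condensations

end TwoCat

end

/-!
# Right duals descend along 2-condensations

A pairing `v : C ⊠ D ⟶ Y` is *universal* if `G ↦ (C ⊠ G) ≫ v` is an equivalence of categories
from `X ⟶ D` to `C ⊠ X ⟶ Y` for every `X`, that is, if it makes `D` a representing object of the
pseudofunctor `X ↦ (C ⊠ X ⟶ Y)` (`MonoidalData.pairing`, `PullSystem.Universal`). A pairing
`ev : C ⊠ D ⟶ I` gives pairings `C ⊠ (D ⊠ Y) ⟶ Y` for all `Y` (`MonoidalData.tensorPairing`). The
proof describes right duals by universal pairings, and shows that universality descends.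

*Duals and universal pairings.* If `ev` is the evaluation of a right dual, then `C ⊠ -` is left
adjoint to `D ⊠ -`, so `ev` and all the pairings `C ⊠ (D ⊠ Y) ⟶ Y` are universal
(`RightDual.universal_ev`, `RightDual.universal_tensorPairing`). Conversely, if `ev : A ⊠ D ⟶ I` and
`A ⊠ (D ⊠ A) ⟶ A` are universal, then the coevaluation is the 1-morphism `I ⟶ D ⊠ A` that
corresponds to the right unitor `A ⊠ I ⟶ A`; this is the first snake relation, and the second one
follows from it because a 1-morphism into `D` is determined by its composite with `ev`
(`MonoidalData.exists_rightDual`). The snake relations only ask for the existence of isomorphisms,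
so the calculations take place in the homotopy category `Ho`, an ordinary monoidal category.

*Descent.* A 2-condensation of `C` onto `A` induces a condensation of the pseudofunctor
`X ↦ (C ⊠ X ⟶ Y)` onto `X ↦ (A ⊠ X ⟶ Y)` (`PullSystem.firstCond`). If `v : C ⊠ D ⟶ I` is universal,
then by the Yoneda principle the condensation monad on `X ↦ (C ⊠ X ⟶ I)` is represented by a
2-condensation monad on `D` (`PullCond.repMonad`). Split it by a 2-condensation of `D` onto `D'`.
For every `X` the equivalence of `X ⟶ D` with `C ⊠ X ⟶ I` then intertwines two condensation monads
on categories. Local idempotent completeness makes the modules over these monads descend to the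
targets `X ⟶ D'` and `A ⊠ X ⟶ I` (`CatCond.Module.descent`), so the equivalence descends as well
(`CondTransfer.isEquivalence`), and it is given by a universal pairing `v' : A ⊠ D' ⟶ I`
(`PullCond.exists_matched_linear`, `PullCond.Linear.universal`). The hypotheses of the descent, that
the two condensations are *matched* and that `v'` is *linear*, are preserved by tensoring with `Y`,
which is a morphism of condensations of pseudofunctors (`PullHom.firstCondHom`,
`MonoidalData.tensorHom`). Hence the pairings `A ⊠ (D' ⊠ Y) ⟶ Y` are universal too
(`MonoidalData.exists_universal`).

Contravariant pseudofunctors to categories, their morphisms and their condensations are written out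
in components (`PullSystem`, `PullHom`, `PullCond`).
-/

universe v₅ u₅

noncomputable section

namespace TwoCat

/-! ### Condensations of categories and their modules -/

/-- A 2-condensation of the category `𝓕` onto the category `𝓕'`, in the 2-category of categories. -/
structure CatCond (𝓕 : Type u₁) [Category.{v₁} 𝓕] (𝓕' : Type u₂) [Category.{v₂} 𝓕'] where
  /-- the functor from the target of the condensation, the `g` of `TwoCondensation` -/
  F : 𝓕' ⥤ 𝓕
  /-- the functor onto the target of the condensation, the `f` of `TwoCondensation` -/
  G : 𝓕 ⥤ 𝓕'
  /-- the natural transformation from the composite to the identity -/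
  φ (u : 𝓕') : G.obj (F.obj u) ⟶ u
  /-- the section of `φ` -/
  γ (u : 𝓕') : u ⟶ G.obj (F.obj u)
  φ_nat {u u' : 𝓕'} (n : u ⟶ u') : G.map (F.map n) ≫ φ u' = φ u ≫ n
  γ_nat {u u' : 𝓕'} (n : u ⟶ u') : n ≫ γ u' = γ u ≫ G.map (F.map n)
  γ_φ (u : 𝓕') : γ u ≫ φ u = 𝟙 u

attribute [simp] CatCond.γ_φ

namespace CatCond

variable {𝓕 : Type u₁} [Category.{v₁} 𝓕] {𝓕' : Type u₂} [Category.{v₂} 𝓕'] (X : CatCond 𝓕 𝓕')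

/-- The endofunctor of `𝓕` underlying the 2-condensation monad of a condensation, on objects. -/
abbrev E (m : 𝓕) : 𝓕 := X.F.obj (X.G.obj m)

/-- The endofunctor of `𝓕` underlying the 2-condensation monad of a condensation, on morphisms. -/
abbrev Em {m m' : 𝓕} (n : m ⟶ m') : X.E m ⟶ X.E m' := X.F.map (X.G.map n)

lemma Em_comp {m₁ m₂ m₃ : 𝓕} (n : m₁ ⟶ m₂) (n' : m₂ ⟶ m₃) :
    X.Em (n ≫ n') = X.Em n ≫ X.Em n' := by
  change X.F.map (X.G.map (n ≫ n')) = _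
  rw [Functor.map_comp, Functor.map_comp]

lemma Em_id (m : 𝓕) : X.Em (𝟙 m) = 𝟙 (X.E m) := by
  change X.F.map (X.G.map (𝟙 m)) = _
  rw [CategoryTheory.Functor.map_id, CategoryTheory.Functor.map_id]

/-- The multiplication of the 2-condensation monad. -/
abbrev M (m : 𝓕) : X.E (X.E m) ⟶ X.E m := X.F.map (X.φ (X.G.obj m))

/-- The comultiplication of the 2-condensation monad. -/
abbrev D (m : 𝓕) : X.E m ⟶ X.E (X.E m) := X.F.map (X.γ (X.G.obj m))

/-- The action of the monad on an object in the image of `F`. -/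
abbrev A (u : 𝓕') : X.E (X.F.obj u) ⟶ X.F.obj u := X.F.map (X.φ u)

/-- The coaction of the monad on an object in the image of `F`. -/
abbrev coA (u : 𝓕') : X.F.obj u ⟶ X.E (X.F.obj u) := X.F.map (X.γ u)

lemma A_nat {u u' : 𝓕'} (n : u ⟶ u') :
    X.Em (X.F.map n) ≫ X.A u' = X.A u ≫ X.F.map n := by
  simp only [← Functor.map_comp, X.φ_nat]

lemma coA_nat {u u' : 𝓕'} (n : u ⟶ u') :
    X.F.map n ≫ X.coA u' = X.coA u ≫ X.Em (X.F.map n) := by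
  simp only [← Functor.map_comp, X.γ_nat]

@[simp]
lemma coA_A (u : 𝓕') : X.coA u ≫ X.A u = 𝟙 _ := by
  rw [← Functor.map_comp, X.γ_φ, CategoryTheory.Functor.map_id]

lemma faithful : X.F.Faithful where
  map_injective {u u'} n n' h := by
    have h1 : X.φ u ≫ n = X.φ u ≫ n' := by rw [← X.φ_nat, ← X.φ_nat, h]
    rw [← Category.id_comp n, ← X.γ_φ, Category.assoc, h1, ← Category.assoc, X.γ_φ,
      Category.id_comp]

/-- A morphism between objects in the image of `F` which commutes with the actions comes
from `𝓕'`. -/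
lemma exists_of_linear {u u' : 𝓕'} (n : X.F.obj u ⟶ X.F.obj u')
    (hn : X.A u ≫ n = X.Em n ≫ X.A u') : ∃ r : u ⟶ u', X.F.map r = n := by
  refine ⟨X.γ u ≫ X.G.map n ≫ X.φ u', ?_⟩
  have h2 : X.F.map (X.G.map n) ≫ X.F.map (X.φ u') = X.F.map (X.φ u) ≫ n := hn.symm
  rw [Functor.map_comp, Functor.map_comp, h2, ← Functor.map_comp_assoc, X.γ_φ]
  simp

/-- A condensed module over the 2-condensation monad of a condensation of categories: an associative
action with a section `coact` which satisfies a Frobenius relation. -/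
structure Module (m : 𝓕) where
  /-- the action of the monad -/
  act : X.E m ⟶ m
  /-- the section of the action -/
  coact : m ⟶ X.E m
  assoc : X.M m ≫ act = X.Em act ≫ act
  coact_act : coact ≫ act = 𝟙 m
  frob : act ≫ coact = X.D m ≫ X.Em act

/-- Condensed modules descend along a condensation onto an idempotent complete category.
The descended object is the image of the idempotent `γ ≫ G act` of `G m`. -/
lemma Module.descent [IsIdempotentComplete 𝓕'] {m : 𝓕} (N : X.Module m) :
    ∃ (u : 𝓕') (a : X.F.obj u ≅ m), X.A u ≫ a.hom = X.Em a.hom ≫ N.act := by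
  let p : X.G.obj m ⟶ X.G.obj m := X.γ _ ≫ X.G.map N.act
  have h1 : X.M m ≫ N.act = X.Em N.act ≫ N.act := N.assoc
  have hp : p ≫ p = p := by
    have h2 := X.γ_nat (X.G.map N.act)
    have h3 := X.γ_nat (X.φ (X.G.obj m))
    have h4 := congrArg X.G.map h1
    rw [Functor.map_comp, Functor.map_comp] at h4
    dsimp only [p]
    rw [Category.assoc, reassoc_of% h2, ← h4, ← reassoc_of% h3, reassoc_of% X.γ_φ]
  obtain ⟨u, i, q, hiq, hqi⟩ := IsIdempotentComplete.idempotents_split _ p hp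
  have hN : N.act ≫ N.coact = X.F.map p := by
    rw [N.frob, ← Functor.map_comp]
  have hF : X.F.map i ≫ X.F.map p = X.F.map i := by
    rw [← Functor.map_comp, ← hqi, reassoc_of% hiq]
  have hq : X.F.map q ≫ X.F.map i = X.F.map p := by
    rw [← Functor.map_comp, hqi]
  refine ⟨u, ⟨X.F.map i ≫ N.act, N.coact ≫ X.F.map q, ?_, ?_⟩, ?_⟩
  · rw [Category.assoc, reassoc_of% hN, reassoc_of% hF, ← Functor.map_comp, hiq,
      CategoryTheory.Functor.map_id]
  · rw [Category.assoc, reassoc_of% hq, ← hN, Category.assoc, N.coact_act, Category.comp_id,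
      N.coact_act]
  · change _ = X.Em (X.F.map i ≫ N.act) ≫ N.act
    rw [← reassoc_of% X.A_nat, X.Em_comp, Category.assoc, h1]

end CatCond

/-! ### Transfer of an equivalence to the targets of two condensations -/

/-- The structure of a morphism of condensation monads on a functor `Ψ`: a natural isomorphism `ζ`
which intertwines the monads and respects multiplications and comultiplications. -/
structure CondTransfer {𝓕 : Type u₁} [Category.{v₁} 𝓕] {𝓕' : Type u₂} [Category.{v₂} 𝓕']
    {𝓖 : Type u₃} [Category.{v₃} 𝓖] {𝓖' : Type u₄} [Category.{v₄} 𝓖']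
    (X : CatCond 𝓕 𝓕') (Y : CatCond 𝓖 𝓖') (Ψ : 𝓖 ⥤ 𝓕) where
  /-- the comparison of the two monads -/
  ζ (G : 𝓖) : X.E (Ψ.obj G) ≅ Ψ.obj (Y.E G)
  ζ_nat {G G' : 𝓖} (n : G ⟶ G') :
    X.Em (Ψ.map n) ≫ (ζ G').hom = (ζ G).hom ≫ Ψ.map (Y.Em n)
  mul (G : 𝓖) : X.M (Ψ.obj G) ≫ (ζ G).hom =
    X.Em (ζ G).hom ≫ (ζ (Y.E G)).hom ≫ Ψ.map (Y.M G)
  comul (G : 𝓖) : X.D (Ψ.obj G) ≫ X.Em (ζ G).hom ≫ (ζ (Y.E G)).hom =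
    (ζ G).hom ≫ Ψ.map (Y.D G)

namespace CondTransfer

variable {𝓕 : Type u₁} [Category.{v₁} 𝓕] {𝓕' : Type u₂} [Category.{v₂} 𝓕']
    {𝓖 : Type u₃} [Category.{v₃} 𝓖] {𝓖' : Type u₄} [Category.{v₄} 𝓖']
    {X : CatCond 𝓕 𝓕'} {Y : CatCond 𝓖 𝓖'} {Ψ : 𝓖 ⥤ 𝓕} (T : CondTransfer X Y Ψ)

/-- The module structure on the image under `Ψ` of an object that comes from `𝓖'`. -/
def module (z : 𝓖') : X.Module (Ψ.obj (Y.F.obj z)) where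
  act := (T.ζ _).hom ≫ Ψ.map (Y.A z)
  coact := Ψ.map (Y.coA z) ≫ (T.ζ _).inv
  assoc := by
    rw [reassoc_of% T.mul, ← Functor.map_comp, ← Y.A_nat (Y.φ z)]
    simp only [Functor.map_comp, CatCond.Em_comp, Category.assoc, reassoc_of% T.ζ_nat]
  coact_act := by
    rw [Category.assoc, Iso.inv_hom_id_assoc, ← Functor.map_comp, Y.coA_A,
      CategoryTheory.Functor.map_id]
  frob := by
    rw [← cancel_mono (T.ζ _).hom]
    simp only [Category.assoc, Iso.inv_hom_id, Category.comp_id, X.Em_comp]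
    rw [T.ζ_nat, reassoc_of% T.comul, ← Functor.map_comp Ψ, ← Functor.map_comp Ψ]
    exact congrArg (fun n => (T.ζ _).hom ≫ Ψ.map n) (Y.coA_nat (Y.φ z))

/-- A module structure is transported along an equivalence which intertwines the monads. -/
lemma exists_module [Ψ.Full] [Ψ.Faithful] {m : 𝓕} (N : X.Module m) (G : 𝓖) (i : Ψ.obj G ≅ m) :
    ∃ N' : Y.Module G, (T.ζ G).hom ≫ Ψ.map N'.act ≫ i.hom = X.Em i.hom ≫ N.act := by
  obtain ⟨act, hact⟩ := Ψ.map_surjective ((T.ζ G).inv ≫ X.Em i.hom ≫ N.act ≫ i.inv)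
  obtain ⟨coact, hcoact⟩ := Ψ.map_surjective (i.hom ≫ N.coact ≫ X.Em i.inv ≫ (T.ζ G).hom)
  have hi : X.Em i.inv ≫ X.Em i.hom = 𝟙 _ := by
    rw [← Functor.map_comp, ← Functor.map_comp, Iso.inv_hom_id, CategoryTheory.Functor.map_id,
      CategoryTheory.Functor.map_id]
  have h1 : (T.ζ G).hom ≫ Ψ.map act = X.Em i.hom ≫ N.act ≫ i.inv := by rw [hact]; simp
  have h1' : (T.ζ G).hom ≫ Ψ.map act ≫ i.hom = X.Em i.hom ≫ N.act := by
    rw [reassoc_of% h1]; simp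
  refine ⟨⟨act, coact, ?_, ?_, ?_⟩, h1'⟩
  · apply Ψ.map_injective
    have h2 : X.Em (X.Em i.hom) ≫ X.M m = X.M (Ψ.obj G) ≫ X.Em i.hom := X.A_nat (X.G.map i.hom)
    have h3 : X.M m ≫ N.act = X.Em N.act ≫ N.act := N.assoc
    have h4 : X.Em (T.ζ G).hom ≫ X.Em (Ψ.map act) =
        X.Em (X.Em i.hom) ≫ X.Em N.act ≫ X.Em i.inv := by
      rw [← Functor.map_comp, ← Functor.map_comp, h1]; simp
    rw [← cancel_epi (X.Em (T.ζ G).hom ≫ (T.ζ (Y.E G)).hom), Functor.map_comp,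
      Functor.map_comp, Category.assoc, Category.assoc, ← reassoc_of% T.mul, ← reassoc_of% T.ζ_nat,
      h1,
      reassoc_of% h4, reassoc_of% hi, ← reassoc_of% h2, reassoc_of% h3]
  · apply Ψ.map_injective
    rw [Functor.map_comp, hcoact, hact]
    simp only [Category.assoc, Iso.hom_inv_id_assoc]
    rw [reassoc_of% hi, reassoc_of% N.coact_act, Iso.hom_inv_id, CategoryTheory.Functor.map_id]
  · apply Ψ.map_injective
    have h2 : Ψ.map coact ≫ (T.ζ G).inv = i.hom ≫ N.coact ≫ X.Em i.inv := by rw [hcoact]; simp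
    have h5 : X.Em i.hom ≫ X.D m = X.D (Ψ.obj G) ≫ X.Em (X.Em i.hom) :=
      X.coA_nat (X.G.map i.hom)
    have h6 : N.act ≫ N.coact = X.D m ≫ X.Em N.act := N.frob
    rw [← cancel_epi (T.ζ G).hom, ← cancel_mono (T.ζ G).inv]
    simp only [Functor.map_comp, Category.assoc]
    rw [h2, ← reassoc_of% T.comul, ← reassoc_of% T.ζ_nat, reassoc_of% h1, Iso.hom_inv_id,
      Category.comp_id,
      ← X.Em_comp, h1, Iso.inv_hom_id_assoc, reassoc_of% h6, X.Em_comp, X.Em_comp,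
      reassoc_of% h5]

/-- If `Ψ` is an equivalence, then so is every functor `Ψ'` between the targets of the
condensations which lies over `Ψ` compatibly with the actions. Full faithfulness holds because the
morphisms in the target of a condensation are the linear ones; for essential surjectivity, a module
over the one monad is transported to a module over the other and descended. -/
theorem isEquivalence [Ψ.IsEquivalence] [IsIdempotentComplete 𝓖'] (Ψ' : 𝓖' ⥤ 𝓕')
    (a : Ψ' ⋙ X.F ≅ Y.F ⋙ Ψ)
    (ha : ∀ z, X.A (Ψ'.obj z) ≫ a.hom.app z =
      X.Em (a.hom.app z) ≫ (T.ζ _).hom ≫ Ψ.map (Y.A z)) : Ψ'.IsEquivalence := by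
  have hXF := X.faithful
  have hYF := Y.faithful
  have hfaith : Ψ'.Faithful := by
    have : (Ψ' ⋙ X.F).Faithful := Functor.Faithful.of_iso a.symm
    exact Functor.Faithful.of_comp Ψ' X.F
  have hfull : Ψ'.Full := ⟨by
    intro z z' n
    obtain ⟨r, hr⟩ := Ψ.map_surjective (a.inv.app z ≫ X.F.map n ≫ a.hom.app z')
    have hr2 : a.hom.app z ≫ Ψ.map r = X.F.map n ≫ a.hom.app z' := by
      rw [hr]; simp
    have hlin : Y.A z ≫ r = Y.Em r ≫ Y.A z' := by
      apply Ψ.map_injective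
      have h2 : X.Em (a.hom.app z) ≫ X.Em (Ψ.map r) = X.Em (X.F.map n) ≫ X.Em (a.hom.app z') := by
        rw [← Functor.map_comp, ← Functor.map_comp, hr2, Functor.map_comp, Functor.map_comp]
      rw [← cancel_epi (T.ζ _).hom, ← cancel_epi (X.Em (a.hom.app z)), Functor.map_comp,
        Functor.map_comp, ← reassoc_of% T.ζ_nat, reassoc_of% h2, ← ha z', reassoc_of% X.A_nat]
      have h3 := ha z
      rw [← reassoc_of% h3, hr2]
    obtain ⟨s, hs⟩ := Y.exists_of_linear r hlin
    refine ⟨s, X.F.map_injective ?_⟩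
    rw [← cancel_mono (a.hom.app z'), ← hr2, ← hs]
    exact a.hom.naturality s⟩
  have heso : Ψ'.EssSurj := ⟨fun u => by
    let N : X.Module (X.F.obj u) :=
      { act := X.A u
        coact := X.coA u
        assoc := (X.A_nat (X.φ u)).symm
        coact_act := X.coA_A u
        frob := X.coA_nat (X.φ u) }
    obtain ⟨N', hN'⟩ := T.exists_module N (Ψ.objPreimage (X.F.obj u)) (Ψ.objObjPreimageIso _)
    obtain ⟨z, b, hb⟩ := N'.descent
    let n : X.F.obj (Ψ'.obj z) ≅ X.F.obj u :=
      a.app z ≪≫ Ψ.mapIso b ≪≫ Ψ.objObjPreimageIso _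
    have hn : X.A (Ψ'.obj z) ≫ n.hom = X.Em n.hom ≫ X.A u := by
      dsimp only [n, Iso.trans_hom, Functor.mapIso_hom, Iso.app_hom]
      rw [reassoc_of% (ha z), ← Functor.map_comp_assoc, hb]
      simp only [X.Em_comp, Functor.map_comp Ψ, Category.assoc]
      rw [← hN', reassoc_of% T.ζ_nat]
    have hn' : X.A u ≫ n.inv = X.Em n.inv ≫ X.A (Ψ'.obj z) := by
      rw [← cancel_epi (X.Em n.hom), ← cancel_mono n.hom]
      simp only [Category.assoc, Iso.inv_hom_id, Category.comp_id]
      rw [hn, ← Functor.map_comp_assoc, ← Functor.map_comp]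
      simp
    obtain ⟨s, hs⟩ := X.exists_of_linear n.hom hn
    obtain ⟨s', hs'⟩ := X.exists_of_linear n.inv hn'
    exact ⟨z, ⟨⟨s, s', X.F.map_injective (by simp [hs, hs']),
      X.F.map_injective (by simp [hs, hs'])⟩⟩⟩⟩
  exact { }

end CondTransfer

/-! ### Morphisms of condensations of categories -/

/-- A morphism between condensations of categories: a pair of functors which commutes with the
1-morphisms of the condensations up to isomorphisms compatible with the 2-morphisms. -/
structure CatCondHom {𝓕 : Type u₁} [Category.{v₁} 𝓕] {𝓕' : Type u₂} [Category.{v₂} 𝓕']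
    {𝓖 : Type u₃} [Category.{v₃} 𝓖] {𝓖' : Type u₄} [Category.{v₄} 𝓖']
    (X : CatCond 𝓕 𝓕') (Y : CatCond 𝓖 𝓖') (Θ : 𝓕 ⥤ 𝓖) (Θ' : 𝓕' ⥤ 𝓖') where
  /-- the compatibility with the functors `F` -/
  isoF (u : 𝓕') : Y.F.obj (Θ'.obj u) ≅ Θ.obj (X.F.obj u)
  /-- the compatibility with the functors `G` -/
  isoG (v : 𝓕) : Y.G.obj (Θ.obj v) ≅ Θ'.obj (X.G.obj v)
  isoF_nat {u u' : 𝓕'} (n : u ⟶ u') :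
    Y.F.map (Θ'.map n) ≫ (isoF u').hom = (isoF u).hom ≫ Θ.map (X.F.map n)
  isoG_nat {v v' : 𝓕} (n : v ⟶ v') :
    Y.G.map (Θ.map n) ≫ (isoG v').hom = (isoG v).hom ≫ Θ'.map (X.G.map n)
  φ_compat (u : 𝓕') :
    Y.G.map (isoF u).hom ≫ (isoG (X.F.obj u)).hom ≫ Θ'.map (X.φ u) = Y.φ (Θ'.obj u)
  γ_compat (u : 𝓕') :
    Y.γ (Θ'.obj u) ≫ Y.G.map (isoF u).hom ≫ (isoG (X.F.obj u)).hom = Θ'.map (X.γ u)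

namespace CatCondHom

variable {𝓕 : Type u₁} [Category.{v₁} 𝓕] {𝓕' : Type u₂} [Category.{v₂} 𝓕']
    {𝓖 : Type u₃} [Category.{v₃} 𝓖] {𝓖' : Type u₄} [Category.{v₄} 𝓖']
    {X : CatCond 𝓕 𝓕'} {Y : CatCond 𝓖 𝓖'} {Θ : 𝓕 ⥤ 𝓖} {Θ' : 𝓕' ⥤ 𝓖'}
    (T : CatCondHom X Y Θ Θ')

/-- The comparison of the underlying endofunctors of the condensation monads. -/
def χ (v : 𝓕) : Y.E (Θ.obj v) ≅ Θ.obj (X.E v) :=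
  Y.F.mapIso (T.isoG v) ≪≫ T.isoF (X.G.obj v)

lemma χ_hom (v : 𝓕) : (T.χ v).hom = Y.F.map (T.isoG v).hom ≫ (T.isoF (X.G.obj v)).hom := rfl

lemma χ_nat {v v' : 𝓕} (n : v ⟶ v') :
    Y.Em (Θ.map n) ≫ (T.χ v').hom = (T.χ v).hom ≫ Θ.map (X.Em n) := by
  rw [χ_hom, χ_hom, Category.assoc, ← T.isoF_nat, ← Functor.map_comp_assoc,
    T.isoG_nat, Functor.map_comp, Category.assoc]

lemma χ_M (v : 𝓕) : Y.M (Θ.obj v) ≫ (T.χ v).hom =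
    Y.Em (T.χ v).hom ≫ (T.χ (X.E v)).hom ≫ Θ.map (X.M v) := by
  have h : Y.A (Θ'.obj (X.G.obj v)) = Y.Em (T.isoF (X.G.obj v)).hom ≫
      Y.F.map (T.isoG (X.E v)).hom ≫ Y.F.map (Θ'.map (X.φ (X.G.obj v))) := by
    rw [← Functor.map_comp, ← Functor.map_comp, T.φ_compat (X.G.obj v)]
  rw [χ_hom, χ_hom, Category.assoc, ← T.isoF_nat, Y.Em_comp, ← reassoc_of% Y.A_nat, Category.assoc,
    h]
  simp only [Category.assoc]

lemma χ_D (v : 𝓕) : Y.D (Θ.obj v) ≫ Y.Em (T.χ v).hom ≫ (T.χ (X.E v)).hom =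
    (T.χ v).hom ≫ Θ.map (X.D v) := by
  have h := T.γ_compat (X.G.obj v)
  rw [χ_hom, χ_hom, Category.assoc, ← T.isoF_nat, Y.Em_comp, Category.assoc,
    ← reassoc_of% Y.coA_nat, ← h]
  simp only [Functor.map_comp, Category.assoc]

lemma χ_A (u : 𝓕') : Y.A (Θ'.obj u) ≫ (T.isoF u).hom =
    Y.Em (T.isoF u).hom ≫ (T.χ (X.F.obj u)).hom ≫ Θ.map (X.A u) := by
  rw [χ_hom, Category.assoc, ← T.isoF_nat, ← Functor.map_comp_assoc, ← Functor.map_comp_assoc,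
    Category.assoc, T.φ_compat]

end CatCondHom

/-! ### Contravariant systems of categories over a bicategory -/

/-- A contravariant pseudofunctor from the bicategory `B` to categories, written out in components:
the pullback of `v` along `H` is `(pull H).obj v`. -/
structure PullSystem (B : Type u) [Bicategory.{w, v} B] where
  /-- the category over an object -/
  cat : B → Type u₁
  [category (Z : B) : Category.{v₁} (cat Z)]
  /-- pullback along a 1-morphism -/
  pull {X Z : B} (H : X ⟶ Z) : cat Z ⥤ cat X
  /-- the effect of a 2-morphism on pullbacks -/
  pull₂ {X Z : B} {H H' : X ⟶ Z} (η : H ⟶ H') (v : cat Z) : (pull H).obj v ⟶ (pull H').obj v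
  pull₂_nat {X Z : B} {H H' : X ⟶ Z} (η : H ⟶ H') {v v' : cat Z} (n : v ⟶ v') :
    (pull H).map n ≫ pull₂ η v' = pull₂ η v ≫ (pull H').map n
  pull₂_id {X Z : B} (H : X ⟶ Z) (v : cat Z) : pull₂ (𝟙 H) v = 𝟙 _
  pull₂_comp {X Z : B} {H H' H'' : X ⟶ Z} (η : H ⟶ H') (θ : H' ⟶ H'') (v : cat Z) :
    pull₂ (η ≫ θ) v = pull₂ η v ≫ pull₂ θ v
  /-- the comparison for composite 1-morphisms -/
  c {X Z W : B} (G : X ⟶ Z) (H : Z ⟶ W) (v : cat W) :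
    (pull (G ≫ H)).obj v ≅ (pull G).obj ((pull H).obj v)
  c_nat {X Z W : B} (G : X ⟶ Z) (H : Z ⟶ W) {v v' : cat W} (n : v ⟶ v') :
    (pull (G ≫ H)).map n ≫ (c G H v').hom = (c G H v).hom ≫ (pull G).map ((pull H).map n)
  /-- the comparison for identity 1-morphisms -/
  ι {Z : B} (v : cat Z) : (pull (𝟙 Z)).obj v ≅ v
  ι_nat {Z : B} {v v' : cat Z} (n : v ⟶ v') : (pull (𝟙 Z)).map n ≫ (ι v').hom = (ι v).hom ≫ n
  c_left {X Z W : B} {G G' : X ⟶ Z} (η : G ⟶ G') (H : Z ⟶ W) (v : cat W) :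
    pull₂ (η ▷ H) v ≫ (c G' H v).hom = (c G H v).hom ≫ pull₂ η ((pull H).obj v)
  c_right {X Z W : B} (G : X ⟶ Z) {H H' : Z ⟶ W} (η : H ⟶ H') (v : cat W) :
    pull₂ (G ◁ η) v ≫ (c G H' v).hom = (c G H v).hom ≫ (pull G).map (pull₂ η v)
  c_assoc {X Z W V : B} (F : X ⟶ Z) (G : Z ⟶ W) (H : W ⟶ V) (v : cat V) :
    pull₂ (α_ F G H).hom v ≫ (c F (G ≫ H) v).hom ≫ (pull F).map (c G H v).hom =
      (c (F ≫ G) H v).hom ≫ (c F G ((pull H).obj v)).hom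
  unit_left {X Z : B} (G : X ⟶ Z) (v : cat Z) :
    (c (𝟙 X) G v).hom ≫ (ι ((pull G).obj v)).hom = pull₂ (λ_ G).hom v
  unit_right {X Z : B} (G : X ⟶ Z) (v : cat Z) :
    (c G (𝟙 Z) v).hom ≫ (pull G).map (ι v).hom = pull₂ (ρ_ G).hom v

attribute [instance] PullSystem.category

namespace PullSystem

variable {B : Type u} [Bicategory.{w, v} B] (P : PullSystem.{w, v, u, v₁, u₁} B)

/-- Pullback along isomorphic 1-morphisms. -/
@[simps]
def pull₂Iso {X Z : B} {H H' : X ⟶ Z} (η : H ≅ H') (v : P.cat Z) :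
    (P.pull H).obj v ≅ (P.pull H').obj v where
  hom := P.pull₂ η.hom v
  inv := P.pull₂ η.inv v
  hom_inv_id := by rw [← P.pull₂_comp, η.hom_inv_id, P.pull₂_id]
  inv_hom_id := by rw [← P.pull₂_comp, η.inv_hom_id, P.pull₂_id]

lemma c_inv_nat {X Z W : B} (G : X ⟶ Z) (H : Z ⟶ W) {v v' : P.cat W} (n : v ⟶ v') :
    (P.pull G).map ((P.pull H).map n) ≫ (P.c G H v').inv =
      (P.c G H v).inv ≫ (P.pull (G ≫ H)).map n := by
  rw [Iso.comp_inv_eq, Category.assoc, P.c_nat, Iso.inv_hom_id_assoc]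

lemma c_inv_left {X Z W : B} {G G' : X ⟶ Z} (η : G ⟶ G') (H : Z ⟶ W) (v : P.cat W) :
    P.pull₂ η ((P.pull H).obj v) ≫ (P.c G' H v).inv = (P.c G H v).inv ≫ P.pull₂ (η ▷ H) v := by
  rw [Iso.comp_inv_eq, Category.assoc, P.c_left, Iso.inv_hom_id_assoc]

lemma c_inv_right {X Z W : B} (G : X ⟶ Z) {H H' : Z ⟶ W} (η : H ⟶ H') (v : P.cat W) :
    (P.pull G).map (P.pull₂ η v) ≫ (P.c G H' v).inv = (P.c G H v).inv ≫ P.pull₂ (G ◁ η) v := by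
  rw [Iso.comp_inv_eq, Category.assoc, P.c_right, Iso.inv_hom_id_assoc]

lemma c_inv_assoc {X Z W V : B} (F : X ⟶ Z) (G : Z ⟶ W) (H : W ⟶ V) (v : P.cat V) :
    (P.c F G ((P.pull H).obj v)).inv ≫ (P.c (F ≫ G) H v).inv ≫ P.pull₂ (α_ F G H).hom v =
      (P.pull F).map (P.c G H v).inv ≫ (P.c F (G ≫ H) v).inv := by
  rw [Iso.inv_comp_eq, Iso.inv_comp_eq, ← reassoc_of% P.c_assoc, ← Functor.map_comp_assoc]
  simp

lemma c_assoc' {X Z W V : B} (F : X ⟶ Z) (G : Z ⟶ W) (H : W ⟶ V) (v : P.cat V) :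
    P.pull₂ (α_ F G H).inv v ≫ (P.c (F ≫ G) H v).hom ≫ (P.c F G ((P.pull H).obj v)).hom =
      (P.c F (G ≫ H) v).hom ≫ (P.pull F).map (P.c G H v).hom := by
  rw [← P.c_assoc, ← reassoc_of% P.pull₂_comp, Iso.inv_hom_id, P.pull₂_id, Category.id_comp]

/-- The functor of pullbacks of a fixed object `v`. -/
abbrev eval {D : B} (v : P.cat D) (X : B) : (X ⟶ D) ⥤ P.cat X where
  obj G := (P.pull G).obj v
  map η := P.pull₂ η v
  map_id G := P.pull₂_id G v
  map_comp η θ := P.pull₂_comp η θ v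

/-- An object `v` is universal if every object is a pullback of `v` in an essentially unique way:
`v` exhibits its base as representing object of the pseudofunctor. -/
def Universal {D : B} (v : P.cat D) : Prop := ∀ X : B, (P.eval v X).IsEquivalence

/-- The image of a 2-condensation of `B` under a contravariant system. -/
abbrev condCat {D D' : B} (L : TwoCondensation D D') : CatCond (P.cat D) (P.cat D') where
  F := P.pull L.f
  G := P.pull L.g
  φ u := (P.c L.g L.f u).inv ≫ P.pull₂ L.φ u ≫ (P.ι u).hom
  γ u := (P.ι u).inv ≫ P.pull₂ L.γ u ≫ (P.c L.g L.f u).hom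
  φ_nat n := by
    rw [reassoc_of% P.c_inv_nat, reassoc_of% P.pull₂_nat, P.ι_nat]; simp
  γ_nat n := by
    simp only [Category.assoc]
    rw [← P.c_nat, ← reassoc_of% P.pull₂_nat, Iso.eq_inv_comp, ← reassoc_of% P.ι_nat]; simp
  γ_φ u := by
    simp only [Category.assoc, Iso.hom_inv_id_assoc]
    rw [← reassoc_of% P.pull₂_comp, L.γ_φ, P.pull₂_id]; simp

end PullSystem

/-- The action of a 2-condensation of `D` onto `D'` on the categories of 1-morphisms into `D` and
`D'`. -/
abbrev TwoCondensation.post {B : Type u} [Bicategory.{w, v} B] {D D' : B} (L : TwoCondensation D D')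
    (X : B) : CatCond (X ⟶ D) (X ⟶ D') where
  F := { obj := fun z => z ≫ L.g, map := fun η => η ▷ L.g }
  G := { obj := fun z => z ≫ L.f, map := fun η => η ▷ L.f }
  φ z := (α_ z L.g L.f).hom ≫ z ◁ L.φ ≫ (ρ_ z).hom
  γ z := (ρ_ z).inv ≫ z ◁ L.γ ≫ (α_ z L.g L.f).inv
  φ_nat n := by
    dsimp
    simp only [Category.assoc]
    rw [associator_naturality_left_assoc, ← whisker_exchange_assoc, rightUnitor_naturality]
  γ_nat n := by
    dsimp
    simp only [Category.assoc]
    rw [← associator_inv_naturality_left, whisker_exchange_assoc, rightUnitor_inv_naturality_assoc]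
  γ_φ z := by
    simp only [Category.assoc, Iso.inv_hom_id_assoc]
    rw [← whiskerLeft_comp_assoc, L.γ_φ]
    simp

namespace PullSystem

variable {B : Type u} [Bicategory.{w, v} B] (P : PullSystem.{w, v, u, v₁, u₁} B)
  {D D' : B} (L : TwoCondensation D D')

/-- The counits of `L` on 1-morphisms into `D'` and on the categories of the system agree. -/
lemma pull₂_post_φ {X : B} (z : X ⟶ D') (w : P.cat D') :
    P.pull₂ ((L.post X).φ z) w = (P.c (z ≫ L.g) L.f w).hom ≫ (P.c z L.g _).hom ≫
      (P.pull z).map ((P.condCat L).φ w) := by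
  dsimp
  rw [P.pull₂_comp, P.pull₂_comp, ← P.unit_right, reassoc_of% P.c_right, ← reassoc_of% P.c_assoc,
    ← Functor.map_comp, ← Functor.map_comp, Iso.hom_inv_id_assoc]

/-- The sections of `L` on 1-morphisms into `D'` and on the categories of the system agree. -/
lemma pull₂_post_γ {X : B} (z : X ⟶ D') (w : P.cat D') :
    P.pull₂ ((L.post X).γ z) w ≫ (P.c (z ≫ L.g) L.f w).hom ≫ (P.c z L.g _).hom =
      (P.pull z).map ((P.condCat L).γ w) := by
  have h : P.pull₂ (ρ_ z).inv w ≫ (P.c z (𝟙 D') w).hom = (P.pull z).map (P.ι w).inv := by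
    rw [← cancel_mono ((P.pull z).map (P.ι w).hom), Category.assoc, P.unit_right,
      ← P.pull₂_comp, Iso.inv_hom_id, P.pull₂_id, ← Functor.map_comp, Iso.inv_hom_id,
      CategoryTheory.Functor.map_id]
  dsimp
  rw [P.pull₂_comp, P.pull₂_comp, Category.assoc, Category.assoc, P.c_assoc', reassoc_of% P.c_right,
    reassoc_of% h]
  simp only [Functor.map_comp]

/-- Pulling back along `(G ≫ L.f) ≫ L.g` is the same as applying the monad of `L` and then pulling
back along `G`. The lemmas below say that this identifies the two monads induced by `L`. -/
def j {X : B} (G : X ⟶ D) (w : P.cat D) :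
    (P.pull G).obj ((P.condCat L).E w) ≅ (P.pull ((L.post X).E G)).obj w :=
  (P.c G L.f _).symm ≪≫ (P.c (G ≫ L.f) L.g w).symm

lemma j_hom {X : B} (G : X ⟶ D) (w : P.cat D) :
    (P.j L G w).hom = (P.c G L.f ((P.pull L.g).obj w)).inv ≫ (P.c (G ≫ L.f) L.g w).inv := rfl

lemma j_inv {X : B} (G : X ⟶ D) (w : P.cat D) :
    (P.j L G w).inv = (P.c (G ≫ L.f) L.g w).hom ≫ (P.c G L.f ((P.pull L.g).obj w)).hom := rfl

lemma j_nat {X : B} (G : X ⟶ D) {w w' : P.cat D} (n : w ⟶ w') :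
    (P.pull G).map ((P.condCat L).Em n) ≫ (P.j L G w').hom = (P.j L G w).hom ≫
      (P.pull ((L.post X).E G)).map n := by
  rw [j_hom, j_hom, Category.assoc, ← P.c_inv_nat, reassoc_of% P.c_inv_nat]

lemma j_pull₂ {X : B} {G G' : X ⟶ D} (η : G ⟶ G') (w : P.cat D) :
    P.pull₂ η _ ≫ (P.j L G' w).hom = (P.j L G w).hom ≫ P.pull₂ ((L.post X).Em η) w := by
  rw [j_hom, j_hom, Category.assoc, ← P.c_inv_left, reassoc_of% P.c_inv_left]

/-- The action by `L` on the pullback of an object `w` along a 1-morphism through `D'`. -/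
lemma j_A {X : B} (z : X ⟶ D') (w : P.cat D) :
    (P.j L (z ≫ L.g) w).hom ≫ P.pull₂ ((L.post X).A z) w ≫ (P.c z L.g w).hom =
      (P.c z L.g _).hom ≫ (P.pull z).map ((P.condCat L).φ ((P.pull L.g).obj w)) := by
  rw [j_hom, Category.assoc, P.c_left ((L.post X).φ z) L.g w,
    Iso.inv_hom_id_assoc, P.pull₂_post_φ, Iso.inv_hom_id_assoc]

lemma j_coA {X : B} (z : X ⟶ D') (w : P.cat D) :
    P.pull₂ ((L.post X).coA z) w ≫ (P.j L (z ≫ L.g) w).inv =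
      (P.c z L.g w).hom ≫ (P.pull z).map ((P.condCat L).γ ((P.pull L.g).obj w)) ≫
        (P.c z L.g _).inv := by
  rw [j_inv, reassoc_of% P.c_left ((L.post X).γ z) L.g w, ← P.pull₂_post_γ]
  simp only [Category.assoc, Iso.hom_inv_id, Category.comp_id]

lemma j_M {X : B} (G : X ⟶ D) (w : P.cat D) :
    (P.j L G ((P.condCat L).E w)).hom ≫ (P.j L ((L.post X).E G) w).hom ≫
      P.pull₂ ((L.post X).M G) w = (P.pull G).map ((P.condCat L).M w) ≫ (P.j L G w).hom := by
  rw [← cancel_mono (P.c (G ≫ L.f) L.g w).hom, Category.assoc, Category.assoc,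
    P.j_A L (G ≫ L.f) w]
  simp only [j_hom, Category.assoc, Iso.inv_hom_id, Iso.inv_hom_id_assoc, Category.comp_id]
  exact (P.c_inv_nat G L.f _).symm

lemma j_D {X : B} (G : X ⟶ D) (w : P.cat D) :
    (P.pull G).map ((P.condCat L).D w) ≫ (P.j L G ((P.condCat L).E w)).hom ≫
      (P.j L ((L.post X).E G) w).hom = (P.j L G w).hom ≫ P.pull₂ ((L.post X).D G) w := by
  rw [← cancel_mono (P.j L ((L.post X).E G) w).inv, Category.assoc, Category.assoc,
    Iso.hom_inv_id, Category.comp_id, Category.assoc, P.j_coA L (G ≫ L.f) w]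
  simp only [j_hom, Category.assoc, Iso.inv_hom_id_assoc]
  exact (reassoc_of% P.c_inv_nat G L.f) _ _

end PullSystem

/-! ### Condensations of contravariant systems -/

/-- A 2-condensation of the contravariant system `P` onto `P'`: condensations of the categories
`P.cat Z` onto `P'.cat Z`, pseudonatural in `Z`. -/
structure PullCond {B : Type u} [Bicategory.{w, v} B] (P : PullSystem.{w, v, u, v₁, u₁} B)
    (P' : PullSystem.{w, v, u, v₂, u₂} B) where
  /-- the condensation of the categories over an object -/
  fib (Z : B) : CatCond (P.cat Z) (P'.cat Z)
  /-- the compatibility with pullback -/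
  hom {X Z : B} (H : X ⟶ Z) : CatCondHom (fib Z) (fib X) (P.pull H) (P'.pull H)
  isoF_pull₂ {X Z : B} {H H' : X ⟶ Z} (η : H ⟶ H') (u : P'.cat Z) :
    (fib X).F.map (P'.pull₂ η u) ≫ ((hom H').isoF u).hom =
      ((hom H).isoF u).hom ≫ P.pull₂ η ((fib Z).F.obj u)
  isoG_pull₂ {X Z : B} {H H' : X ⟶ Z} (η : H ⟶ H') (v : P.cat Z) :
    (fib X).G.map (P.pull₂ η v) ≫ ((hom H').isoG v).hom =
      ((hom H).isoG v).hom ≫ P'.pull₂ η ((fib Z).G.obj v)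
  isoF_c {X Z W : B} (G : X ⟶ Z) (H : Z ⟶ W) (u : P'.cat W) :
    (fib X).F.map (P'.c G H u).hom ≫ ((hom G).isoF ((P'.pull H).obj u)).hom ≫
      (P.pull G).map ((hom H).isoF u).hom = ((hom (G ≫ H)).isoF u).hom ≫ (P.c G H _).hom
  isoG_c {X Z W : B} (G : X ⟶ Z) (H : Z ⟶ W) (v : P.cat W) :
    (fib X).G.map (P.c G H v).hom ≫ ((hom G).isoG ((P.pull H).obj v)).hom ≫
      (P'.pull G).map ((hom H).isoG v).hom = ((hom (G ≫ H)).isoG v).hom ≫ (P'.c G H _).hom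

namespace PullCond

variable {B : Type u} [Bicategory.{w, v} B] {P : PullSystem.{w, v, u, v₁, u₁} B}
  {P' : PullSystem.{w, v, u, v₂, u₂} B} (W : PullCond P P')

lemma χ_pull₂ {X Z : B} {H H' : X ⟶ Z} (η : H ⟶ H') (v : P.cat Z) :
    (W.fib X).Em (P.pull₂ η v) ≫ ((W.hom H').χ v).hom =
      ((W.hom H).χ v).hom ≫ P.pull₂ η ((W.fib Z).E v) := by
  rw [CatCondHom.χ_hom, CatCondHom.χ_hom, Category.assoc, ← W.isoF_pull₂,
    ← Functor.map_comp_assoc, W.isoG_pull₂, Functor.map_comp, Category.assoc]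

lemma χ_c {X Z V : B} (G : X ⟶ Z) (H : Z ⟶ V) (v : P.cat V) :
    (W.fib X).Em (P.c G H v).hom ≫ ((W.hom G).χ ((P.pull H).obj v)).hom ≫
      (P.pull G).map ((W.hom H).χ v).hom =
        ((W.hom (G ≫ H)).χ v).hom ≫ (P.c G H ((W.fib V).E v)).hom := by
  rw [CatCondHom.χ_hom, CatCondHom.χ_hom, CatCondHom.χ_hom, Category.assoc, Category.assoc,
    Functor.map_comp, ← reassoc_of% CatCondHom.isoF_nat, ← W.isoF_c]
  simp only [← Functor.map_comp_assoc, ← W.isoG_c]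

lemma χ_c_inv {X Z V : B} (G : X ⟶ Z) (H : Z ⟶ V) (v : P.cat V) :
    (W.fib X).Em (P.c G H v).inv ≫ ((W.hom (G ≫ H)).χ v).hom =
      ((W.hom G).χ ((P.pull H).obj v)).hom ≫ (P.pull G).map ((W.hom H).χ v).hom ≫
        (P.c G H ((W.fib V).E v)).inv := by
  rw [← cancel_mono (P.c G H ((W.fib V).E v)).hom, Category.assoc, ← W.χ_c,
    ← reassoc_of% CatCond.Em_comp, Iso.inv_hom_id, CatCond.Em_id]
  simp only [Category.id_comp, Category.assoc, Iso.inv_hom_id, Category.comp_id]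

/-- The comparison of the monads of `W` and of a condensation `L`. -/
def χ₂ {D D' : B} (L : TwoCondensation D D') (v : P.cat D) :
    (W.fib D).E ((P.condCat L).E v) ≅ (P.condCat L).E ((W.fib D).E v) :=
  (W.hom L.f).χ ((P.pull L.g).obj v) ≪≫ (P.pull L.f).mapIso ((W.hom L.g).χ v)

lemma χ₂_hom {D D' : B} (L : TwoCondensation D D') (v : P.cat D) :
    (W.χ₂ L v).hom = ((W.hom L.f).χ ((P.pull L.g).obj v)).hom ≫
      (P.pull L.f).map ((W.hom L.g).χ v).hom := rfl

/-- Compatibility of the comparison with pulling back. -/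
lemma χ₂_j {D D' X : B} (L : TwoCondensation D D') (G : X ⟶ D) (v : P.cat D) :
    (W.fib X).Em (P.j L G v).hom ≫ ((W.hom ((L.post X).E G)).χ v).hom =
      ((W.hom G).χ ((P.condCat L).E v)).hom ≫ (P.pull G).map (W.χ₂ L v).hom ≫
        (P.j L G ((W.fib D).E v)).hom := by
  rw [P.j_hom, CatCond.Em_comp, Category.assoc, W.χ_c_inv, reassoc_of% W.χ_c_inv, P.j_hom, χ₂_hom,
    Functor.map_comp, Category.assoc, ← reassoc_of% P.c_inv_nat]

/-- A condensation `L` of `D` onto `D'` is matched with `W` at `v` if its monad and the monad of `W`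
agree on `v`, compatibly with the multiplications and comultiplications. -/
structure Matched {D D' : B} (L : TwoCondensation D D') (v : P.cat D) where
  /-- the identification of the two monads at `v` -/
  σ : (P.condCat L).E v ≅ (W.fib D).E v
  mul : (W.fib D).Em σ.hom ≫ (W.fib D).M v =
    (W.χ₂ L v).hom ≫ (P.condCat L).Em σ.inv ≫ (P.condCat L).M v ≫ σ.hom
  comul : (W.fib D).D v ≫ (W.fib D).Em σ.inv ≫ (W.χ₂ L v).hom =
    σ.inv ≫ (P.condCat L).D v ≫ (P.condCat L).Em σ.hom

/-- An object `v'` of the target of `W` which lies over the pullback of `v` along `L.g`,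
compatibly with the actions of the monads. -/
structure Linear {D D' : B} {L : TwoCondensation D D'} {v : P.cat D} (m : W.Matched L v)
    (v' : P'.cat D') where
  /-- the isomorphism by which `v'` lies over the pullback of `v` -/
  a : (W.fib D').F.obj v' ≅ (P.pull L.g).obj v
  lin : (W.fib D').A v' ≫ a.hom = (W.fib D').Em a.hom ≫ ((W.hom L.g).χ v).hom ≫
    (P.pull L.g).map m.σ.inv ≫ (P.condCat L).φ ((P.pull L.g).obj v)

section

variable {W} {D D' : B} {L : TwoCondensation D D'} {v : P.cat D} (m : W.Matched L v)

/-- The comparison of monads given by a matched condensation, on all pullbacks of `v`. -/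
def Matched.transfer (X : B) : CondTransfer (W.fib X) (L.post X) (P.eval v X) where
  ζ G := (W.hom G).χ v ≪≫ (P.pull G).mapIso m.σ.symm ≪≫ P.j L G v
  ζ_nat {G G'} n := by
    simp only [Iso.trans_hom, Functor.mapIso_hom, Iso.symm_hom]
    rw [reassoc_of% W.χ_pull₂, ← reassoc_of% P.pull₂_nat, P.j_pull₂]
    simp only [Category.assoc]
  mul G := by
    have h : (W.fib D).M v ≫ m.σ.inv = (W.fib D).Em m.σ.inv ≫ (W.χ₂ L v).hom ≫
        (P.condCat L).Em m.σ.inv ≫ (P.condCat L).M v := by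
      rw [← cancel_mono m.σ.hom, ← cancel_epi ((W.fib D).Em m.σ.hom)]
      simp only [Category.assoc, Iso.inv_hom_id, Category.comp_id]
      rw [← reassoc_of% CatCond.Em_comp, Iso.hom_inv_id, CatCond.Em_id, m.mul,
        Category.id_comp]
    simp only [Iso.trans_hom, Functor.mapIso_hom, Iso.symm_hom, CatCond.Em_comp, Category.assoc]
    rw [reassoc_of% W.χ₂_j, ← reassoc_of% P.j_nat, P.j_M, reassoc_of% CatCondHom.χ_M,
      reassoc_of% CatCondHom.χ_nat]
    simp only [← Functor.map_comp_assoc, h]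
  comul G := by
    have h : (W.fib D).D v ≫ (W.fib D).Em m.σ.inv ≫ (W.χ₂ L v).hom ≫ (P.condCat L).Em m.σ.inv =
        m.σ.inv ≫ (P.condCat L).D v := by
      have h2 := m.comul
      rw [reassoc_of% h2, ← CatCond.Em_comp, Iso.hom_inv_id, CatCond.Em_id, Category.comp_id]
    simp only [Iso.trans_hom, Functor.mapIso_hom, Iso.symm_hom, CatCond.Em_comp, Category.assoc]
    rw [reassoc_of% W.χ₂_j, ← reassoc_of% P.j_nat, reassoc_of% CatCondHom.χ_nat,
      reassoc_of% CatCondHom.χ_D, ← P.j_D]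
    simp only [← Functor.map_comp_assoc, ← h]

lemma Matched.transfer_ζ_hom {X : B} (G : X ⟶ D) : ((m.transfer X).ζ G).hom =
    ((W.hom G).χ v).hom ≫ (P.pull G).map m.σ.inv ≫ (P.j L G v).hom := rfl

/-- Universality is inherited by linear objects: evaluation at `v'` lies over evaluation at `v`
compatibly with the actions, so that `CondTransfer.isEquivalence` applies. -/
theorem Linear.universal {v' : P'.cat D'} (l : W.Linear m v') (hv : P.Universal v)
    (hidem : ∀ X, IsIdempotentComplete (X ⟶ D')) : P'.Universal v' := by
  intro X
  have := hv X
  have := hidem X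
  let i : ∀ z : X ⟶ D', (W.fib X).F.obj ((P'.pull z).obj v') ≅ (P.pull (z ≫ L.g)).obj v :=
    fun z => (W.hom z).isoF v' ≪≫ (P.pull z).mapIso l.a ≪≫ (P.c z L.g v).symm
  refine (m.transfer X).isEquivalence (P'.eval v' X) (NatIso.ofComponents i ?_) ?_
  · intro z z' n
    simp only [i, Iso.trans_hom, Functor.mapIso_hom, Iso.symm_hom, Functor.comp_map]
    simp only [Category.assoc]
    rw [reassoc_of% W.isoF_pull₂, ← reassoc_of% P.pull₂_nat, P.c_inv_left]
  · intro z
    have h := l.lin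
    simp only [i, Iso.trans_hom, Functor.mapIso_hom, Iso.symm_hom, NatIso.ofComponents_hom_app]
    rw [m.transfer_ζ_hom]
    rw [← cancel_mono (P.c z L.g v).hom]
    simp only [Category.assoc, CatCond.Em_comp, Iso.inv_hom_id, Category.comp_id]
    rw [P.j_A, reassoc_of% CatCondHom.χ_A, ← Functor.map_comp, h]
    rw [reassoc_of% P.c_nat, reassoc_of% W.χ_c_inv, Iso.inv_hom_id_assoc]
    simp only [Functor.map_comp]
    rw [reassoc_of% CatCondHom.χ_nat]

end

end PullCond

/-- The image of an isomorphism under the endofunctor underlying a condensation monad. -/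
abbrev CatCond.mapIso {𝓕 : Type u₁} [Category.{v₁} 𝓕] {𝓕' : Type u₂} [Category.{v₂} 𝓕']
    (X : CatCond 𝓕 𝓕') {m m' : 𝓕} (n : m ≅ m') : X.E m ≅ X.E m' :=
  X.F.mapIso (X.G.mapIso n)

/-! ### The 2-condensation monad which represents a condensation of systems -/

namespace PullSystem

variable {B : Type u} [Bicategory.{w, v} B] (P : PullSystem.{w, v, u, v₁, u₁} B)
  {D D' : B} (L : TwoCondensation D D')

/-- The multiplication induced by a 2-condensation acts by the multiplication of its image. -/
lemma pull₂_inducedMul (v : P.cat D) :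
    (P.condCat L).Em (P.c L.f L.g v).inv ≫ (P.c L.f L.g _).inv ≫
      (P.c (L.f ≫ L.g) (L.f ≫ L.g) v).inv ≫ P.pull₂ L.inducedMul v =
        (P.condCat L).M v ≫ (P.c L.f L.g v).inv := by
  have h : (P.pull L.g).map (P.c L.f L.g v).inv ≫ (P.c L.g (L.f ≫ L.g) v).inv ≫
      P.pull₂ (α_ L.g L.f L.g).inv v = (P.c L.g L.f _).inv ≫ (P.c (L.g ≫ L.f) L.g v).inv := by
    rw [← reassoc_of% P.c_inv_assoc, ← P.pull₂_comp, Iso.hom_inv_id, P.pull₂_id, Category.comp_id]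
  have h2 : (P.c (𝟙 _) L.g v).inv ≫ P.pull₂ (λ_ L.g).hom v = (P.ι _).hom := by
    rw [← P.unit_left, Iso.inv_hom_id_assoc]
  unfold TwoCondensation.inducedMul
  simp only [P.pull₂_comp]
  rw [reassoc_of% P.c_inv_assoc, ← reassoc_of% P.c_inv_right, ← reassoc_of% P.c_inv_right,
    ← P.c_inv_right]
  simp only [← Functor.map_comp_assoc]
  rw [reassoc_of% h, ← reassoc_of% P.c_inv_left, h2]

/-- The comultiplication induced by a 2-condensation acts by the comultiplication of its image. -/
lemma pull₂_inducedComul (v : P.cat D) :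
    (P.c L.f L.g v).inv ≫ P.pull₂ L.inducedComul v =
      (P.condCat L).D v ≫ (P.condCat L).Em (P.c L.f L.g v).inv ≫ (P.c L.f L.g _).inv ≫
        (P.c (L.f ≫ L.g) (L.f ≫ L.g) v).inv := by
  have h1 : (P.c L.f (L.g ≫ L.f ≫ L.g) v).inv ≫ P.pull₂ (α_ L.f L.g (L.f ≫ L.g)).inv v =
      (P.pull L.f).map (P.c L.g (L.f ≫ L.g) v).hom ≫ (P.c L.f L.g _).inv ≫
        (P.c (L.f ≫ L.g) (L.f ≫ L.g) v).inv := by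
    rw [← cancel_epi ((P.pull L.f).map (P.c L.g (L.f ≫ L.g) v).inv), ← reassoc_of% P.c_inv_assoc,
      ← P.pull₂_comp, Iso.hom_inv_id, P.pull₂_id, ← Functor.map_comp_assoc]
    simp
  have h2 : P.pull₂ (λ_ L.g).inv v = (P.ι _).inv ≫ (P.c (𝟙 _) L.g v).inv := by
    rw [← cancel_mono ((P.c (𝟙 _) L.g v).hom ≫ (P.ι _).hom), P.unit_left, ← P.pull₂_comp,
      Iso.inv_hom_id, P.pull₂_id, ← P.unit_left]
    simp
  have h3 : P.pull₂ (α_ L.g L.f L.g).hom v ≫ (P.c L.g (L.f ≫ L.g) v).hom =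
      (P.c (L.g ≫ L.f) L.g v).hom ≫ (P.c L.g L.f _).hom ≫
        (P.pull L.g).map (P.c L.f L.g v).inv := by
    rw [← reassoc_of% P.c_assoc, ← Functor.map_comp, Iso.hom_inv_id]
    simp
  unfold TwoCondensation.inducedComul
  simp only [P.pull₂_comp]
  rw [← reassoc_of% P.c_inv_right, ← reassoc_of% P.c_inv_right, ← reassoc_of% P.c_inv_right, h1]
  simp only [← Functor.map_comp_assoc, Category.assoc]
  rw [h3, ← Category.assoc (P.pull₂ _ _) (P.c _ _ _).hom, P.c_left, h2]
  simp only [Category.assoc, Iso.inv_hom_id_assoc]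

end PullSystem

namespace PullCond

variable {B : Type u} [Bicategory.{w, v} B] {P : PullSystem.{w, v, u, v₁, u₁} B}
  {P' : PullSystem.{w, v, u, v₂, u₂} B} (W : PullCond P P') {D : B} {v : P.cat D}

section

variable {e : D ⟶ D} (σ : (P.pull e).obj v ≅ (W.fib D).E v)

/-- If `e` represents the value at `v` of the monad of `W`, then composition with `e` represents the
monad on all pullbacks of `v`. -/
def rep {X : B} (G : X ⟶ D) : (W.fib X).E ((P.pull G).obj v) ≅ (P.pull (G ≫ e)).obj v :=
  (W.hom G).χ v ≪≫ (P.pull G).mapIso σ.symm ≪≫ (P.c G e v).symm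

lemma rep_hom {X : B} (G : X ⟶ D) : (W.rep σ G).hom =
    ((W.hom G).χ v).hom ≫ (P.pull G).map σ.inv ≫ (P.c G e v).inv := rfl

lemma rep_nat {X : B} {G G' : X ⟶ D} (η : G ⟶ G') :
    (W.fib X).Em (P.pull₂ η v) ≫ (W.rep σ G').hom = (W.rep σ G).hom ≫ P.pull₂ (η ▷ e) v := by
  rw [rep_hom, rep_hom, reassoc_of% W.χ_pull₂, ← reassoc_of% P.pull₂_nat, P.c_inv_left]
  simp only [Category.assoc]

/-- The isomorphism between the square of the monad at `v` and the pullback along `e ≫ e`. -/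
def rep₂ : (W.fib D).E ((W.fib D).E v) ≅ (P.pull (e ≫ e)).obj v :=
  (W.fib D).mapIso σ.symm ≪≫ W.rep σ e

lemma rep₂_hom : (W.rep₂ σ).hom = (W.fib D).Em σ.inv ≫ (W.rep σ e).hom := rfl

/-- The isomorphism between the cube of the monad at `v` and the pullback along `(e ≫ e) ≫ e`. -/
def rep₃ : (W.fib D).E ((W.fib D).E ((W.fib D).E v)) ≅ (P.pull ((e ≫ e) ≫ e)).obj v :=
  (W.fib D).mapIso (W.rep₂ σ) ≪≫ W.rep σ (e ≫ e)

lemma rep₃_hom :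
    (W.rep₃ σ).hom = (W.fib D).Em (W.rep₂ σ).hom ≫ (W.rep σ (e ≫ e)).hom := rfl

/-- Representing the monad twice is representing its square by `e ≫ e`. -/
lemma Em_rep_rep {X : B} (G : X ⟶ D) :
    (W.fib X).Em (W.rep σ G).hom ≫ (W.rep σ (G ≫ e)).hom ≫ P.pull₂ (α_ G e e).hom v =
      (W.fib X).Em ((W.hom G).χ v).hom ≫ ((W.hom G).χ _).hom ≫
        (P.pull G).map (W.rep₂ σ).hom ≫ (P.c G (e ≫ e) v).inv := by
  rw [rep_hom, rep_hom, rep₂_hom, rep_hom]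
  simp only [CatCond.Em_comp, Category.assoc, Functor.map_comp (P.pull G)]
  rw [reassoc_of% W.χ_c_inv, ← reassoc_of% P.c_inv_nat, P.c_inv_assoc, reassoc_of% CatCondHom.χ_nat]

variable {μ : e ≫ e ⟶ e} (hμ : (W.rep₂ σ).hom ≫ P.pull₂ μ v = (W.fib D).M v ≫ σ.inv)
  {δ : e ⟶ e ≫ e} (hδ : σ.inv ≫ P.pull₂ δ v = (W.fib D).D v ≫ (W.rep₂ σ).hom)

include hμ in
lemma rep_mul_left {X : B} (G : X ⟶ D) :
    (W.fib X).Em (W.rep σ G).hom ≫ (W.rep σ (G ≫ e)).hom ≫ P.pull₂ (α_ G e e).hom v ≫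
      P.pull₂ (G ◁ μ) v = (W.fib X).M _ ≫ (W.rep σ G).hom := by
  rw [reassoc_of% W.Em_rep_rep, ← P.c_inv_right, ← Functor.map_comp_assoc, hμ, rep_hom,
    reassoc_of% CatCondHom.χ_M, Functor.map_comp, Category.assoc]

include hδ in
lemma rep_comul_left {X : B} (G : X ⟶ D) :
    (W.rep σ G).hom ≫ P.pull₂ (G ◁ δ) v = (W.fib X).D _ ≫ (W.fib X).Em (W.rep σ G).hom ≫
      (W.rep σ (G ≫ e)).hom ≫ P.pull₂ (α_ G e e).hom v := by
  rw [W.Em_rep_rep, reassoc_of% CatCondHom.χ_D, rep_hom, Category.assoc, Category.assoc,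
    ← P.c_inv_right, ← Functor.map_comp_assoc, ← Functor.map_comp_assoc, hδ]

include hμ in
lemma rep₃_mul_right :
    (W.rep₃ σ).hom ≫ P.pull₂ (μ ▷ e) v = (W.fib D).Em ((W.fib D).M v) ≫ (W.rep₂ σ).hom := by
  rw [rep₃_hom, Category.assoc, ← W.rep_nat, ← reassoc_of% CatCond.Em_comp, hμ, rep₂_hom,
    CatCond.Em_comp, Category.assoc]

include hμ in
lemma rep₃_mul_left :
    (W.rep₃ σ).hom ≫ P.pull₂ (α_ e e e).hom v ≫ P.pull₂ (e ◁ μ) v =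
      (W.fib D).M ((W.fib D).E v) ≫ (W.rep₂ σ).hom := by
  have h : (W.fib D).Em ((W.fib D).Em σ.inv) ≫ (W.fib D).M _ =
    (W.fib D).M _ ≫ (W.fib D).Em σ.inv := (W.fib D).A_nat _
  rw [rep₃_hom, rep₂_hom, CatCond.Em_comp, Category.assoc, Category.assoc,
    W.rep_mul_left σ hμ, reassoc_of% h]

include hδ in
lemma rep₂_comul_right :
    (W.rep₂ σ).hom ≫ P.pull₂ (δ ▷ e) v = (W.fib D).Em ((W.fib D).D v) ≫ (W.rep₃ σ).hom := by
  rw [rep₂_hom, Category.assoc, ← W.rep_nat, ← reassoc_of% CatCond.Em_comp, hδ, rep₃_hom,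
    CatCond.Em_comp, Category.assoc]

include hδ in
lemma rep₂_comul_left :
    (W.rep₂ σ).hom ≫ P.pull₂ (e ◁ δ) v = (W.fib D).D ((W.fib D).E v) ≫ (W.rep₃ σ).hom ≫
      P.pull₂ (α_ e e e).hom v := by
  have h : (W.fib D).Em σ.inv ≫ (W.fib D).D _ =
    (W.fib D).D _ ≫ (W.fib D).Em ((W.fib D).Em σ.inv) := (W.fib D).coA_nat _
  rw [rep₂_hom, Category.assoc, W.rep_comul_left σ hδ, reassoc_of% h, rep₃_hom, rep₂_hom,
    CatCond.Em_comp]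
  simp only [Category.assoc]

/-- The 2-condensation monad on `D` which represents the monad of `W` at a universal object. Its
axioms are checked after evaluation at `v`, which is faithful. -/
def repMonad [(P.eval v D).Faithful]
    (hμ : (W.rep₂ σ).hom ≫ P.pull₂ μ v = (W.fib D).M v ≫ σ.inv)
    (hδ : σ.inv ≫ P.pull₂ δ v = (W.fib D).D v ≫ (W.rep₂ σ).hom) : TwoCondensationMonad D where
  e := e
  μ := μ
  δ := δ
  assoc := by
    have h : (W.fib D).Em ((W.fib D).M v) ≫ (W.fib D).M v = (W.fib D).M _ ≫ (W.fib D).M v :=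
      (W.fib D).A_nat _
    apply (P.eval v D).map_injective
    change P.pull₂ _ v = P.pull₂ _ v
    rw [← cancel_epi (W.rep₃ σ).hom]
    simp only [P.pull₂_comp]
    rw [reassoc_of% W.rep₃_mul_right σ hμ, reassoc_of% W.rep₃_mul_left σ hμ, hμ, reassoc_of% h]
  coassoc := by
    have h : (W.fib D).D v ≫ (W.fib D).D _ = (W.fib D).D v ≫ (W.fib D).Em ((W.fib D).D v) :=
      (W.fib D).coA_nat _
    apply (P.eval v D).map_injective
    change P.pull₂ _ v = P.pull₂ _ v
    rw [← cancel_epi σ.inv]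
    simp only [P.pull₂_comp]
    rw [reassoc_of% hδ, reassoc_of% hδ, reassoc_of% W.rep₂_comul_right σ hδ, W.rep₂_comul_left σ hδ,
      reassoc_of% h]
  frobenius_left := by
    have h : (W.fib D).Em ((W.fib D).D v) ≫ (W.fib D).M _ = (W.fib D).M v ≫ (W.fib D).D v :=
      (W.fib D).A_nat _
    apply (P.eval v D).map_injective
    change P.pull₂ _ v = P.pull₂ _ v
    rw [← cancel_epi (W.rep₂ σ).hom]
    simp only [P.pull₂_comp]
    rw [reassoc_of% W.rep₂_comul_right σ hδ, W.rep₃_mul_left σ hμ, reassoc_of% h, reassoc_of% hμ,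
      hδ]
  frobenius_right := by
    have h : (W.fib D).M v ≫ (W.fib D).D v = (W.fib D).D _ ≫ (W.fib D).Em ((W.fib D).M v) :=
      (W.fib D).coA_nat _
    apply (P.eval v D).map_injective
    change P.pull₂ _ v = P.pull₂ _ v
    rw [← cancel_epi (W.rep₂ σ).hom]
    simp only [P.pull₂_comp]
    rw [reassoc_of% W.rep₂_comul_left σ hδ, ← reassoc_of% P.pull₂_comp, Iso.hom_inv_id, P.pull₂_id,
      Category.id_comp, W.rep₃_mul_right σ hμ, reassoc_of% hμ, hδ, reassoc_of% h]
  δ_μ := by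
    apply (P.eval v D).map_injective
    change P.pull₂ _ v = P.pull₂ _ v
    rw [← cancel_epi σ.inv]
    simp only [P.pull₂_comp]
    rw [reassoc_of% hδ, hμ, reassoc_of% CatCond.coA_A, P.pull₂_id, Category.comp_id]

end

section

variable {e : D ⟶ D} {D' : B} (L : TwoCondensation D D') (θ : L.f ≫ L.g ≅ e)

/-- The identification of the monads given by `θ : L.f ≫ L.g ≅ e`. -/
def τ (w : P.cat D) : (P.condCat L).E w ≅ (P.pull e).obj w :=
  (P.c L.f L.g w).symm ≪≫ P.pull₂Iso θ w

lemma τ_hom (w : P.cat D) : (τ L θ w).hom = (P.c L.f L.g w).inv ≫ P.pull₂ θ.hom w := rfl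

lemma τ_nat {w w' : P.cat D} (n : w ⟶ w') :
    (P.condCat L).Em n ≫ (τ L θ w').hom = (τ L θ w).hom ≫ (P.pull e).map n := by
  rw [τ_hom, τ_hom, reassoc_of% P.c_inv_nat, P.pull₂_nat, Category.assoc]

lemma χ₂_τ (w : P.cat D) :
    (W.fib D).Em (τ L θ w).hom ≫ ((W.hom e).χ w).hom =
      (W.χ₂ L w).hom ≫ (τ L θ ((W.fib D).E w)).hom := by
  rw [τ_hom, τ_hom, CatCond.Em_comp, Category.assoc, W.χ_pull₂, reassoc_of% W.χ_c_inv, χ₂_hom,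
    Category.assoc]

lemma τ_mul {μ : e ≫ e ⟶ e}
    (hθ : L.inducedMul ≫ θ.hom = θ.hom ▷ (L.f ≫ L.g) ≫ e ◁ θ.hom ≫ μ) (w : P.cat D) :
    (P.condCat L).Em (τ L θ w).hom ≫ (τ L θ _).hom ≫ (P.c e e w).inv ≫ P.pull₂ μ w =
      (P.condCat L).M w ≫ (τ L θ w).hom := by
  rw [τ_hom, τ_hom, CatCond.Em_comp]
  have h := P.pull₂_inducedMul L w
  rw [← reassoc_of% h, ← P.pull₂_comp, hθ]
  simp only [P.pull₂_comp, Category.assoc]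
  rw [reassoc_of% P.c_inv_nat, reassoc_of% P.pull₂_nat, reassoc_of% P.c_inv_right,
    reassoc_of% P.c_inv_left]

lemma τ_comul {δ : e ⟶ e ≫ e}
    (hθ : L.inducedComul ≫ θ.hom ▷ (L.f ≫ L.g) ≫ e ◁ θ.hom = θ.hom ≫ δ) (w : P.cat D) :
    (P.condCat L).D w ≫ (P.condCat L).Em (τ L θ w).hom ≫ (τ L θ _).hom ≫ (P.c e e w).inv =
      (τ L θ w).hom ≫ P.pull₂ δ w := by
  simp only [τ_hom, Category.assoc]
  rw [← P.pull₂_comp, ← hθ, P.pull₂_comp, P.pull₂_comp]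
  have h := P.pull₂_inducedComul L w
  rw [reassoc_of% h, CatCond.Em_comp, ← reassoc_of% P.c_inv_left, ← P.c_inv_right,
    reassoc_of% P.c_inv_nat,
    reassoc_of% P.pull₂_nat]
  simp only [Category.assoc]
  rw [reassoc_of% P.c_inv_nat, reassoc_of% P.c_inv_nat, reassoc_of% P.pull₂_nat,
    reassoc_of% P.pull₂_nat]

variable (σ : (P.pull e).obj v ≅ (W.fib D).E v)

/-- A splitting of the monad which represents the monad of `W` at `v` is matched with `W`. -/
def matchedOfSplitting {μ : e ≫ e ⟶ e}
    (hμ : (W.rep₂ σ).hom ≫ P.pull₂ μ v = (W.fib D).M v ≫ σ.inv)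
    {δ : e ⟶ e ≫ e} (hδ : σ.inv ≫ P.pull₂ δ v = (W.fib D).D v ≫ (W.rep₂ σ).hom)
    (hθ : L.inducedMul ≫ θ.hom = θ.hom ▷ (L.f ≫ L.g) ≫ e ◁ θ.hom ≫ μ)
    (hθ' : L.inducedComul ≫ θ.hom ▷ (L.f ≫ L.g) ≫ e ◁ θ.hom = θ.hom ≫ δ) :
    W.Matched L v where
  σ := τ L θ v ≪≫ σ
  mul := by
    have h1 := W.χ₂_τ L θ v
    have h2 := τ_mul L θ hθ v
    have h3 : (P.condCat L).Em (τ L θ v).inv ≫ (P.condCat L).Em (τ L θ v).hom = 𝟙 _ := by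
      rw [← CatCond.Em_comp, Iso.inv_hom_id, CatCond.Em_id]
    have h4 : (W.fib D).Em σ.hom ≫ (W.fib D).Em σ.inv = 𝟙 _ := by
      rw [← CatCond.Em_comp, Iso.hom_inv_id, CatCond.Em_id]
    rw [← cancel_mono σ.inv]
    simp only [Iso.trans_hom, Iso.trans_inv, CatCond.Em_comp, Category.assoc, Iso.hom_inv_id,
      Category.comp_id]
    rw [← h2, reassoc_of% h3, ← hμ, rep₂_hom, rep_hom, Category.assoc, reassoc_of% h4]
    simp only [Category.assoc]
    rw [reassoc_of% h1, reassoc_of% τ_nat]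
  comul := by
    have h1 := W.χ₂_τ L θ v
    have h2 := τ_comul L θ hθ' v
    have h3 : (W.fib D).Em (τ L θ v).inv ≫ (W.fib D).Em (τ L θ v).hom = 𝟙 _ := by
      rw [← CatCond.Em_comp, Iso.inv_hom_id, CatCond.Em_id]
    have h5 : (W.fib D).D v ≫ (W.fib D).Em σ.inv ≫ ((W.hom e).χ v).hom =
        σ.inv ≫ P.pull₂ δ v ≫ (P.c e e v).hom ≫ (P.pull e).map σ.hom := by
      rw [reassoc_of% hδ, rep₂_hom, rep_hom]
      simp only [Category.assoc, Iso.inv_hom_id_assoc]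
      rw [← Functor.map_comp, Iso.inv_hom_id]
      simp
    have h6 : (P.condCat L).D v ≫ (P.condCat L).Em (τ L θ v).hom ≫ (τ L θ _).hom =
        (τ L θ v).hom ≫ P.pull₂ δ v ≫ (P.c e e v).hom := by
      rw [← reassoc_of% h2, Iso.inv_hom_id, Category.comp_id]
    rw [← cancel_mono (τ L θ _).hom]
    simp only [Iso.trans_hom, Iso.trans_inv, CatCond.Em_comp, Category.assoc]
    rw [← h1, reassoc_of% h3, h5, τ_nat, reassoc_of% h6, Iso.inv_hom_id_assoc]

end

section

variable {W} {D' : B} {L : TwoCondensation D D'} (m : W.Matched L v)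

/-- A matched condensation onto `D'` produces a linear object over `D'`: the pullback of `v` along
`L.g` is a module over the monad of `W`, and it descends. -/
lemma Matched.exists_linear [IsIdempotentComplete (P'.cat D')] :
    ∃ v' : P'.cat D', Nonempty (W.Linear m v') := by
  obtain ⟨v', a, ha⟩ := ((m.transfer D').module (𝟙 D')).descent
  refine ⟨v', ⟨⟨a ≪≫ P.pull₂Iso (λ_ L.g) v, ?_⟩⟩⟩
  have h1 : (W.fib D').A v' ≫ a.hom = (W.fib D').Em a.hom ≫ ((m.transfer D').ζ _).hom ≫
    P.pull₂ ((L.post D').A (𝟙 D')) v := ha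
  have h2 : P.pull₂ (λ_ L.g).hom v = (P.c (𝟙 D') L.g v).hom ≫ (P.ι _).hom :=
    (P.unit_left _ _).symm
  simp only [Iso.trans_hom, PullSystem.pull₂Iso_hom, CatCond.Em_comp, Category.assoc]
  rw [reassoc_of% h1, m.transfer_ζ_hom, reassoc_of% W.χ_pull₂, ← reassoc_of% P.pull₂_nat,
    ← P.unit_left L.g ((P.condCat L).E v), h2]
  simp only [Category.assoc]
  rw [reassoc_of% P.j_A, P.ι_nat]

end

/-- If all 2-condensation monads split, then so does the monad of `W` at a universal object `v`:
there are a condensation which is matched with `W` at `v` and a linear object over its target. -/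
theorem exists_matched_linear (hsplit : AllTwoCondensationMonadsSplit B)
    (hidem : ∀ Z, IsIdempotentComplete (P'.cat Z)) (hv : P.Universal v) :
    ∃ (D' : B) (L : TwoCondensation D D') (m : W.Matched L v) (v' : P'.cat D'),
      Nonempty (W.Linear m v') := by
  have := hv D
  -- As `v` is universal, the monad of `W` at `v` is given by a 1-morphism `e : D ⟶ D`, and its
  -- structure morphisms come from 2-morphisms `μ` and `δ`.
  let σ : (P.pull ((P.eval v D).objPreimage ((W.fib D).E v))).obj v ≅ (W.fib D).E v :=
    (P.eval v D).objObjPreimageIso ((W.fib D).E v)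
  obtain ⟨μ, hμ⟩ := (P.eval v D).map_surjective
    ((W.rep₂ σ).inv ≫ (W.fib D).M v ≫ σ.inv)
  obtain ⟨δ, hδ⟩ := (P.eval v D).map_surjective
    (σ.hom ≫ (W.fib D).D v ≫ (W.rep₂ σ).hom)
  have hμ' : (W.rep₂ σ).hom ≫ P.pull₂ μ v = (W.fib D).M v ≫ σ.inv := by
    rw [← Iso.eq_inv_comp]; exact hμ
  have hδ' : σ.inv ≫ P.pull₂ δ v = (W.fib D).D v ≫ (W.rep₂ σ).hom := by
    rw [Iso.inv_comp_eq]; exact hδ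
  obtain ⟨S⟩ := hsplit D (W.repMonad σ hμ' hδ')
  have := hidem S.obj
  let m := W.matchedOfSplitting S.condensation S.θ σ hμ' hδ' S.θ_mul S.θ_comul
  obtain ⟨v', l⟩ := m.exists_linear
  exact ⟨S.obj, S.condensation, m, v', l⟩

end PullCond

/-! ### Morphisms of contravariant systems and of their condensations -/

/-- A morphism from the contravariant system `P` over `B` to the system `Q` over `B'`, lying over a
pseudofunctor `R : B ⥤ᵖ B'`. -/
structure PullHom {B : Type u₁} [Bicategory.{w₁, v₁} B] {B' : Type u₂} [Bicategory.{w₂, v₂} B']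
    (P : PullSystem.{w₁, v₁, u₁, v₃, u₃} B) (Q : PullSystem.{w₂, v₂, u₂, v₄, u₄} B')
    (R : B ⥤ᵖ B') where
  /-- the functor between the categories over an object -/
  app (Z : B) : P.cat Z ⥤ Q.cat (R.obj Z)
  /-- the compatibility with pullback -/
  iso {X Z : B} (H : X ⟶ Z) (v : P.cat Z) :
    (Q.pull (R.map H)).obj ((app Z).obj v) ≅ (app X).obj ((P.pull H).obj v)
  iso_nat {X Z : B} (H : X ⟶ Z) {v v' : P.cat Z} (n : v ⟶ v') :
    (Q.pull (R.map H)).map ((app Z).map n) ≫ (iso H v').hom =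
      (iso H v).hom ≫ (app X).map ((P.pull H).map n)
  iso_pull₂ {X Z : B} {H H' : X ⟶ Z} (η : H ⟶ H') (v : P.cat Z) :
    Q.pull₂ (R.map₂ η) ((app Z).obj v) ≫ (iso H' v).hom =
      (iso H v).hom ≫ (app X).map (P.pull₂ η v)
  iso_c {X Z W : B} (G : X ⟶ Z) (H : Z ⟶ W) (v : P.cat W) :
    Q.pull₂ (R.mapComp G H).hom ((app W).obj v) ≫ (Q.c (R.map G) (R.map H) _).hom ≫
      (Q.pull (R.map G)).map (iso H v).hom ≫ (iso G ((P.pull H).obj v)).hom =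
        (iso (G ≫ H) v).hom ≫ (app X).map (P.c G H v).hom
  iso_ι {Z : B} (v : P.cat Z) :
    Q.pull₂ (R.mapId Z).hom ((app Z).obj v) ≫ (Q.ι _).hom =
      (iso (𝟙 Z) v).hom ≫ (app Z).map (P.ι v).hom

/-- The image of a 2-condensation under a pseudofunctor. -/
abbrev TwoCondensation.map {B : Type u₁} [Bicategory.{w₁, v₁} B] {B' : Type u₂}
    [Bicategory.{w₂, v₂} B'] {D D' : B} (L : TwoCondensation D D') (R : B ⥤ᵖ B') :
    TwoCondensation (R.obj D) (R.obj D') where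
  f := R.map L.f
  g := R.map L.g
  φ := (R.mapComp L.g L.f).inv ≫ R.map₂ L.φ ≫ (R.mapId D').hom
  γ := (R.mapId D').inv ≫ R.map₂ L.γ ≫ (R.mapComp L.g L.f).hom
  γ_φ := by
    simp only [Category.assoc, Iso.hom_inv_id_assoc]
    rw [← PrelaxFunctor.map₂_comp_assoc, L.γ_φ, PrelaxFunctor.map₂_id]
    simp

namespace PullHom

variable {B : Type u₁} [Bicategory.{w₁, v₁} B] {B' : Type u₂} [Bicategory.{w₂, v₂} B']
  {P : PullSystem.{w₁, v₁, u₁, v₃, u₃} B} {Q : PullSystem.{w₂, v₂, u₂, v₄, u₄} B'}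
  {R : B ⥤ᵖ B'} (t : PullHom P Q R)

lemma iso_c' {X Z W : B} (G : X ⟶ Z) (H : Z ⟶ W) (v : P.cat W) :
    (Q.c (R.map G) (R.map H) _).hom ≫ (Q.pull (R.map G)).map (t.iso H v).hom ≫
      (t.iso G ((P.pull H).obj v)).hom =
        Q.pull₂ (R.mapComp G H).inv _ ≫ (t.iso (G ≫ H) v).hom ≫ (t.app X).map (P.c G H v).hom := by
  rw [← t.iso_c, ← reassoc_of% Q.pull₂_comp, Iso.inv_hom_id, Q.pull₂_id, Category.id_comp]

lemma iso_ι' {Z : B} (v : P.cat Z) :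
    (Q.ι ((t.app Z).obj v)).hom = Q.pull₂ (R.mapId Z).inv _ ≫ (t.iso (𝟙 Z) v).hom ≫
      (t.app Z).map (P.ι v).hom := by
  rw [← t.iso_ι, ← reassoc_of% Q.pull₂_comp, Iso.inv_hom_id, Q.pull₂_id, Category.id_comp]

/-- A morphism of contravariant systems is compatible with the actions of 2-condensations. -/
def condHom {D D' : B} (L : TwoCondensation D D') :
    CatCondHom (P.condCat L) (Q.condCat (L.map R)) (t.app D) (t.app D') where
  isoF u := t.iso L.f u
  isoG v := t.iso L.g v
  isoF_nat n := t.iso_nat L.f n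
  isoG_nat n := t.iso_nat L.g n
  φ_compat u := by
    simp only [Functor.map_comp, Q.pull₂_comp, Category.assoc]
    rw [t.iso_ι, reassoc_of% t.iso_pull₂, Iso.eq_inv_comp, reassoc_of% t.iso_c',
      Iso.map_hom_inv_id_assoc]
  γ_compat u := by
    simp only [Functor.map_comp, Q.pull₂_comp, Category.assoc]
    rw [t.iso_c, reassoc_of% t.iso_pull₂, Iso.inv_comp_eq, reassoc_of% t.iso_ι',
      Iso.map_hom_inv_id_assoc]

end PullHom

/-- A morphism between condensations of contravariant systems: morphisms `t` and `t'` of the systems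
which form a morphism of condensations over every object, compatibly with pullback. -/
structure PullCondHom {B : Type u₁} [Bicategory.{w₁, v₁} B] {B' : Type u₂} [Bicategory.{w₂, v₂} B']
    {P P' : PullSystem.{w₁, v₁, u₁, v₃, u₃} B} {Q Q' : PullSystem.{w₂, v₂, u₂, v₄, u₄} B'}
    {R : B ⥤ᵖ B'} (W : PullCond P P') (V : PullCond Q Q') (t : PullHom P Q R)
    (t' : PullHom P' Q' R) where
  /-- the morphism of condensations over an object -/
  fib (Z : B) : CatCondHom (W.fib Z) (V.fib (R.obj Z)) (t.app Z) (t'.app Z)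
  isoF_hom {X Z : B} (H : X ⟶ Z) (u : P'.cat Z) :
    (V.fib (R.obj X)).F.map (t'.iso H u).hom ≫ ((fib X).isoF ((P'.pull H).obj u)).hom ≫
      (t.app X).map ((W.hom H).isoF u).hom =
    ((V.hom (R.map H)).isoF ((t'.app Z).obj u)).hom ≫
      (Q.pull (R.map H)).map ((fib Z).isoF u).hom ≫ (t.iso H ((W.fib Z).F.obj u)).hom
  isoG_hom {X Z : B} (H : X ⟶ Z) (v : P.cat Z) :
    (V.fib (R.obj X)).G.map (t.iso H v).hom ≫ ((fib X).isoG ((P.pull H).obj v)).hom ≫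
      (t'.app X).map ((W.hom H).isoG v).hom =
    ((V.hom (R.map H)).isoG ((t.app Z).obj v)).hom ≫
      (Q'.pull (R.map H)).map ((fib Z).isoG v).hom ≫ (t'.iso H ((W.fib Z).G.obj v)).hom

namespace PullCondHom

variable {B : Type u₁} [Bicategory.{w₁, v₁} B] {B' : Type u₂} [Bicategory.{w₂, v₂} B']
    {P P' : PullSystem.{w₁, v₁, u₁, v₃, u₃} B} {Q Q' : PullSystem.{w₂, v₂, u₂, v₄, u₄} B'}
    {R : B ⥤ᵖ B'} {W : PullCond P P'} {V : PullCond Q Q'} {t : PullHom P Q R}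
    {t' : PullHom P' Q' R} (T : PullCondHom W V t t')

/-- The comparison of the monads of `W` and `V` is compatible with pullback. -/
lemma χ_iso {X Z : B} (H : X ⟶ Z) (v : P.cat Z) :
    (V.fib (R.obj X)).Em (t.iso H v).hom ≫ ((T.fib X).χ ((P.pull H).obj v)).hom ≫
      (t.app X).map ((W.hom H).χ v).hom =
    ((V.hom (R.map H)).χ ((t.app Z).obj v)).hom ≫
      (Q.pull (R.map H)).map ((T.fib Z).χ v).hom ≫ (t.iso H ((W.fib Z).E v)).hom := by
  simp only [CatCondHom.χ_hom, Functor.map_comp, Category.assoc]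
  rw [← reassoc_of% CatCondHom.isoF_nat, ← reassoc_of% CatCondHom.isoF_nat, ← T.isoF_hom]
  simp only [← Functor.map_comp_assoc]
  rw [T.isoG_hom]

lemma χ₂_iso {D D' : B} (L : TwoCondensation D D') (v : P.cat D) :
    (V.fib (R.obj D)).Em ((t.condHom L).χ v).hom ≫ ((T.fib D).χ _).hom ≫
      (t.app D).map (W.χ₂ L v).hom =
    (V.χ₂ (L.map R) ((t.app D).obj v)).hom ≫
      (Q.condCat (L.map R)).Em ((T.fib D).χ v).hom ≫ ((t.condHom L).χ _).hom := by
  have h1 : ∀ w, ((t.condHom L).χ w).hom =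
    (Q.pull (R.map L.f)).map (t.iso L.g w).hom ≫ (t.iso L.f _).hom := fun _ => rfl
  rw [h1, h1, PullCond.χ₂_hom, PullCond.χ₂_hom, CatCond.Em_comp, Functor.map_comp, Category.assoc,
    reassoc_of% T.χ_iso, reassoc_of% CatCondHom.χ_nat, Category.assoc, ← t.iso_nat]
  simp only [← Functor.map_comp_assoc]
  rw [T.χ_iso]

variable {D D' : B} {L : TwoCondensation D D'} {v : P.cat D} (m : W.Matched L v)

/-- Morphisms of condensations preserve matched 2-condensations. -/
def mapMatched : V.Matched (L.map R) ((t.app D).obj v) where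
  σ := (t.condHom L).χ v ≪≫ (t.app D).mapIso m.σ ≪≫ ((T.fib D).χ v).symm
  mul := by
    have h := m.mul
    rw [← cancel_mono ((T.fib D).χ v).hom]
    simp only [Iso.trans_hom, Iso.trans_inv, Iso.symm_hom, Iso.symm_inv, Functor.mapIso_hom,
      Functor.mapIso_inv, CatCond.Em_comp, Category.assoc, Iso.inv_hom_id, Category.comp_id]
    rw [CatCondHom.χ_M, reassoc_of% CatCondHom.χ_M]
    rw [← reassoc_of% CatCond.Em_comp _ ((T.fib D).χ v).inv, Iso.inv_hom_id, CatCond.Em_id,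
      Category.id_comp, ← reassoc_of% CatCond.Em_comp _ ((t.condHom L).χ v).inv, Iso.inv_hom_id,
      CatCond.Em_id, Category.id_comp, reassoc_of% CatCondHom.χ_nat, reassoc_of% CatCondHom.χ_nat,
      ← reassoc_of% T.χ₂_iso]
    simp only [← Functor.map_comp, h]
  comul := by
    have h := m.comul
    rw [← cancel_mono ((Q.condCat (L.map R)).Em ((T.fib D).χ v).hom),
      ← cancel_mono ((t.condHom L).χ _).hom]
    have h1 : (Q.condCat (L.map R)).Em ((T.fib D).χ v).inv ≫
        (Q.condCat (L.map R)).Em ((T.fib D).χ v).hom = 𝟙 _ := by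
      rw [← CatCond.Em_comp, Iso.inv_hom_id, CatCond.Em_id]
    have h2 : (V.fib (R.obj D)).Em ((t.condHom L).χ v).inv ≫
        (V.fib (R.obj D)).Em ((t.condHom L).χ v).hom = 𝟙 _ := by
      rw [← CatCond.Em_comp, Iso.inv_hom_id, CatCond.Em_id]
    simp only [Iso.trans_hom, Iso.trans_inv, Iso.symm_hom, Iso.symm_inv, Functor.mapIso_hom,
      Functor.mapIso_inv, CatCond.Em_comp, Category.assoc]
    rw [← T.χ₂_iso, reassoc_of% h1, reassoc_of% h2, reassoc_of% CatCondHom.χ_nat,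
      reassoc_of% CatCondHom.χ_D,
      CatCondHom.χ_nat, reassoc_of% CatCondHom.χ_D, Iso.inv_hom_id_assoc]
    simp only [← Functor.map_comp, h]

lemma mapMatched_σ_inv : (T.mapMatched m).σ.inv =
    ((T.fib D).χ v).hom ≫ (t.app D).map m.σ.inv ≫ ((t.condHom L).χ v).inv := by
  simp [mapMatched]

/-- Morphisms of condensations preserve linear objects. -/
def mapLinear {v' : P'.cat D'} (l : W.Linear m v') :
    V.Linear (T.mapMatched m) ((t'.app D').obj v') where
  a := (T.fib D').isoF v' ≪≫ (t.app D').mapIso l.a ≪≫ (t.iso L.g v).symm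
  lin := by
    have h := l.lin
    have h1 : ((t.condHom L).χ v).inv ≫ (Q.condCat (L.map R)).F.map (t.iso L.g v).hom =
        (t.iso L.f _).inv := by
      rw [Iso.inv_comp_eq, Iso.eq_comp_inv]; rfl
    have h3 := (Q.condCat (L.map R)).φ_nat (t.iso L.g v).hom
    have h4 := T.χ_iso L.g v
    have h5 : (V.fib (R.obj D')).Em (t.iso L.g v).inv ≫ (V.fib (R.obj D')).Em (t.iso L.g v).hom =
        𝟙 _ := by
      rw [← CatCond.Em_comp, Iso.inv_hom_id, CatCond.Em_id]
    have key : (Q.condCat (L.map R)).G.map ((t.condHom L).χ v).inv ≫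
        (Q.condCat (L.map R)).φ ((Q.pull (R.map L.g)).obj ((t.app D).obj v)) ≫
          (t.iso L.g v).hom = (t.iso L.g _).hom ≫
            (t.app D').map ((P.condCat L).φ ((P.pull L.g).obj v)) := by
      rw [← h3, ← (t.condHom L).φ_compat ((P.pull L.g).obj v), ← Functor.map_comp_assoc,
        ← Functor.map_comp_assoc, h1]
      erw [Iso.inv_hom_id]
      rw [CategoryTheory.Functor.map_id, Category.id_comp]
      rfl
    generalize (Q.condCat (L.map R)).φ ((Q.pull (R.map L.g)).obj ((t.app D).obj v)) = φ₁
      at key ⊢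
    generalize (P.condCat L).φ ((P.pull L.g).obj v) = φ₂ at key h
    rw [← cancel_mono (t.iso L.g v).hom]
    simp only [Iso.trans_hom, Iso.symm_hom, Functor.mapIso_hom, CatCond.Em_comp, Category.assoc,
      Iso.inv_hom_id, Category.comp_id, T.mapMatched_σ_inv, Functor.map_comp (Q.pull _)]
    rw [reassoc_of% CatCondHom.χ_A, ← Functor.map_comp, h, key, reassoc_of% t.iso_nat,
      ← reassoc_of% h4,
      reassoc_of% h5]
    simp only [Functor.map_comp]
    rw [reassoc_of% CatCondHom.χ_nat]

end PullCondHom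

/-! ### Representable and restricted systems -/

namespace PullSystem

/-- The representable system `Z ↦ (Z ⟶ Y)`. -/
abbrev hom {B : Type u} [Bicategory.{w, v} B] (Y : B) : PullSystem.{w, v, u, w, v} B where
  cat Z := Z ⟶ Y
  pull H := { obj := fun v => H ≫ v, map := fun n => H ◁ n }
  pull₂ η v := η ▷ v
  pull₂_nat η _ _ n := by simp only [whisker_exchange]
  pull₂_id H v := by simp
  pull₂_comp η θ v := by simp
  c G H v := α_ G H v
  c_nat G H _ _ n := by simp
  ι v := λ_ v
  ι_nat n := by simp
  c_left η H v := by simp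
  c_right G _ _ η v := by simp
  c_assoc F G H v := by simp
  unit_left G v := by simp
  unit_right G v := by simp

/-- The restriction of a contravariant system along a pseudofunctor. -/
abbrev restrict {B : Type u₁} [Bicategory.{w₁, v₁} B] {B' : Type u₂} [Bicategory.{w₂, v₂} B']
    (R : B ⥤ᵖ B') (P : PullSystem.{w₂, v₂, u₂, v₃, u₃} B') : PullSystem.{w₁, v₁, u₁, v₃, u₃} B where
  cat Z := P.cat (R.obj Z)
  pull H := P.pull (R.map H)
  pull₂ η v := P.pull₂ (R.map₂ η) v
  pull₂_nat η _ _ n := P.pull₂_nat _ n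
  pull₂_id H v := by rw [PrelaxFunctor.map₂_id, P.pull₂_id]
  pull₂_comp η θ v := by rw [PrelaxFunctor.map₂_comp, P.pull₂_comp]
  c G H v := P.pull₂Iso (R.mapComp G H) v ≪≫ P.c (R.map G) (R.map H) v
  c_nat G H _ _ n := by
    simp only [Iso.trans_hom, pull₂Iso_hom, Category.assoc]
    rw [reassoc_of% P.pull₂_nat, P.c_nat]
  ι v := P.pull₂Iso (R.mapId _) v ≪≫ P.ι v
  ι_nat n := by
    simp only [Iso.trans_hom, pull₂Iso_hom, Category.assoc]
    rw [reassoc_of% P.pull₂_nat, P.ι_nat]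
  c_left η H v := by
    simp only [Iso.trans_hom, pull₂Iso_hom, Category.assoc]
    rw [← P.c_left, ← reassoc_of% P.pull₂_comp, ← reassoc_of% P.pull₂_comp,
      Pseudofunctor.map₂_whisker_right]
    simp
  c_right G _ _ η v := by
    simp only [Iso.trans_hom, pull₂Iso_hom, Category.assoc]
    rw [← P.c_right, ← reassoc_of% P.pull₂_comp, ← reassoc_of% P.pull₂_comp,
      Pseudofunctor.map₂_whisker_left]
    simp
  c_assoc F G H v := by
    simp only [Iso.trans_hom, pull₂Iso_hom, Category.assoc, Functor.map_comp]
    rw [← reassoc_of% P.c_right, ← reassoc_of% P.c_left, ← P.c_assoc, ← reassoc_of% P.pull₂_comp,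
      ← reassoc_of% P.pull₂_comp, ← reassoc_of% P.pull₂_comp, ← reassoc_of% P.pull₂_comp,
      Pseudofunctor.map₂_associator]
    simp
  unit_left G v := by
    simp only [Iso.trans_hom, pull₂Iso_hom, Category.assoc]
    rw [← reassoc_of% P.c_left, P.unit_left, ← P.pull₂_comp, ← P.pull₂_comp,
      Pseudofunctor.map₂_left_unitor]
  unit_right G v := by
    simp only [Iso.trans_hom, pull₂Iso_hom, Category.assoc, Functor.map_comp]
    rw [← reassoc_of% P.c_right, P.unit_right, ← P.pull₂_comp, ← P.pull₂_comp,
      Pseudofunctor.map₂_right_unitor]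

/-! ### Squares of 1-morphisms -/

section

variable {B : Type u} [Bicategory.{w, v} B] (P : PullSystem.{w, v, u, v₁, u₁} B)

lemma c_exchange {X Z W V : B} (F : X ⟶ Z) (G : Z ⟶ W) (H : W ⟶ V) (v : P.cat V) :
    (P.pull F).map (P.c G H v).hom ≫ (P.c F G ((P.pull H).obj v)).inv =
      (P.c F (G ≫ H) v).inv ≫ P.pull₂ (α_ F G H).inv v ≫ (P.c (F ≫ G) H v).hom := by
  rw [Iso.eq_inv_comp, ← reassoc_of% P.c_assoc', Iso.hom_inv_id, Category.comp_id]

lemma c_exchange' {X Z W V : B} (F : X ⟶ Z) (G : Z ⟶ W) (H : W ⟶ V) (v : P.cat V) :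
    (P.c F G ((P.pull H).obj v)).hom ≫ (P.pull F).map (P.c G H v).inv =
      (P.c (F ≫ G) H v).inv ≫ P.pull₂ (α_ F G H).hom v ≫ (P.c F (G ≫ H) v).hom := by
  rw [Iso.eq_inv_comp, ← reassoc_of% P.c_assoc, Iso.map_hom_inv_id, Category.comp_id]

/-- The comparison of pullbacks given by a square which commutes up to an invertible
2-morphism. -/
def sq {X Y Z W : B} {p : X ⟶ Y} {q : Y ⟶ W} {r : X ⟶ Z} {t : Z ⟶ W} (s : p ≫ q ≅ r ≫ t)
    (u : P.cat W) : (P.pull p).obj ((P.pull q).obj u) ≅ (P.pull r).obj ((P.pull t).obj u) :=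
  (P.c p q u).symm ≪≫ P.pull₂Iso s u ≪≫ P.c r t u

lemma sq_hom {X Y Z W : B} {p : X ⟶ Y} {q : Y ⟶ W} {r : X ⟶ Z} {t : Z ⟶ W} (s : p ≫ q ≅ r ≫ t)
    (u : P.cat W) : (P.sq s u).hom = (P.c p q u).inv ≫ P.pull₂ s.hom u ≫ (P.c r t u).hom := rfl

lemma sq_nat {X Y Z W : B} {p : X ⟶ Y} {q : Y ⟶ W} {r : X ⟶ Z} {t : Z ⟶ W} (s : p ≫ q ≅ r ≫ t)
    {u u' : P.cat W} (n : u ⟶ u') :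
    (P.pull p).map ((P.pull q).map n) ≫ (P.sq s u').hom =
      (P.sq s u).hom ≫ (P.pull r).map ((P.pull t).map n) := by
  rw [sq_hom, sq_hom, reassoc_of% P.c_inv_nat, reassoc_of% P.pull₂_nat, P.c_nat]
  simp only [Category.assoc]

lemma sq_pull₂ {X Y Z W : B} {p : X ⟶ Y} {q q' : Y ⟶ W} {r r' : X ⟶ Z} {t : Z ⟶ W}
    (s : p ≫ q ≅ r ≫ t) (s' : p ≫ q' ≅ r' ≫ t) (η : q ⟶ q') (θ : r ⟶ r')
    (h : p ◁ η ≫ s'.hom = s.hom ≫ θ ▷ t) (u : P.cat W) :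
    (P.pull p).map (P.pull₂ η u) ≫ (P.sq s' u).hom =
      (P.sq s u).hom ≫ P.pull₂ θ ((P.pull t).obj u) := by
  rw [sq_hom, sq_hom, reassoc_of% P.c_inv_right, Category.assoc, Category.assoc, ← P.c_left,
    ← reassoc_of% P.pull₂_comp, ← reassoc_of% P.pull₂_comp, h]

/-- Compatibility of the comparison with horizontal pasting of squares. -/
lemma sq_c {X Y Z V V' W : B} {p : X ⟶ Y} {q : Y ⟶ V} {q' : V ⟶ W} {q'' : Y ⟶ W} {r : X ⟶ Z}
    {p' : Z ⟶ V} {r' : Z ⟶ V'} {r'' : X ⟶ V'} {t : V' ⟶ W}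
    (s : p ≫ q ≅ r ≫ p') (s' : p' ≫ q' ≅ r' ≫ t) (s'' : p ≫ q'' ≅ r'' ≫ t)
    (m : q'' ≅ q ≫ q') (m' : r'' ≅ r ≫ r')
    (h : p ◁ m.hom ≫ (α_ p q q').inv ≫ s.hom ▷ q' ≫ (α_ r p' q').hom ≫ r ◁ s'.hom =
      s''.hom ≫ m'.hom ▷ t ≫ (α_ r r' t).hom) (u : P.cat W) :
    (P.pull p).map (P.pull₂Iso m u ≪≫ P.c q q' u).hom ≫ (P.sq s ((P.pull q').obj u)).hom ≫
      (P.pull r).map (P.sq s' u).hom =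
        (P.sq s'' u).hom ≫ (P.pull₂Iso m' _ ≪≫ P.c r r' _).hom := by
  have h1 : (P.pull r).map (P.c r' t u).hom =
    (P.c r (r' ≫ t) u).inv ≫ P.pull₂ (α_ r r' t).inv u ≫ (P.c (r ≫ r') t u).hom ≫
      (P.c r r' ((P.pull t).obj u)).hom := by
    rw [P.c_assoc', Iso.inv_hom_id_assoc]
  have h2 : p ◁ m.hom ≫ (α_ p q q').inv ≫ s.hom ▷ q' ≫ (α_ r p' q').hom ≫ r ◁ s'.hom ≫
      (α_ r r' t).inv = s''.hom ≫ m'.hom ▷ t := by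
    rw [reassoc_of% h, Iso.hom_inv_id, Category.comp_id]
  simp only [sq_hom, Iso.trans_hom, pull₂Iso_hom, Functor.map_comp, Category.assoc]
  rw [reassoc_of% P.c_exchange, reassoc_of% P.c_exchange', reassoc_of% P.c_inv_right,
    ← reassoc_of% P.c_left,
    Iso.hom_inv_id_assoc, h1, ← reassoc_of% P.c_right, Iso.hom_inv_id_assoc, ← reassoc_of% P.c_left]
  simp only [← reassoc_of% P.pull₂_comp, h2]

/-- The morphism between the images of two condensations given by a square of 1-morphisms. -/
def condSquare {D D' E E' : B} {L : TwoCondensation D D'} {N : TwoCondensation E E'}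
    (p : E ⟶ D) (p' : E' ⟶ D') (s : N.f ≫ p' ≅ p ≫ L.f) (s' : N.g ≫ p ≅ p' ≫ L.g)
    (hφ : N.g ◁ s.hom ≫ (α_ _ _ _).inv ≫ s'.hom ▷ L.f ≫ (α_ _ _ _).hom ≫ p' ◁ L.φ ≫ (ρ_ p').hom =
      (α_ _ _ _).inv ≫ N.φ ▷ p' ≫ (λ_ p').hom)
    (hγ : (λ_ p').inv ≫ N.γ ▷ p' ≫ (α_ _ _ _).hom ≫ N.g ◁ s.hom ≫ (α_ _ _ _).inv ≫
      s'.hom ▷ L.f ≫ (α_ _ _ _).hom = (ρ_ p').inv ≫ p' ◁ L.γ) :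
    CatCondHom (P.condCat L) (P.condCat N) (P.pull p) (P.pull p') where
  isoF u := P.sq s u
  isoG v := P.sq s' v
  isoF_nat n := P.sq_nat s n
  isoG_nat n := P.sq_nat s' n
  φ_compat u := by
    simp only [sq_hom, Functor.map_comp, Category.assoc]
    rw [reassoc_of% P.c_exchange, reassoc_of% P.c_exchange', reassoc_of% P.c_inv_right,
      ← reassoc_of% P.c_left,
      Iso.hom_inv_id_assoc, ← reassoc_of% P.c_right, P.unit_right]
    simp only [← P.pull₂_comp, hφ]
    rw [P.pull₂_comp, P.pull₂_comp, ← reassoc_of% P.c_inv_assoc, ← reassoc_of% P.pull₂_comp,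
      Iso.hom_inv_id,
      P.pull₂_id, Category.id_comp, ← reassoc_of% P.c_inv_left, ← P.unit_left, Iso.inv_hom_id_assoc]
  γ_compat u := by
    have h1 : P.pull₂ (ρ_ p').inv u ≫ (P.c p' (𝟙 _) u).hom = (P.pull p').map (P.ι u).inv := by
      rw [← cancel_mono ((P.pull p').map (P.ι u).hom), Category.assoc, P.unit_right,
        ← P.pull₂_comp, Iso.inv_hom_id, P.pull₂_id, ← Functor.map_comp, Iso.inv_hom_id,
        CategoryTheory.Functor.map_id]
    have h2 : (P.ι ((P.pull p').obj u)).inv ≫ (P.c (𝟙 _) p' u).inv = P.pull₂ (λ_ p').inv u := by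
      rw [← cancel_mono ((P.c (𝟙 _) p' u).hom ≫ (P.ι _).hom), P.unit_left, ← P.pull₂_comp,
        Iso.inv_hom_id, P.pull₂_id, ← P.unit_left]
      simp
    simp only [sq_hom, Functor.map_comp, Category.assoc]
    rw [reassoc_of% P.c_exchange', reassoc_of% P.c_exchange, reassoc_of% P.c_inv_left,
      ← reassoc_of% P.c_right,
      Iso.hom_inv_id_assoc, ← reassoc_of% P.c_left, reassoc_of% h2, ← P.c_assoc,
      ← h1, Category.assoc, ← reassoc_of% P.c_right]
    simp only [← reassoc_of% P.pull₂_comp, hγ]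

end

end PullSystem

/-! ### The components of the structure of `B × B` -/

section

variable {B : Type u} [Bicategory.{w, v} B] {X Y Z W : B × B}

@[simp]
lemma pair_associator_hom (f : X ⟶ Y) (g : Y ⟶ Z) (h : Z ⟶ W) :
    (α_ f g h).hom = ((α_ f.1 g.1 h.1).hom ×ₘ (α_ f.2 g.2 h.2).hom) := rfl

@[simp]
lemma pair_associator_inv (f : X ⟶ Y) (g : Y ⟶ Z) (h : Z ⟶ W) :
    (α_ f g h).inv = ((α_ f.1 g.1 h.1).inv ×ₘ (α_ f.2 g.2 h.2).inv) := rfl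

@[simp]
lemma pair_leftUnitor_hom (f : X ⟶ Y) : (λ_ f).hom = ((λ_ f.1).hom ×ₘ (λ_ f.2).hom) := rfl

@[simp]
lemma pair_leftUnitor_inv (f : X ⟶ Y) : (λ_ f).inv = ((λ_ f.1).inv ×ₘ (λ_ f.2).inv) := rfl

@[simp]
lemma pair_rightUnitor_hom (f : X ⟶ Y) : (ρ_ f).hom = ((ρ_ f.1).hom ×ₘ (ρ_ f.2).hom) := rfl

@[simp]
lemma pair_rightUnitor_inv (f : X ⟶ Y) : (ρ_ f).inv = ((ρ_ f.1).inv ×ₘ (ρ_ f.2).inv) := rfl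

@[simp]
lemma pair_whiskerLeft (f : X ⟶ Y) {g h : Y ⟶ Z} (η : g ⟶ h) :
    f ◁ η = ((f.1 ◁ η.1) ×ₘ (f.2 ◁ η.2)) := rfl

@[simp]
lemma pair_whiskerRight {f g : X ⟶ Y} (η : f ⟶ g) (h : Y ⟶ Z) :
    η ▷ h = ((η.1 ▷ h.1) ×ₘ (η.2 ▷ h.2)) := rfl

@[simp]
lemma pair_comp_fst {f g h : X ⟶ Y} (η : f ⟶ g) (θ : g ⟶ h) : (η ≫ θ).1 = η.1 ≫ θ.1 := rfl

@[simp]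
lemma pair_comp_snd {f g h : X ⟶ Y} (η : f ⟶ g) (θ : g ⟶ h) : (η ≫ θ).2 = η.2 ≫ θ.2 := rfl

@[simp]
lemma pair_id_fst (f : X ⟶ Y) : (𝟙 f : f ⟶ f).1 = 𝟙 f.1 := rfl

@[simp]
lemma pair_id_snd (f : X ⟶ Y) : (𝟙 f : f ⟶ f).2 = 𝟙 f.2 := rfl

@[simp]
lemma pair_iso_hom {X Y X' Y' : B} {f g : X ⟶ Y} {f' g' : X' ⟶ Y'} (i : f ≅ g) (j : f' ≅ g') :
    (Iso.prod i j).hom = (i.hom ×ₘ j.hom) := rfl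

@[simp]
lemma pair_iso_inv {X Y X' Y' : B} {f g : X ⟶ Y} {f' g' : X' ⟶ Y'} (i : f ≅ g) (j : f' ≅ g') :
    (Iso.prod i j).inv = (i.inv ×ₘ j.inv) := rfl

end

/-! ### Condensations in the first variable -/

/-- The product of a 2-condensation with an object. -/
abbrev TwoCondensation.prodId {B : Type u} [Bicategory.{w, v} B] {C A : B}
    (K : TwoCondensation C A) (Z : B) : TwoCondensation (B := B × B) (C, Z) (A, Z) where
  f := K.f ×ₘ 𝟙 Z
  g := K.g ×ₘ 𝟙 Z
  φ := K.φ ×ₘ (λ_ (𝟙 Z)).hom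
  γ := K.γ ×ₘ (λ_ (𝟙 Z)).inv
  γ_φ := by
    apply Prod.ext
    · exact K.γ_φ
    · exact (λ_ (𝟙 Z)).inv_hom_id

/-- The pseudofunctor `Z ↦ (C, Z)`. -/
abbrev pairR {B : Type u} [Bicategory.{w, v} B] (C : B) : B ⥤ᵖ (B × B) where
  obj Z := (C, Z)
  map H := 𝟙 C ×ₘ H
  map₂ η := 𝟙 (𝟙 C) ×ₘ η
  mapId Z := Iso.refl _
  mapComp F G := Iso.prod (λ_ (𝟙 C)).symm (Iso.refl _)

namespace PullSystem

variable {B : Type u} [Bicategory.{w, v} B] (Q : PullSystem.{w, v, u, v₁, u₁} (B × B)) {C A : B}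

/-- A 2-condensation of `C` onto `A` acts on the restrictions of a system over `B × B` to `C`
and `A` in the first variable. -/
abbrev firstCond (K : TwoCondensation C A) :
    PullCond (restrict (pairR C) Q) (restrict (pairR A) Q) where
  fib Z := Q.condCat (K.prodId Z)
  hom {X Z} H := Q.condSquare (L := K.prodId Z) (N := K.prodId X) (𝟙 C ×ₘ H) (𝟙 A ×ₘ H)
    (Iso.prod (ρ_ K.f ≪≫ (λ_ K.f).symm) (λ_ H ≪≫ (ρ_ H).symm))
    (Iso.prod (ρ_ K.g ≪≫ (λ_ K.g).symm) (λ_ H ≪≫ (ρ_ H).symm))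
    (by apply Prod.ext <;> dsimp <;> bicategory)
    (by apply Prod.ext <;> dsimp <;> bicategory)
  isoF_pull₂ η u := Q.sq_pull₂ _ _ _ _ (by apply Prod.ext <;> dsimp <;> bicategory) u
  isoG_pull₂ η v := Q.sq_pull₂ _ _ _ _ (by apply Prod.ext <;> dsimp <;> bicategory) v
  isoF_c G H u := Q.sq_c _ _ _ _ _ (by apply Prod.ext <;> dsimp <;> bicategory) u
  isoG_c G H v := Q.sq_c _ _ _ _ _ (by apply Prod.ext <;> dsimp <;> bicategory) v

variable (P : PullSystem.{w, v, u, v₁, u₁} B)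

lemma sq_pull₂' {X Y Z W : B} {p p' : X ⟶ Y} {q : Y ⟶ W} {r : X ⟶ Z} {t t' : Z ⟶ W}
    (s : p ≫ q ≅ r ≫ t) (s' : p' ≫ q ≅ r ≫ t') (η : p ⟶ p') (θ : t ⟶ t')
    (h : η ▷ q ≫ s'.hom = s.hom ≫ r ◁ θ) (u : P.cat W) :
    P.pull₂ η ((P.pull q).obj u) ≫ (P.sq s' u).hom =
      (P.sq s u).hom ≫ (P.pull r).map (P.pull₂ θ u) := by
  rw [sq_hom, sq_hom, reassoc_of% P.c_inv_left, Category.assoc, Category.assoc, ← P.c_right,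
    ← reassoc_of% P.pull₂_comp, ← reassoc_of% P.pull₂_comp, h]

/-- Replacing the 1-morphisms of a 2-condensation by isomorphic ones. -/
def congrCondHom {𝓕 : Type u₂} [Category.{v₂} 𝓕] {𝓕' : Type u₃} [Category.{v₃} 𝓕']
    {D D' : B} {N N' : TwoCondensation D D'} {X : CatCond 𝓕 𝓕'} {Θ : 𝓕 ⥤ P.cat D}
    {Θ' : 𝓕' ⥤ P.cat D'} (T : CatCondHom X (P.condCat N) Θ Θ') (a : N'.f ≅ N.f) (b : N'.g ≅ N.g)
    (hφ : N'.g ◁ a.hom ≫ b.hom ▷ N.f ≫ N.φ = N'.φ)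
    (hγ : N'.γ ≫ N'.g ◁ a.hom ≫ b.hom ▷ N.f = N.γ) : CatCondHom X (P.condCat N') Θ Θ' where
  isoF u := P.pull₂Iso a _ ≪≫ T.isoF u
  isoG v := P.pull₂Iso b _ ≪≫ T.isoG v
  isoF_nat n := by
    have h := T.isoF_nat n
    simp only [Iso.trans_hom, pull₂Iso_hom, Category.assoc]
    rw [reassoc_of% P.pull₂_nat, h]
  isoG_nat n := by
    have h := T.isoG_nat n
    simp only [Iso.trans_hom, pull₂Iso_hom, Category.assoc]
    rw [reassoc_of% P.pull₂_nat, h]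
  φ_compat u := by
    have h := T.φ_compat u
    simp only [Iso.trans_hom, pull₂Iso_hom, Category.assoc, Functor.map_comp]
    rw [reassoc_of% P.pull₂_nat, h, reassoc_of% P.c_inv_left, reassoc_of% P.c_inv_right,
      ← reassoc_of% P.pull₂_comp,
      ← reassoc_of% P.pull₂_comp, Category.assoc, hφ]
  γ_compat u := by
    have h := T.γ_compat u
    simp only [Iso.trans_hom, pull₂Iso_hom, Category.assoc, Functor.map_comp]
    rw [reassoc_of% P.pull₂_nat, ← h, ← reassoc_of% P.c_right, ← reassoc_of% P.c_left,
      ← reassoc_of% P.pull₂_comp,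
      ← reassoc_of% P.pull₂_comp, Category.assoc, hγ]
    simp only [Category.assoc]

end PullSystem

/-- The pseudofunctor `(X, Y) ↦ (X, R Y)`. -/
abbrev pairMap {B : Type u} [Bicategory.{w, v} B] (R : B ⥤ᵖ B) : (B × B) ⥤ᵖ (B × B) where
  obj X := (X.1, R.obj X.2)
  map f := f.1 ×ₘ R.map f.2
  map₂ η := η.1 ×ₘ R.map₂ η.2
  mapId X := Iso.prod (Iso.refl _) (R.mapId X.2)
  mapComp f g := Iso.prod (Iso.refl _) (R.mapComp f.2 g.2)

namespace PullHom

section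

variable {B : Type u₁} [Bicategory.{w₁, v₁} B] {B' : Type u₂} [Bicategory.{w₂, v₂} B']
  {P : PullSystem.{w₁, v₁, u₁, v₃, u₃} B} {Q : PullSystem.{w₂, v₂, u₂, v₄, u₄} B'}
  {R : B ⥤ᵖ B'} (t : PullHom P Q R)

/-- Morphisms of systems are compatible with the comparisons given by squares. -/
lemma sq_iso {X Y Z W : B} {p : X ⟶ Y} {q : Y ⟶ W} {r : X ⟶ Z} {k : Z ⟶ W} (s : p ≫ q ≅ r ≫ k)
    (u : P.cat W) :
    (Q.pull (R.map p)).map (t.iso q u).hom ≫ (t.iso p _).hom ≫ (t.app X).map (P.sq s u).hom =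
      (Q.sq ((R.mapComp p q).symm ≪≫ R.map₂Iso s ≪≫ R.mapComp r k) ((t.app W).obj u)).hom ≫
        (Q.pull (R.map r)).map (t.iso k u).hom ≫ (t.iso r _).hom := by
  simp only [PullSystem.sq_hom, Iso.trans_hom, Iso.symm_hom, PrelaxFunctor.map₂Iso_hom,
    Functor.map_comp, Category.assoc, Q.pull₂_comp]
  have h := t.iso_c' p q u
  rw [← Iso.eq_inv_comp] at h
  rw [t.iso_c', ← reassoc_of% Q.pull₂_comp (R.mapComp r k).hom, Iso.hom_inv_id, Q.pull₂_id,
    Category.id_comp, reassoc_of% t.iso_pull₂, reassoc_of% h, Iso.map_hom_inv_id_assoc]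

end

variable {B : Type u} [Bicategory.{w, v} B] {P : PullSystem.{w, v, u, v₁, u₁} (B × B)}
  {Q : PullSystem.{w, v, u, v₂, u₂} (B × B)} {R : B ⥤ᵖ B} (t : PullHom P Q (pairMap R))

/-- The restriction of a morphism of systems over `B × B` to an object in the first variable. -/
abbrev restrictPair (C : B) :
    PullHom (PullSystem.restrict (pairR C) P) (PullSystem.restrict (pairR C) Q) R where
  app Z := t.app (C, Z)
  iso H v := t.iso (𝟙 C ×ₘ H) v
  iso_nat H _ _ n := t.iso_nat (𝟙 C ×ₘ H) n
  iso_pull₂ η v := t.iso_pull₂ (X := (C, _)) (Z := (C, _)) (H := 𝟙 C ×ₘ _) (H' := 𝟙 C ×ₘ _)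
    (𝟙 (𝟙 C) ×ₘ η) v
  iso_c {X Z W} G H v := by
    have h1 := t.iso_c (𝟙 C ×ₘ G) (𝟙 C ×ₘ H) v
    have h2 : Q.pull₂ ((pairMap R).map₂ ((pairR C).mapComp G H).hom) ((t.app (C, W)).obj v) ≫
        (t.iso ((𝟙 C ×ₘ G) ≫ (𝟙 C ×ₘ H)) v).hom = (t.iso (𝟙 C ×ₘ (G ≫ H)) v).hom ≫
          (t.app (C, X)).map (P.pull₂ (Iso.prod (λ_ (𝟙 C)).symm (Iso.refl (G ≫ H))).hom v) :=
      t.iso_pull₂ _ v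
    simp only [Iso.trans_hom, PullSystem.pull₂Iso_hom, Category.assoc, Functor.map_comp]
    rw [← reassoc_of% h2, ← h1, ← reassoc_of% Q.pull₂_comp, ← reassoc_of% Q.pull₂_comp]
    congr 2
    apply Prod.ext <;> simp
  iso_ι {Z} v := by
    have h1 := t.iso_ι (Z := (C, Z)) v
    simp only [Iso.trans_hom, PullSystem.pull₂Iso_hom, Iso.refl_hom, PullSystem.pull₂_id,
      Category.id_comp]
    exact h1

lemma map₂_rightUnitor_inv {X Z : B} (H : X ⟶ Z) : R.map₂ (ρ_ H).inv =
    (ρ_ (R.map H)).inv ≫ R.map H ◁ (R.mapId Z).inv ≫ (R.mapComp H (𝟙 Z)).inv := by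
  rw [← cancel_epi (R.map₂ (ρ_ H).hom), ← PrelaxFunctor.map₂_comp, Iso.hom_inv_id,
    PrelaxFunctor.map₂_id, Pseudofunctor.map₂_right_unitor]
  simp

/-- Replacing `f ×ₘ 𝟙 (R Z)` by the image of `f ×ₘ 𝟙 Z` is compatible with the interchange of `f` with
1-morphisms in the second variable. -/
lemma restrict_sq {X Z A C : B} (H : X ⟶ Z) (f : C ⟶ A) (u : P.cat (A, Z)) :
    (Q.pull (f ×ₘ 𝟙 (R.obj X))).map (t.iso (𝟙 A ×ₘ H) u).hom ≫
      (Q.pull₂Iso (Iso.prod (Iso.refl f) (R.mapId X).symm :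
        (f ×ₘ 𝟙 (R.obj X)) ≅ (pairMap R).map (f ×ₘ 𝟙 X)) _ ≪≫ t.iso (f ×ₘ 𝟙 X) _).hom ≫
        (t.app (C, X)).map (P.sq (p := f ×ₘ 𝟙 X) (q := 𝟙 A ×ₘ H) (r := 𝟙 C ×ₘ H) (t := f ×ₘ 𝟙 Z)
          (Iso.prod (ρ_ f ≪≫ (λ_ f).symm) (λ_ H ≪≫ (ρ_ H).symm)) u).hom =
      (Q.sq (p := f ×ₘ 𝟙 (R.obj X)) (q := 𝟙 A ×ₘ R.map H) (r := 𝟙 C ×ₘ R.map H)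
          (t := f ×ₘ 𝟙 (R.obj Z))
          (Iso.prod (ρ_ f ≪≫ (λ_ f).symm) (λ_ (R.map H) ≪≫ (ρ_ (R.map H)).symm)) _).hom ≫
        (Q.pull (𝟙 C ×ₘ R.map H)).map (Q.pull₂Iso (Iso.prod (Iso.refl f) (R.mapId Z).symm :
          (f ×ₘ 𝟙 (R.obj Z)) ≅ (pairMap R).map (f ×ₘ 𝟙 Z)) _ ≪≫ t.iso (f ×ₘ 𝟙 Z) _).hom ≫
          (t.iso (𝟙 C ×ₘ H) _).hom := by
  simp only [Iso.trans_hom, PullSystem.pull₂Iso_hom, Functor.map_comp, Category.assoc]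
  rw [reassoc_of% Q.pull₂_nat]
  have h := t.sq_iso (p := f ×ₘ 𝟙 X) (q := 𝟙 A ×ₘ H) (r := 𝟙 C ×ₘ H) (k := f ×ₘ 𝟙 Z)
    (Iso.prod (ρ_ f ≪≫ (λ_ f).symm) (λ_ H ≪≫ (ρ_ H).symm)) u
  rw [h]
  simp only [← Category.assoc]
  congr 2
  refine Q.sq_pull₂' _ _ _ _ ?_ _
  apply Prod.ext
  · simp
  · simp [map₂_rightUnitor_inv]

/-- A morphism of systems over `B × B` is compatible with the action of condensations in the first
variable. -/
def firstCondHom {C A : B} (K : TwoCondensation C A) :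
    PullCondHom (P.firstCond K) (Q.firstCond K) (restrictPair t C) (restrictPair t A) where
  fib Z := Q.congrCondHom (N' := K.prodId (R.obj Z)) (t.condHom (K.prodId Z))
    (Iso.prod (Iso.refl _) (R.mapId Z).symm) (Iso.prod (Iso.refl _) (R.mapId Z).symm)
    (by
      apply Prod.ext
      · simp
      · simp
        rw [← whisker_exchange_assoc]
        simp)
    (by
      apply Prod.ext
      · simp
      · simp
        rw [map₂_rightUnitor_inv, ← cancel_epi (R.mapId Z).inv, leftUnitor_inv_naturality_assoc,
          whisker_exchange]
        simp [unitors_inv_equal])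
  isoF_hom H u := restrict_sq t H K.f u
  isoG_hom H v := restrict_sq t H K.g v

end PullHom

/-! ### Morphisms of systems from the tensor product -/

namespace PullSystem

variable {B : Type u} [Bicategory.{w, v} B] (P : PullSystem.{w, v, u, v₁, u₁} B)

/-- Compatibility of the comparison with vertical pasting of squares. -/
lemma sq_c' {X X' Y Z Z' W : B} {p₁ : X ⟶ X'} {p₂ : X' ⟶ Y} {q : Y ⟶ W} {q₁ : X' ⟶ Z'}
    {t₂ : Z' ⟶ W} {r : X ⟶ Z} {t₁ : Z ⟶ Z'} {p : X ⟶ Y} {t : Z ⟶ W}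
    (s₁ : p₁ ≫ q₁ ≅ r ≫ t₁) (s₂ : p₂ ≫ q ≅ q₁ ≫ t₂) (s : p ≫ q ≅ r ≫ t)
    (m : p ≅ p₁ ≫ p₂) (m' : t ≅ t₁ ≫ t₂)
    (h : m.hom ▷ q ≫ (α_ _ _ _).hom ≫ p₁ ◁ s₂.hom ≫ (α_ _ _ _).inv ≫ s₁.hom ▷ t₂ ≫
      (α_ _ _ _).hom = s.hom ≫ r ◁ m'.hom) (u : P.cat W) :
    (P.pull₂Iso m _ ≪≫ P.c p₁ p₂ ((P.pull q).obj u)).hom ≫ (P.pull p₁).map (P.sq s₂ u).hom ≫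
      (P.sq s₁ ((P.pull t₂).obj u)).hom =
        (P.sq s u).hom ≫ (P.pull r).map (P.pull₂Iso m' _ ≪≫ P.c t₁ t₂ u).hom := by
  simp only [sq_hom, Iso.trans_hom, pull₂Iso_hom, Functor.map_comp, Category.assoc]
  rw [reassoc_of% P.c_exchange, reassoc_of% P.c_exchange', ← reassoc_of% P.c_right,
    Iso.hom_inv_id_assoc,
    ← reassoc_of% P.c_left, ← reassoc_of% P.c_right, ← P.c_assoc, reassoc_of% P.c_inv_left]
  simp only [← reassoc_of% P.pull₂_comp, h]

/-- Compatibility of the comparison with identity squares. -/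
lemma sq_ι {X Y : B} {p : X ⟶ X} {q : X ⟶ Y} {t : Y ⟶ Y} (s : p ≫ q ≅ q ≫ t) (m : p ⟶ 𝟙 X)
    (m' : t ⟶ 𝟙 Y) (h : s.hom ≫ q ◁ m' = m ▷ q ≫ (λ_ q).hom ≫ (ρ_ q).inv) (u : P.cat Y) :
    (P.sq s u).hom ≫ (P.pull q).map (P.pull₂ m' u ≫ (P.ι u).hom) =
      P.pull₂ m _ ≫ (P.ι ((P.pull q).obj u)).hom := by
  have h' : s.hom ≫ q ◁ m' ≫ (ρ_ q).hom = m ▷ q ≫ (λ_ q).hom := by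
    rw [reassoc_of% h, Iso.inv_hom_id, Category.comp_id]
  simp only [sq_hom, Functor.map_comp, Category.assoc]
  rw [← reassoc_of% P.c_right, P.unit_right, ← P.pull₂_comp, ← P.pull₂_comp, h', P.pull₂_comp,
    ← reassoc_of% P.c_inv_left, ← P.unit_left, Iso.inv_hom_id_assoc]

end PullSystem

/-- A square of pseudofunctors which commutes up to a strong transformation, written out in
components. -/
structure SquareTrans {A : Type u₁} [Bicategory.{w₁, v₁} A] {A' : Type u₂} [Bicategory.{w₂, v₂} A']
    {B : Type u₃} [Bicategory.{w₃, v₃} B] {B' : Type u₄} [Bicategory.{w₄, v₄} B']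
    (S : A ⥤ᵖ A') (F' : A' ⥤ᵖ B') (F : A ⥤ᵖ B) (R : B ⥤ᵖ B') where
  /-- the components -/
  app (X : A) : F'.obj (S.obj X) ⟶ R.obj (F.obj X)
  /-- the naturality squares -/
  nat {X Y : A} (f : X ⟶ Y) : F'.map (S.map f) ≫ app Y ≅ app X ≫ R.map (F.map f)
  nat_nat {X Y : A} {f g : X ⟶ Y} (η : f ⟶ g) :
    F'.map₂ (S.map₂ η) ▷ app Y ≫ (nat g).hom = (nat f).hom ≫ app X ◁ R.map₂ (F.map₂ η)
  nat_id (X : A) :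
    (nat (𝟙 X)).hom ≫ app X ◁ (R.map₂ (F.mapId X).hom ≫ (R.mapId _).hom) =
      (F'.map₂ (S.mapId X).hom ≫ (F'.mapId _).hom) ▷ app X ≫ (λ_ (app X)).hom ≫ (ρ_ (app X)).inv
  nat_comp {X Y Z : A} (f : X ⟶ Y) (g : Y ⟶ Z) :
    (nat (f ≫ g)).hom ≫ app X ◁ (R.map₂ (F.mapComp f g).hom ≫ (R.mapComp _ _).hom) =
      (F'.map₂ (S.mapComp f g).hom ≫ (F'.mapComp _ _).hom) ▷ app Z ≫ (α_ _ _ _).hom ≫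
        F'.map (S.map f) ◁ (nat g).hom ≫ (α_ _ _ _).inv ≫ (nat f).hom ▷ R.map (F.map g) ≫
          (α_ _ _ _).hom

namespace PullHom

/-- A pseudofunctor `R` and a 1-morphism `u : R I ⟶ Y` give a morphism of representable
systems. -/
abbrev homMap {B : Type u₁} [Bicategory.{w₁, v₁} B] {B' : Type u₂} [Bicategory.{w₂, v₂} B']
    (R : B ⥤ᵖ B') {I : B} {Y : B'} (y : R.obj I ⟶ Y) :
    PullHom (PullSystem.hom I) (PullSystem.hom Y) R where
  app Z := { obj := fun v => R.map v ≫ y, map := fun n => R.map₂ n ▷ y }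
  iso H v := (α_ _ _ _).symm ≪≫ whiskerRightIso (R.mapComp H v).symm y
  iso_nat H _ _ n := by
    simp
  iso_pull₂ η v := by
    simp
  iso_c G H v := by
    simp
  iso_ι v := by
    simp

/-- Restriction of a morphism of systems along a square of pseudofunctors. -/
abbrev restrictSquare {A : Type u₁} [Bicategory.{w₁, v₁} A] {A' : Type u₂}
    [Bicategory.{w₂, v₂} A'] {B : Type u₃} [Bicategory.{w₃, v₃} B] {B' : Type u₄}
    [Bicategory.{w₄, v₄} B'] {S : A ⥤ᵖ A'} {F' : A' ⥤ᵖ B'} {F : A ⥤ᵖ B} {R : B ⥤ᵖ B'}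
    (θ : SquareTrans S F' F R) {P : PullSystem.{w₃, v₃, u₃, v, u} B}
    {Q : PullSystem.{w₄, v₄, u₄, v₅, u₅} B'} (t : PullHom P Q R) :
    PullHom (PullSystem.restrict F P) (PullSystem.restrict F' Q) S where
  app X := t.app (F.obj X) ⋙ Q.pull (θ.app X)
  iso {X Z} H v := Q.sq (θ.nat H) _ ≪≫ (Q.pull (θ.app X)).mapIso (t.iso (F.map H) v)
  iso_nat {X Z} H v v' n := by
    have h := t.iso_nat (F.map H) n
    simp only [Iso.trans_hom, Functor.mapIso_hom, Functor.comp_map, Category.assoc]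
    rw [reassoc_of% Q.sq_nat, ← Functor.map_comp, ← Functor.map_comp, h]
  iso_pull₂ {X Z H H'} η v := by
    have h := t.iso_pull₂ (F.map₂ η) v
    have h2 := Q.sq_pull₂' (θ.nat H) (θ.nat H') (F'.map₂ (S.map₂ η)) _ (θ.nat_nat η)
      ((t.app (F.obj Z)).obj v)
    simp only [Iso.trans_hom, Functor.mapIso_hom, Functor.comp_map, Functor.comp_obj,
      Category.assoc]
    rw [← Functor.map_comp, ← h, Functor.map_comp]
    simpa only [Category.assoc] using h2 =≫ (Q.pull (θ.app X)).map (t.iso (F.map H') v).hom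
  iso_c {X Z W} G H v := by
    have h := t.iso_c (F.map G) (F.map H) v
    have h1 := t.iso_pull₂ (F.mapComp G H).hom v
    have h2 := Q.sq_c' (θ.nat G) (θ.nat H) (θ.nat (G ≫ H))
      (F'.map₂Iso (S.mapComp G H) ≪≫ F'.mapComp _ _) (R.map₂Iso (F.mapComp G H) ≪≫ R.mapComp _ _)
      (by simpa using (θ.nat_comp G H).symm) ((t.app (F.obj W)).obj v)
    simp only [Iso.trans_hom, PullSystem.pull₂Iso_hom, PrelaxFunctor.map₂Iso_hom, Q.pull₂_comp,
      Category.assoc] at h2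
    simp only [Iso.trans_hom, Functor.mapIso_hom, Functor.comp_map, Functor.comp_obj,
      Category.assoc, PullSystem.pull₂Iso_hom, Functor.map_comp]
    rw [reassoc_of% Q.sq_nat, reassoc_of% h2]
    simp only [← Functor.map_comp, Category.assoc]
    rw [Functor.map_comp (t.app _), ← reassoc_of% h1, h]
  iso_ι {Z} v := by
    have h := t.iso_ι (Z := F.obj Z) v
    have h1 := t.iso_pull₂ (F.mapId Z).hom v
    have h2 := Q.sq_ι _ _ _ (θ.nat_id Z) ((t.app (F.obj Z)).obj v)
    simp only [Q.pull₂_comp, Category.assoc] at h2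
    simp only [Iso.trans_hom, Functor.mapIso_hom, Functor.comp_map, Functor.comp_obj,
      Category.assoc, PullSystem.pull₂Iso_hom, ← Functor.map_comp]
    rw [← h2, Functor.map_comp (t.app _), ← reassoc_of% h1, h]

end PullHom

/-- The pseudofunctor `Z ↦ (Z, Y)`. -/
abbrev pairL {B : Type u} [Bicategory.{w, v} B] (Y : B) : B ⥤ᵖ (B × B) where
  obj Z := (Z, Y)
  map H := H ×ₘ 𝟙 Y
  map₂ η := η ×ₘ 𝟙 (𝟙 Y)
  mapId Z := Iso.refl _
  mapComp F G := Iso.prod (Iso.refl _) (λ_ (𝟙 Y)).symm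

namespace MonoidalData

variable {B : Type u} [Bicategory.{w, v} B] (T : MonoidalData B)

/-- The pseudofunctor `Z ↦ Z ⊠ Y`. -/
abbrev tensorR (Y : B) : B ⥤ᵖ B where
  obj Z := T.obj Z Y
  map f := T.wr f Y
  map₂ η := T.tensor.map₂ (η ×ₘ 𝟙 (𝟙 Y))
  mapId Z := T.tensor.map₂Iso (Iso.refl (𝟙 (Z, Y))) ≪≫ T.mapId Z Y
  mapComp f g := T.wrComp f g Y
  map₂_id f := ((pairL Y).comp T.tensor).map₂_id f
  map₂_comp η θ := ((pairL Y).comp T.tensor).map₂_comp η θ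
  map₂_whisker_left f _ _ η := ((pairL Y).comp T.tensor).map₂_whisker_left f η
  map₂_whisker_right η h := ((pairL Y).comp T.tensor).map₂_whisker_right η h
  map₂_associator f g h := ((pairL Y).comp T.tensor).map₂_associator f g h
  map₂_left_unitor f := ((pairL Y).comp T.tensor).map₂_left_unitor f
  map₂_right_unitor f := ((pairL Y).comp T.tensor).map₂_right_unitor f

lemma map₂_id_id {a a' b b' : B} (f : a ⟶ a') (g : b ⟶ b') :
    T.tensor.map₂ (𝟙 f ×ₘ 𝟙 g) = 𝟙 (T.map f g) :=
  T.tensor.map₂_id (f ×ₘ g)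

/-- The inverse associator, as a transformation in the first two variables. -/
abbrev assocSquare (Y : B) : SquareTrans (pairMap (T.tensorR Y)) T.tensor T.tensor (T.tensorR Y) where
  app X := T.asInv X.1 X.2 Y
  nat f := T.associator.inv.naturality ((f.1 ×ₘ f.2) ×ₘ 𝟙 Y)
  nat_nat η := T.associator.inv.naturality_naturality
    (a := ((_, _), Y)) (b := ((_, _),
    Y)) (f := (_ ×ₘ _) ×ₘ 𝟙 Y) (g := (_ ×ₘ _) ×ₘ 𝟙 Y) ((η.1 ×ₘ η.2) ×ₘ 𝟙 (𝟙 Y))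
  nat_id X := by
    have h := T.associator.inv.naturality_id ((X.1, X.2), Y)
    have h1 : (((prodMap T.tensor (Pseudofunctor.id B)).comp T.tensor).mapId ((X.1, X.2), Y)).hom =
        (T.tensorR Y).map₂ (T.tensor.mapId X).hom ≫ ((T.tensorR Y).mapId _).hom := by
      change T.tensor.map₂ ((T.tensor.mapId X).hom ×ₘ 𝟙 (𝟙 Y)) ≫ (T.mapId _ _).hom =
        T.tensor.map₂ _ ≫ T.tensor.map₂ (𝟙 _) ≫ (T.mapId _ _).hom
      rw [PrelaxFunctor.map₂_id, Category.id_comp]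
    have h2 : ((((prodAssoc B B B).comp (prodMap (Pseudofunctor.id B) T.tensor)).comp
        T.tensor).mapId ((X.1, X.2), Y)).hom =
        T.tensor.map₂ ((pairMap (T.tensorR Y)).mapId X).hom ≫ (T.tensor.mapId _).hom :=
      congrArg (fun x => T.tensor.map₂ x ≫ (T.tensor.mapId (X.1, T.obj X.2 Y)).hom)
        (Prod.ext (Category.id_comp _) rfl)
    rw [h1, h2] at h
    exact h
  nat_comp {X Z W} f g := by
    have h := T.associator.inv.naturality_comp ((f.1 ×ₘ f.2) ×ₘ 𝟙 Y) ((g.1 ×ₘ g.2) ×ₘ 𝟙 Y)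
    let η : (((f ≫ g).1 ×ₘ (f ≫ g).2) ×ₘ 𝟙 Y : ((X.1, X.2), Y) ⟶ ((W.1, W.2), Y)) ⟶
        (((f.1 ×ₘ f.2) ×ₘ 𝟙 Y : ((X.1, X.2), Y) ⟶ ((Z.1, Z.2), Y)) ≫
          ((g.1 ×ₘ g.2) ×ₘ 𝟙 Y : ((Z.1, Z.2), Y) ⟶ ((W.1, W.2), Y))) :=
      (𝟙 _ ×ₘ 𝟙 _) ×ₘ (λ_ (𝟙 Y)).inv
    have hη := T.associator.inv.naturality_naturality η
    have h1 : (T.tensorR Y).map₂ (T.tensor.mapComp f g).hom ≫ ((T.tensorR Y).mapComp _ _).hom =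
        ((prodMap T.tensor (Pseudofunctor.id B)).comp T.tensor).map₂ η ≫
          (((prodMap T.tensor (Pseudofunctor.id B)).comp T.tensor).mapComp
        ((f.1 ×ₘ f.2) ×ₘ 𝟙 Y) ((g.1 ×ₘ g.2) ×ₘ 𝟙 Y)).hom := by
      change T.tensor.map₂ ((T.tensor.mapComp f g).hom ×ₘ 𝟙 (𝟙 Y)) ≫
          T.tensor.map₂ (𝟙 _ ×ₘ (λ_ (𝟙 Y)).inv) ≫ (T.mapComp _ _ _ _).hom =
        T.tensor.map₂ (T.tensor.map₂ (𝟙 _) ×ₘ (λ_ (𝟙 Y)).inv) ≫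
          T.tensor.map₂ ((T.tensor.mapComp f g).hom ×ₘ 𝟙 _) ≫ (T.mapComp _ _ _ _).hom
      rw [← PrelaxFunctor.map₂_comp_assoc, ← PrelaxFunctor.map₂_comp_assoc]
      congr 2
      apply Prod.ext <;> simp [T.map₂_id_id]
    have h2 : T.tensor.map₂ ((pairMap (T.tensorR Y)).mapComp f g).hom ≫ (T.tensor.mapComp _ _).hom =
        (((prodAssoc B B B).comp (prodMap (Pseudofunctor.id B) T.tensor)).comp T.tensor).map₂ η ≫
          ((((prodAssoc B B B).comp (prodMap (Pseudofunctor.id B) T.tensor)).comp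
            T.tensor).mapComp ((f.1 ×ₘ f.2) ×ₘ 𝟙 Y) ((g.1 ×ₘ g.2) ×ₘ 𝟙 Y)).hom := by
      change T.tensor.map₂ (𝟙 _ ×ₘ (T.tensor.map₂ (𝟙 _ ×ₘ (λ_ (𝟙 Y)).inv) ≫
          (T.mapComp _ _ _ _).hom)) ≫ (T.mapComp _ _ _ _).hom =
        T.tensor.map₂ (𝟙 _ ×ₘ T.tensor.map₂ (𝟙 _ ×ₘ (λ_ (𝟙 Y)).inv)) ≫
          T.tensor.map₂ ((𝟙 _ ≫ 𝟙 _) ×ₘ (T.tensor.map₂ (𝟙 _) ≫ (T.mapComp _ _ _ _).hom)) ≫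
            (T.mapComp _ _ _ _).hom
      rw [← PrelaxFunctor.map₂_comp_assoc]
      congr 2
      apply Prod.ext <;> simp [T.map₂_id_id]
    have h3 := hη =≫ (T.associator.inv.app ((X.1, X.2), Y) ◁
      (((prodMap T.tensor (Pseudofunctor.id B)).comp T.tensor).mapComp
        ((f.1 ×ₘ f.2) ×ₘ 𝟙 Y) ((g.1 ×ₘ g.2) ×ₘ 𝟙 Y)).hom)
    rw [Category.assoc, Category.assoc, ← whiskerLeft_comp, h, ← comp_whiskerRight_assoc] at h3
    rw [h1, h2]
    exact h3.symm

/-- The operation `v ↦ (C ⊠ (Z ⊠ Y) ⟶ (C ⊠ Z) ⊠ Y ⟶ I ⊠ Y ⟶ Y)` on 1-morphisms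
`v : C ⊠ Z ⟶ I`. -/
abbrev tensorHom (Y : B) : PullHom (PullSystem.restrict T.tensor (PullSystem.hom T.unit))
    (PullSystem.restrict T.tensor (PullSystem.hom Y)) (pairMap (T.tensorR Y)) :=
  PullHom.restrictSquare (T.assocSquare Y) (PullHom.homMap (T.tensorR Y) (T.lu Y))

/-! ### Descent of universal pairings -/

/-- The system `Z ↦ (C ⊠ Z ⟶ Y)` of pairings of `C` with values in `Y`. -/
abbrev pairing (C Y : B) : PullSystem.{w, v, u, w, v} B :=
  PullSystem.restrict (pairR C) (PullSystem.restrict T.tensor (PullSystem.hom Y))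

/-- The pairing `C ⊠ (D ⊠ Y) ⟶ (C ⊠ D) ⊠ Y ⟶ I ⊠ Y ⟶ Y` obtained from a pairing `C ⊠ D ⟶ I`. -/
abbrev tensorPairing {C D : B} (ev : T.obj C D ⟶ T.unit) (Y : B) : T.obj C (T.obj D Y) ⟶ Y :=
  T.asInv C D Y ≫ T.wr ev Y ≫ T.lu Y

/-- Universal pairings descend along 2-condensations in the first variable. The same pairing `ev'` is
universal with coefficients in every `Y`, because tensoring with `Y` is a morphism of condensations
of systems and so preserves matched condensations and linear objects. -/
theorem exists_universal (hB : LocallyIdempotentComplete B) (hsplit : AllTwoCondensationMonadsSplit B)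
    {C A D : B} (K : TwoCondensation C A) (ev : T.obj C D ⟶ T.unit)
    (h : (T.pairing C T.unit).Universal (D := D) ev)
    (h' : ∀ Y, (T.pairing C Y).Universal (D := T.obj D Y) (T.tensorPairing ev Y)) :
    ∃ (D' : B) (ev' : T.obj A D' ⟶ T.unit), (T.pairing A T.unit).Universal (D := D') ev' ∧
      ∀ Y, (T.pairing A Y).Universal (D := T.obj D' Y) (T.tensorPairing ev' Y) := by
  obtain ⟨D', L, m, ev', ⟨l⟩⟩ := PullCond.exists_matched_linear
    (PullSystem.firstCond (PullSystem.restrict T.tensor (PullSystem.hom T.unit)) K) hsplit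
    (fun Z => hB _ _) h
  refine ⟨D', ev', l.universal m h (fun X => hB _ _), fun Y => ?_⟩
  exact (((T.tensorHom Y).firstCondHom K).mapLinear m l).universal _ (h' Y) (fun X => hB _ _)

end MonoidalData

/-! ### The homotopy category -/

/-- The homotopy category of a monoidal 2-category: its morphisms are the isomorphism classes of
1-morphisms. It is a structure and not a type synonym, so that its composition does not compete with
that of the bicategory. -/
structure Ho {B : Type u} [Bicategory.{w, v} B] {T : MonoidalData B} (h : T.Coherence) where
  /-- an object of the 2-category, as an object of the homotopy category -/
  of ::
  /-- the underlying object of the 2-category -/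
  as : B

namespace Ho

variable {B : Type u} [Bicategory.{w, v} B] {T : MonoidalData B} {h : T.Coherence}

instance : CategoryStruct.{v} (Ho h) where
  Hom X Y := Quotient (isIsomorphicSetoid (X.as ⟶ Y.as))
  id X := Quotient.mk _ (𝟙 X.as)
  comp := Quotient.map₂ (fun f g => f ≫ g) (by
    rintro f f' ⟨i⟩ g g' ⟨j⟩
    exact ⟨whiskerRightIso i g ≪≫ whiskerLeftIso f' j⟩)

variable (h) in
/-- The class of a 1-morphism. -/
def cls {a b : B} (f : a ⟶ b) : (⟨a⟩ : Ho h) ⟶ ⟨b⟩ := Quotient.mk _ f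

lemma cls_sound {a b : B} {f g : a ⟶ b} (i : f ≅ g) : cls h f = cls h g := Quotient.sound ⟨i⟩

lemma cls_exact {a b : B} {f g : a ⟶ b} (i : cls h f = cls h g) : Nonempty (f ≅ g) :=
  Quotient.exact i

instance : Category.{v} (Ho h) where
  id_comp := by rintro _ _ ⟨f⟩; exact cls_sound (λ_ f)
  comp_id := by rintro _ _ ⟨f⟩; exact cls_sound (ρ_ f)
  assoc := by rintro _ _ _ _ ⟨f⟩ ⟨g⟩ ⟨k⟩; exact cls_sound (α_ f g k)

/-- An equivalence of the 2-category becomes an isomorphism. -/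
def mkIso {a b : B} (f : a ⟶ b) (g : b ⟶ a) (i : f ≫ g ≅ 𝟙 a) (j : g ≫ f ≅ 𝟙 b) :
    (⟨a⟩ : Ho h) ≅ ⟨b⟩ where
  hom := cls h f
  inv := cls h g
  hom_inv_id := cls_sound i
  inv_hom_id := cls_sound j

section Components

open Pseudofunctor

variable {A : Type u₁} [Bicategory.{w₁, v₁} A] {F G : A ⥤ᵖ B}

/-- A component of an invertible modification. -/
def modApp {η θ : F ⟶ G} (m : η ≅ θ) (a : A) : η.app a ≅ θ.app a where
  hom := m.hom.as.app a
  inv := m.inv.as.app a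
  hom_inv_id := congrArg (fun x => x.as.app a) m.hom_inv_id
  inv_hom_id := congrArg (fun x => x.as.app a) m.inv_hom_id

/-- The components of an equivalence of pseudofunctors become isomorphisms. -/
abbrev appIso (e : F ≌ G) (a : A) : (⟨F.obj a⟩ : Ho h) ≅ ⟨G.obj a⟩ :=
  mkIso (e.hom.app a) (e.inv.app a) (modApp e.unit a).symm (modApp e.counit a)

end Components

instance : MonoidalCategoryStruct (Ho h) where
  tensorObj X Y := ⟨T.obj X.as Y.as⟩
  tensorHom {X Y Z W} := Quotient.map₂ (fun f g => T.map f g) (by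
    rintro f f' ⟨i⟩ g g' ⟨j⟩
    exact ⟨T.map₂Iso i j⟩)
  whiskerLeft X _ _ := Quotient.map (fun f => T.wl X.as f) (by
    rintro f f' ⟨i⟩
    exact ⟨T.wl₂ _ i⟩)
  whiskerRight f Y := Quotient.map (fun f => T.wr f Y.as) (by
    rintro f f' ⟨i⟩
    exact ⟨T.wr₂ i _⟩) f
  tensorUnit := ⟨T.unit⟩
  associator X Y Z := appIso T.associator ((X.as, Y.as), Z.as)
  leftUnitor X := appIso T.leftUnitor X.as
  rightUnitor X := appIso T.rightUnitor X.as

/-- The pentagon and triangle identities hold because of the pentagonator and the middle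
2-unitor. -/
instance : MonoidalCategory (Ho h) :=
  MonoidalCategory.ofTensorHom
    (id_tensorHom_id := fun X Y => cls_sound (T.mapId X.as Y.as))
    (id_tensorHom := by rintro X _ _ ⟨f⟩; rfl)
    (tensorHom_id := by rintro _ _ ⟨f⟩ Y; rfl)
    (tensorHom_comp_tensorHom := by
      rintro _ _ _ _ _ _ ⟨f⟩ ⟨f'⟩ ⟨g⟩ ⟨g'⟩
      exact cls_sound (T.mapComp f g f' g').symm)
    (associator_naturality := by
      rintro _ _ _ _ _ _ ⟨f⟩ ⟨f'⟩ ⟨f''⟩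
      exact cls_sound (T.asNat f f' f''))
    (leftUnitor_naturality := by
      rintro _ _ ⟨f⟩
      exact cls_sound (T.luNat f))
    (rightUnitor_naturality := by
      rintro _ _ ⟨f⟩
      exact cls_sound (T.ruNat f))
    (pentagon := fun _ _ _ _ => cls_sound (h.pentagonator _ _ _ _))
    (triangle := fun _ _ => cls_sound (h.middle _ _))

open MonoidalCategory

/-- A right dual becomes a dual in the homotopy category. -/
abbrev exactPairing {C : B} (R : T.RightDual C) : ExactPairing (⟨R.dual⟩ : Ho h) ⟨C⟩ where
  coevaluation' := cls h R.coev
  evaluation' := cls h R.ev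
  coevaluation_evaluation' := by
    have e := cls_sound (h := h) R.snake_left.some
    change (ρ_ (⟨C⟩ : Ho h)).inv ≫ _ ◁ cls h R.coev ≫ (α_ (⟨C⟩ : Ho h) ⟨R.dual⟩ ⟨C⟩).inv ≫
      cls h R.ev ▷ _ ≫ (λ_ (⟨C⟩ : Ho h)).hom = 𝟙 _ at e
    rw [Iso.inv_comp_eq, ← Category.assoc, ← Category.assoc, ← Iso.eq_comp_inv] at e
    simpa using e
  evaluation_coevaluation' := by
    have e := cls_sound (h := h) R.snake_right.some
    change (λ_ (⟨R.dual⟩ : Ho h)).inv ≫ cls h R.coev ▷ _ ≫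
      (α_ (⟨R.dual⟩ : Ho h) ⟨C⟩ ⟨R.dual⟩).hom ≫ _ ◁ cls h R.ev ≫
        (ρ_ (⟨R.dual⟩ : Ho h)).hom = 𝟙 _ at e
    rw [Iso.inv_comp_eq, ← Category.assoc, ← Category.assoc, ← Iso.eq_comp_inv] at e
    simpa using e

end Ho

/-! ### Evaluations of right duals are universal -/

/-- A family of 1-morphisms between the values of two pseudofunctors with invertible naturality
squares which are natural in 2-morphisms; no compatibility with composition is asked for. -/
structure NatFamily {B : Type u₁} [Bicategory.{w₁, v₁} B] {C : Type u₂} [Bicategory.{w₂, v₂} C]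
    (F G : B ⥤ᵖ C) where
  /-- the 1-morphisms -/
  app (X : B) : F.obj X ⟶ G.obj X
  /-- the naturality squares -/
  nat {X Y : B} (f : X ⟶ Y) : F.map f ≫ app Y ≅ app X ≫ G.map f
  nat_nat {X Y : B} {f g : X ⟶ Y} (η : f ⟶ g) :
    F.map₂ η ▷ app Y ≫ (nat g).hom = (nat f).hom ≫ app X ◁ G.map₂ η

namespace NatFamily

/-- The composite of two families. -/
abbrev comp {B : Type u₁} [Bicategory.{w₁, v₁} B] {C : Type u₂} [Bicategory.{w₂, v₂} C]
    {F G H : B ⥤ᵖ C} (s : NatFamily F G) (t : NatFamily G H) : NatFamily F H where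
  app X := s.app X ≫ t.app X
  nat f := paste (s.nat f) (t.nat f)
  nat_nat {X Y f g} η := by
    have h := s.nat_nat η
    have h' := t.nat_nat η
    simp only [paste, Iso.trans_hom, Iso.symm_hom, whiskerRightIso_hom, whiskerLeftIso_hom,
      Category.assoc, whiskerRight_comp, comp_whiskerLeft]
    rw [Iso.hom_inv_id_assoc]
    simp only [← comp_whiskerRight_assoc, h]
    simp only [comp_whiskerRight, Category.assoc, whisker_assoc, Iso.inv_hom_id_assoc,
      ← whiskerLeft_comp_assoc, h']

variable {B : Type u} [Bicategory.{w, v} B]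

/-- The functor `G ↦ L G ≫ e`, which is the transposition functor of an adjunction if `e` is a
counit. -/
abbrev transpose {L R : B ⥤ᵖ B} {Y : B} (e : L.obj (R.obj Y) ⟶ Y) (X : B) :
    (X ⟶ R.obj Y) ⥤ (L.obj X ⟶ Y) where
  obj G := L.map G ≫ e
  map n := L.map₂ n ▷ e

/-- If the triangle composites are isomorphic to identities, without any coherence between these
isomorphisms, then transposition is an equivalence of categories. -/
theorem isEquivalence_transpose {L R : B ⥤ᵖ B} {X Y : B} (s : X ⟶ R.obj (L.obj X))
    (s' : R.obj Y ⟶ R.obj (L.obj (R.obj Y))) (e : L.obj (R.obj Y) ⟶ Y)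
    (e' : L.obj (R.obj (L.obj X)) ⟶ L.obj X)
    (n₁ : ∀ G : X ⟶ R.obj Y, G ≫ s' ≅ s ≫ R.map (L.map G))
    (hn₁ : ∀ {G G' : X ⟶ R.obj Y} (n : G ⟶ G'),
      n ▷ s' ≫ (n₁ G').hom = (n₁ G).hom ≫ s ◁ R.map₂ (L.map₂ n))
    (n₂ : ∀ F : L.obj X ⟶ Y, L.map (R.map F) ≫ e ≅ e' ≫ F)
    (hn₂ : ∀ {F F' : L.obj X ⟶ Y} (n : F ⟶ F'),
      L.map₂ (R.map₂ n) ▷ e ≫ (n₂ F').hom = (n₂ F).hom ≫ e' ◁ n)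
    (h₁ : L.map s ≫ e' ≅ 𝟙 (L.obj X)) (h₂ : s' ≫ R.map e ≅ 𝟙 (R.obj Y)) :
    (transpose e X : (X ⟶ R.obj Y) ⥤ (L.obj X ⟶ Y)).IsEquivalence := by
  let Ψ : (L.obj X ⟶ Y) ⥤ (X ⟶ R.obj Y) :=
    { obj := fun F => s ≫ R.map F
      map := fun n => s ◁ R.map₂ n }
  refine (CategoryTheory.Equivalence.mk (transpose e X) Ψ
    (NatIso.ofComponents (fun G => (ρ_ G).symm ≪≫ whiskerLeftIso G h₂.symm ≪≫
      (α_ _ _ _).symm ≪≫ whiskerRightIso (n₁ G) (R.map e) ≪≫ α_ _ _ _ ≪≫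
      whiskerLeftIso _ (R.mapComp (L.map G) e).symm) ?_)
    (NatIso.ofComponents (fun F => whiskerRightIso (L.mapComp s (R.map F)) _ ≪≫
      α_ _ _ _ ≪≫ whiskerLeftIso (L.map s) (n₂ F) ≪≫ (α_ _ _ _).symm ≪≫
      whiskerRightIso h₁ F ≪≫ λ_ F) ?_)).isEquivalence_functor
  · intro G G' n
    have h : n ▷ s' ▷ R.map e ≫ (n₁ G').hom ▷ R.map e =
        (n₁ G).hom ▷ R.map e ≫ (s ◁ R.map₂ (L.map₂ n)) ▷ R.map e := by
      simp only [← comp_whiskerRight, hn₁]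
    have h' : n ≫ (ρ_ G').inv ≫ G' ◁ h₂.inv ≫ (α_ G' s' (R.map e)).inv =
        (ρ_ G).inv ≫ G ◁ h₂.inv ≫ (α_ G s' (R.map e)).inv ≫ n ▷ s' ▷ R.map e := by
      rw [← associator_inv_naturality_left, whisker_exchange_assoc]
      simp
    simp [Ψ, reassoc_of% h, reassoc_of% h']
  · intro F F' n
    have h : L.map s ◁ L.map₂ (R.map₂ n) ▷ e ≫ L.map s ◁ (n₂ F').hom =
        L.map s ◁ (n₂ F).hom ≫ L.map s ◁ e' ◁ n := by
      simp only [← whiskerLeft_comp, hn₂]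
    have h' : L.map s ◁ e' ◁ n ≫ (α_ (L.map s) e' F').inv ≫ h₁.hom ▷ F' ≫ (λ_ F').hom =
        (α_ (L.map s) e' F).inv ≫ h₁.hom ▷ F ≫ (λ_ F).hom ≫ n := by
      rw [associator_inv_naturality_right_assoc, whisker_exchange_assoc]
      simp
    simp [Ψ, reassoc_of% h, h']

end NatFamily

namespace MonoidalData

variable {B : Type u} [Bicategory.{w, v} B] (T : MonoidalData B)

/-- The pseudofunctor `C ⊠ -`. -/
abbrev tensorL (C : B) : B ⥤ᵖ B := (pairR C).comp T.tensor

section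

variable {a a' a'' b b' b'' c c' : B}

/-- The tensor product of 2-morphisms. -/
abbrev ten {f f' : a ⟶ a'} {g g' : b ⟶ b'} (η : f ⟶ f') (θ : g ⟶ g') : T.map f g ⟶ T.map f' g' :=
  T.tensor.map₂ (η ×ₘ θ)

lemma ten_comp {f f' f'' : a ⟶ a'} {g g' g'' : b ⟶ b'} (η : f ⟶ f') (η' : f' ⟶ f'') (θ : g ⟶ g')
    (θ' : g' ⟶ g'') : T.ten (η ≫ η') (θ ≫ θ') = T.ten η θ ≫ T.ten η' θ' :=
  T.tensor.map₂_comp (f := f ×ₘ g) (g := f' ×ₘ g') (h := f'' ×ₘ g'') (η ×ₘ θ) (η' ×ₘ θ')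

lemma ten_id (f : a ⟶ a') (g : b ⟶ b') : T.ten (𝟙 f) (𝟙 g) = 𝟙 (T.map f g) :=
  T.map₂_id_id f g

lemma ten_whiskerRight {f f' : a ⟶ a'} {g g' : b ⟶ b'} (η : f ⟶ f') (θ : g ⟶ g') (k : a' ⟶ a'')
    (l : b' ⟶ b'') : T.ten η θ ▷ T.map k l ≫ (T.mapComp f' k g' l).inv =
      (T.mapComp f k g l).inv ≫ T.ten (η ▷ k) (θ ▷ l) := by
  rw [Iso.eq_inv_comp, ← Category.assoc, Iso.comp_inv_eq]
  have h := T.tensor.map₂_whisker_right (f := f ×ₘ g) (g := f' ×ₘ g') (η ×ₘ θ) (k ×ₘ l) =≫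
    (T.mapComp f' k g' l).hom
  simp only [Category.assoc, Iso.inv_hom_id, Category.comp_id] at h
  exact h.symm

lemma ten_whiskerLeft (k : a ⟶ a') (l : b ⟶ b') {f f' : a' ⟶ a''} {g g' : b' ⟶ b''} (η : f ⟶ f')
    (θ : g ⟶ g') : T.ten (k ◁ η) (l ◁ θ) ≫ (T.mapComp k f' l g').hom =
      (T.mapComp k f l g).hom ≫ T.map k l ◁ T.ten η θ := by
  have h := T.tensor.map₂_whisker_left (k ×ₘ l) (g := f ×ₘ g) (h := f' ×ₘ g') (η ×ₘ θ) =≫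
    (T.mapComp k f' l g').hom
  simp only [Category.assoc, Iso.inv_hom_id, Category.comp_id] at h
  exact h

/-- Pseudonaturality of the inverse associator. -/
abbrev asInvNat (f : a ⟶ a') (g : b ⟶ b') (k : c ⟶ c') :
    T.map f (T.map g k) ≫ T.asInv a' b' c' ≅ T.asInv a b c ≫ T.map (T.map f g) k :=
  T.associator.inv.naturality ((f ×ₘ g) ×ₘ k)

lemma asNat_ten {f f' : a ⟶ a'} {g g' : b ⟶ b'} {k k' : c ⟶ c'} (η : f ⟶ f') (θ : g ⟶ g')
    (κ : k ⟶ k') : T.ten (T.ten η θ) κ ▷ T.as a' b' c' ≫ (T.asNat f' g' k').hom =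
      (T.asNat f g k).hom ≫ T.as a b c ◁ T.ten η (T.ten θ κ) :=
  T.associator.hom.naturality_naturality
    (a := ((a, b), c)) (b := ((a', b'), c')) (f := (f ×ₘ g) ×ₘ k) (g := (f' ×ₘ g') ×ₘ k')
    ((η ×ₘ θ) ×ₘ κ)

lemma asInvNat_ten {f f' : a ⟶ a'} {g g' : b ⟶ b'} {k k' : c ⟶ c'} (η : f ⟶ f') (θ : g ⟶ g')
    (κ : k ⟶ k') : T.ten η (T.ten θ κ) ▷ T.asInv a' b' c' ≫ (T.asInvNat f' g' k').hom =
      (T.asInvNat f g k).hom ≫ T.asInv a b c ◁ T.ten (T.ten η θ) κ :=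
  T.associator.inv.naturality_naturality
    (a := ((a, b), c)) (b := ((a', b'), c')) (f := (f ×ₘ g) ×ₘ k) (g := (f' ×ₘ g') ×ₘ k')
    ((η ×ₘ θ) ×ₘ κ)

end

/-- The 1-morphisms `f ⊠ X`, as a family in `X`. -/
abbrev wrFamily {C D : B} (f : C ⟶ D) : NatFamily (T.tensorL C) (T.tensorL D) where
  app X := T.wr f X
  nat k := (T.mapComp (𝟙 C) f k (𝟙 _)).symm ≪≫
    T.map₂Iso (λ_ f ≪≫ (ρ_ f).symm) (ρ_ k ≪≫ (λ_ k).symm) ≪≫ T.mapComp f (𝟙 D) (𝟙 _) k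
  nat_nat {X Y k l} η := by
    change T.ten (𝟙 (𝟙 C)) η ▷ T.wr f Y ≫ (T.mapComp (𝟙 C) f l (𝟙 Y)).inv ≫
        T.ten ((λ_ f).hom ≫ (ρ_ f).inv) ((ρ_ l).hom ≫ (λ_ l).inv) ≫
          (T.mapComp f (𝟙 D) (𝟙 X) l).hom = ((T.mapComp (𝟙 C) f k (𝟙 Y)).inv ≫
        T.ten ((λ_ f).hom ≫ (ρ_ f).inv) ((ρ_ k).hom ≫ (λ_ k).inv) ≫
          (T.mapComp f (𝟙 D) (𝟙 X) k).hom) ≫ T.wr f X ◁ T.ten (𝟙 (𝟙 D)) η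
    have h₁ := T.ten_whiskerRight (𝟙 (𝟙 C)) η f (𝟙 Y)
    have h₂ := T.ten_whiskerLeft f (𝟙 X) (𝟙 (𝟙 D)) η
    rw [reassoc_of% h₁, Category.assoc, Category.assoc, ← h₂, ← Category.assoc (T.ten _ _),
      ← Category.assoc (T.ten _ _) (T.ten _ _), ← T.ten_comp, ← T.ten_comp]
    simp

/-- The left unitor, as a family. -/
abbrev luFamily : NatFamily (T.tensorL T.unit) (Pseudofunctor.id B) where
  app X := T.lu X
  nat f := T.leftUnitor.hom.naturality f
  nat_nat η := T.leftUnitor.hom.naturality_naturality η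

/-- The inverse left unitor, as a family. -/
abbrev luInvFamily : NatFamily (Pseudofunctor.id B) (T.tensorL T.unit) where
  app X := T.luInv X
  nat f := T.leftUnitor.inv.naturality f
  nat_nat η := T.leftUnitor.inv.naturality_naturality η

/-- The associator, as a family in the third variable. -/
abbrev asFamily (C D : B) :
    NatFamily (T.tensorL (T.obj C D)) ((T.tensorL D).comp (T.tensorL C)) where
  app X := T.as C D X
  nat f := T.asNat₃ C D f
  nat_nat {X Y f g} η := by
    have h := T.asNat_ten (𝟙 (𝟙 C)) (𝟙 (𝟙 D)) η
    change T.ten (𝟙 _) η ▷ T.as C D Y ≫ T.ten (T.mapId C D).inv (𝟙 g) ▷ T.as C D Y ≫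
        (T.asNat (𝟙 C) (𝟙 D) g).hom = (T.ten (T.mapId C D).inv (𝟙 f) ▷ T.as C D Y ≫
        (T.asNat (𝟙 C) (𝟙 D) f).hom) ≫ T.as C D X ◁ T.ten (𝟙 (𝟙 C)) (T.ten (𝟙 (𝟙 D)) η)
    rw [← comp_whiskerRight_assoc, ← T.ten_comp, Category.assoc, ← h, ← comp_whiskerRight_assoc,
      ← T.ten_comp, T.ten_id]
    simp

/-- The inverse associator, as a family in the third variable. -/
abbrev asInvFamily (C D : B) :
    NatFamily ((T.tensorL D).comp (T.tensorL C)) (T.tensorL (T.obj C D)) where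
  app X := T.asInv C D X
  nat f := T.asInvNat (𝟙 C) (𝟙 D) f ≪≫ whiskerLeftIso _ (T.map₂Iso (T.mapId C D) (Iso.refl f))
  nat_nat {X Y f g} η := by
    have h := T.asInvNat_ten (𝟙 (𝟙 C)) (𝟙 (𝟙 D)) η
    change T.ten (𝟙 (𝟙 C)) (T.ten (𝟙 (𝟙 D)) η) ▷ T.asInv C D Y ≫
        (T.asInvNat (𝟙 C) (𝟙 D) g).hom ≫ T.asInv C D X ◁ T.ten (T.mapId C D).hom (𝟙 g) =
      ((T.asInvNat (𝟙 C) (𝟙 D) f).hom ≫ T.asInv C D X ◁ T.ten (T.mapId C D).hom (𝟙 f)) ≫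
        T.asInv C D X ◁ T.ten (𝟙 _) η
    rw [reassoc_of% h, ← whiskerLeft_comp, ← T.ten_comp, Category.assoc, ← whiskerLeft_comp,
      ← T.ten_comp, T.ten_id]
    simp

end MonoidalData

open MonoidalCategory in
/-- The triangle identities of the adjunction `C ⊗ - ⊣ D ⊗ -` given by a dual pair. -/
lemma exactPairing_triangles {V : Type u} [Category.{v} V] [MonoidalCategory V] (D C : V)
    [ExactPairing D C] (X : V) :
    C ◁ ((λ_ X).inv ≫ η_ D C ▷ X ≫ (α_ D C X).hom) ≫
        (α_ C D (C ⊗ X)).inv ≫ ε_ D C ▷ (C ⊗ X) ≫ (λ_ (C ⊗ X)).hom = 𝟙 (C ⊗ X) ∧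
      ((λ_ (D ⊗ X)).inv ≫ η_ D C ▷ (D ⊗ X) ≫ (α_ D C (D ⊗ X)).hom) ≫
        D ◁ ((α_ C D X).inv ≫ ε_ D C ▷ X ≫ (λ_ X).hom) = 𝟙 (D ⊗ X) := by
  constructor
  · have e := (tensorLeftHomEquiv X D C (C ⊗ X)).left_inv (𝟙 _)
    simpa [tensorLeftHomEquiv] using e
  · have e := (tensorLeftHomEquiv (D ⊗ X) D C X).right_inv (𝟙 _)
    simpa [tensorLeftHomEquiv] using e

open MonoidalCategory in
/-- The evaluation of a dual pair, written through the counit of the adjunction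
`C ⊗ - ⊣ D ⊗ -` at the unit object. -/
lemma whiskerLeft_rightUnitor_evaluation {V : Type u} [Category.{v} V] [MonoidalCategory V]
    {D C : V} (e : C ⊗ D ⟶ 𝟙_ V) :
    C ◁ (ρ_ D).inv ≫ (α_ C D (𝟙_ V)).inv ≫ e ▷ (𝟙_ V) ≫ (λ_ (𝟙_ V)).hom = e := by
  rw [MonoidalCategory.unitors_equal, MonoidalCategory.rightUnitor_naturality]
  simp

/-- Composition with an equivalence is an equivalence of categories. -/
lemma isEquivalence_postcomp {B : Type u} [Bicategory.{w, v} B] (X : B) {D D' : B} (k : D' ⟶ D)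
    (l : D ⟶ D') (i : k ≫ l ≅ 𝟙 D') (j : l ≫ k ≅ 𝟙 D) :
    (Bicategory.postcomp X k).IsEquivalence :=
  (CategoryTheory.Equivalence.mk (Bicategory.postcomp X k) (Bicategory.postcomp X l)
    (NatIso.ofComponents
      (fun G => (ρ_ G).symm ≪≫ whiskerLeftIso G i.symm ≪≫ (α_ G k l).symm) (by
        intro G G' n
        have h := whisker_exchange n i.inv
        change n ≫ (ρ_ G').inv ≫ G' ◁ i.inv ≫ (α_ G' k l).inv =
          ((ρ_ G).inv ≫ G ◁ i.inv ≫ (α_ G k l).inv) ≫ n ▷ k ▷ l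
        rw [Category.assoc, Category.assoc, ← associator_inv_naturality_left, reassoc_of% h]
        simp))
    (NatIso.ofComponents
      (fun G => α_ G l k ≪≫ whiskerLeftIso G j ≪≫ ρ_ G) (by
        intro G G' n
        have h := whisker_exchange n j.hom
        change n ▷ l ▷ k ≫ (α_ G' l k).hom ≫ G' ◁ j.hom ≫ (ρ_ G').hom =
          ((α_ G l k).hom ≫ G ◁ j.hom ≫ (ρ_ G).hom) ≫ n
        rw [associator_naturality_left_assoc, ← reassoc_of% h]
        simp))).isEquivalence_functor

/-- Universality is invariant under pullback along an equivalence of the base and under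
isomorphism. -/
lemma PullSystem.Universal.of_equivalence {B : Type u} [Bicategory.{w, v} B]
    {P : PullSystem.{w, v, u, v₁, u₁} B} {D D' : B} {z : P.cat D}
    (hz : P.Universal z) (k : D' ⟶ D) (l : D ⟶ D') (i : k ≫ l ≅ 𝟙 D') (j : l ≫ k ≅ 𝟙 D)
    {z' : P.cat D'} (a : (P.pull k).obj z ≅ z') : P.Universal z' := by
  intro X
  have := hz X
  have := isEquivalence_postcomp X k l i j
  refine Functor.isEquivalence_of_iso (F := Bicategory.postcomp X k ⋙ P.eval z X)
    (NatIso.ofComponents (fun G => P.c G k z ≪≫ (P.pull G).mapIso a) ?_)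
  intro G G' n
  have h := P.pull₂_nat n a.hom
  change P.pull₂ (n ▷ k) z ≫ (P.c G' k z).hom ≫ (P.pull G').map a.hom =
    ((P.c G k z).hom ≫ (P.pull G).map a.hom) ≫ P.pull₂ n z'
  rw [reassoc_of% P.c_left, Category.assoc, h]

namespace MonoidalData

variable {B : Type u} [Bicategory.{w, v} B] {T : MonoidalData B}

/-- The evaluation of a right dual is universal, with coefficients in every object: `C ⊠ -` is left
adjoint to `D ⊠ -`, and the triangle composites are isomorphic to identities because they are
identities in the homotopy category. -/
theorem RightDual.universal_tensorPairing (h : T.Coherence) {C : B} (R : T.RightDual C) (Y : B) :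
    (T.pairing C Y).Universal (D := T.obj R.dual Y) (T.tensorPairing R.ev Y) := by
  intro X
  let s : NatFamily (Pseudofunctor.id B) ((T.tensorL C).comp (T.tensorL R.dual)) :=
    (T.luInvFamily).comp ((T.wrFamily R.coev).comp (T.asFamily R.dual C))
  let e : NatFamily ((T.tensorL R.dual).comp (T.tensorL C)) (Pseudofunctor.id B) :=
    (T.asInvFamily C R.dual).comp ((T.wrFamily R.ev).comp T.luFamily)
  let := Ho.exactPairing (h := h) R
  obtain ⟨h₁⟩ := Ho.cls_exact (h := h) (f := (T.tensorL C).map (s.app X) ≫ e.app (T.obj C X))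
    (g := 𝟙 _) (exactPairing_triangles (⟨R.dual⟩ : Ho h) ⟨C⟩ ⟨X⟩).1
  obtain ⟨h₂⟩ := Ho.cls_exact (h := h) (f := s.app (T.obj R.dual Y) ≫
    (T.tensorL R.dual).map (e.app Y)) (g := 𝟙 _)
    (exactPairing_triangles (⟨R.dual⟩ : Ho h) ⟨C⟩ ⟨Y⟩).2
  exact NatFamily.isEquivalence_transpose (L := T.tensorL C) (R := T.tensorL R.dual)
    (X := X) (Y := Y) (s.app X) (s.app _) (e.app Y) (e.app _) (fun G => s.nat G)
    (fun n => s.nat_nat n) (fun F => e.nat F) (fun n => e.nat_nat n) h₁ h₂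

/-- The evaluation of a right dual is universal. Up to the right unitor of the dual it is the pairing
with coefficients in the unit object. -/
theorem RightDual.universal_ev (h : T.Coherence) {C : B} (R : T.RightDual C) :
    (T.pairing C T.unit).Universal (D := R.dual) R.ev := by
  obtain ⟨a⟩ := Ho.cls_exact (h := h)
    (f := T.wl C (T.ruInv R.dual) ≫ T.tensorPairing R.ev T.unit) (g := R.ev)
    (whiskerLeft_rightUnitor_evaluation (V := Ho h) (C := ⟨C⟩) (D := ⟨R.dual⟩)
      (Ho.cls h R.ev : (⟨T.obj C R.dual⟩ : Ho h) ⟶ ⟨T.unit⟩))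
  exact (R.universal_tensorPairing h T.unit).of_equivalence (P := T.pairing C T.unit)
    (T.ruInv R.dual) (T.ru R.dual) (Ho.modApp T.rightUnitor.counit R.dual)
    (Ho.modApp T.rightUnitor.unit R.dual).symm a

end MonoidalData

/-! ### Right duals from universal pairings -/

open MonoidalCategory in
/-- If one of the two snake composites of `η` and `e` is the identity, then the other one is fixed
by `e`. -/
lemma snake_comp_evaluation {V : Type u} [Category.{v} V] [MonoidalCategory V] {A D : V}
    (η : 𝟙_ V ⟶ D ⊗ A) (e : A ⊗ D ⟶ 𝟙_ V)
    (hs : A ◁ η ≫ (α_ A D A).inv ≫ e ▷ A ≫ (λ_ A).hom = (ρ_ A).hom) :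
    A ◁ ((λ_ D).inv ≫ η ▷ D ≫ (α_ D A D).hom ≫ D ◁ e ≫ (ρ_ D).hom) ≫ e = e := by
  obtain ⟨x, hx⟩ : ∃ x : A ⊗ 𝟙_ V ⟶ A, x = A ◁ η ≫ (α_ A D A).inv ≫ e ▷ A ≫ (λ_ A).hom :=
    ⟨_, rfl⟩
  calc
    _ = 𝟙 _ ⊗≫ A ◁ η ▷ D ⊗≫ ((A ⊗ D) ◁ e ≫ e ▷ (𝟙_ V)) ⊗≫ 𝟙 _ := by
      rw [MonoidalCategory.whiskerRight_id]; monoidal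
    _ = 𝟙 _ ⊗≫ x ▷ D ⊗≫ e := by
      rw [MonoidalCategory.whisker_exchange, hx]; monoidal
    _ = e := by
      rw [hx, hs]; monoidal

namespace MonoidalData

variable {B : Type u} [Bicategory.{w, v} B] {T : MonoidalData B}

/-- A universal pairing whose tensor product with `A` is universal as well exhibits a right
dual. -/
theorem exists_rightDual (h : T.Coherence) {A D : B} (ev : T.obj A D ⟶ T.unit)
    (hev : (T.pairing A T.unit).Universal (D := D) ev)
    (hev' : (T.pairing A A).Universal (D := T.obj D A) (T.tensorPairing ev A)) :
    Nonempty (T.RightDual A) := by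
  have := hev' T.unit
  have := hev D
  -- The coevaluation is the 1-morphism that corresponds to the right unitor of `A`.
  let F := (T.pairing A A).eval (D := T.obj D A) (T.tensorPairing ev A) T.unit
  let coev : T.unit ⟶ T.obj D A := F.objPreimage (T.ru A)
  have i : T.wl A coev ≫ T.tensorPairing ev A ≅ T.ru A := F.objObjPreimageIso (T.ru A)
  have hs := Ho.cls_sound (h := h) i
  -- The second snake composite is isomorphic to the identity because it becomes so after pullback
  -- of the universal pairing.
  let s : D ⟶ D := T.luInv D ≫ T.wr coev D ≫ T.as D A D ≫ T.wl D ev ≫ T.ru D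
  have hs' := snake_comp_evaluation (V := Ho h) (A := ⟨A⟩) (D := ⟨D⟩) (Ho.cls h coev)
    (Ho.cls h ev) hs
  obtain ⟨j⟩ := Ho.cls_exact (h := h) (f := T.wl A s ≫ ev) (g := ev) hs'
  have k : ((T.pairing A T.unit).eval (D := D) ev D).obj s ≅
      ((T.pairing A T.unit).eval (D := D) ev D).obj (𝟙 D) :=
    j ≪≫ ((T.pairing A T.unit).ι (Z := D) ev).symm
  refine ⟨⟨D, ev, coev, ?_, ⟨Functor.preimageIso _ k⟩⟩⟩
  refine Ho.cls_exact (h := h) ?_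
  exact (congrArg (fun x => Ho.cls h (T.ruInv A) ≫ x) hs).trans
    (Ho.cls_sound (Ho.modApp T.rightUnitor.counit A))

end MonoidalData

end TwoCat

end

theorem mainTheorem9 {B : Type u} [Bicategory.{w, v} B] [TwoCat.MonoidalTwoCategory B]
    (hB : TwoCat.LocallyIdempotentComplete B)
    (hsplit : TwoCat.AllTwoCondensationMonadsSplit B)
    (C : B) (hC : TwoCat.HasRightDual C)
    (M : TwoCat.TwoCondensationMonad C) (S : M.Splitting) :
    TwoCat.HasRightDual S.obj := by
  obtain ⟨R⟩ := hC
  have h := TwoCat.MonoidalTwoCategory.coherence (B := B)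
  obtain ⟨D, ev, hev, hev'⟩ := TwoCat.MonoidalData.exists_universal _ hB hsplit S.condensation R.ev
    (R.universal_ev h) (R.universal_tensorPairing h)
  exact TwoCat.MonoidalData.exists_rightDual h ev hev (hev' S.obj)
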